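/- A \emph{weak solenoid} of dimension $n$ is the inverse limit $\mathcal S=\varprojlim\{p_{\ell+1}\colon M_{\ell+1}\to M_\ell\}_{\ell\ge 0}$ (with the topology induced from $\prod_\ell M_\ell$) of smooth covering maps of finite degree greater than $1$ between closed connected smooth $n$-manifolds; $\Pi_0\colon\mathcal S\to M_0$ is the projection to the base. Its \emph{leaves} are its path components, with the leaf topology, which is generated by the path components of the open subsets of $\mathcal S$. A smooth Riemannian metric $g$ on $M_0$ lifts to the leaves, and so gives each leaf $L$ a length metric $d_L$ and a volume $\mathrm{Vol}$; the growth type of $L$ is that of $r\mapsto \mathrm{Vol}\{y\in L: d_L(x,y)\le r\}$, $x\in L$, where $f_1\sim f_2$ means that there are $A,B,C>0$ with $f_1(r)\le A f_2(Br)+C$ and $f_2(r)\le A f_1(Br)+C$ for all $r\ge 0$. A space is \emph{homogeneous} if its homeomorphisms act transitively on its points. $\mathcal S$ is \emph{virtually homogeneous} if there is a finite-to-one covering map $p_0'\colon M_0'\to M_0$, with $M_0'$ connected, such that the pullback $\mathcal S'=M_0'\times_{M_0}\mathcal S$ is homogeneous. Let $\mathbb H$ be the Heisenberg space, that is $\mathbb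 R^3$ with the group operation $(x,y,z)*(x',y',z')=(x+x',y+y',z+z'+xy')$. \textbf{Theorem.} There exists a weak solenoid $\mathcal S$ of dimension $3$ such that: (1) every leaf of $\mathcal S$ is a $3$-manifold and is covered by $\mathbb H$; more precisely, there are a discrete subgroup $\Gamma\subset\mathbb H$ and a surjective smooth local diffeomorphism $\pi\colon\mathbb H\to M_0$ whose fibres are the cosets $a\Gamma$ (so $M_0\cong\mathbb H/\Gamma$), and for every leaf $L$ there is a surjective covering map $f\colon\mathbb H\to L$ with $\Pi_0\circ f=\pi$; (2) for every smooth Riemannian metric $g$ on $M_0$ and every $x\in\mathcal S$, the leaf through $x$ has growth type exactly polynomial of degree $4$, i.e. its growth function at $x$ is $\sim r^4$; (3) $\mathcal S$ is not homogeneous; (4) $\mathcal S$ is not virtually homogeneous; moreover, for every finite-to-one covering $M_0'\to M_0$ with $M_0'$ connected, no connected component of the pullback $M_0'\times_{M_0}\mathcal S$ is homogeneous. -/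

import Mathlib

open Set Manifold MeasureTheory Topology
open scoped ENNReal ContDiff Bundle

noncomputable section

/-- A presentation of a weak solenoid of dimension `d`: closed connected smooth `d`-manifolds
`M ℓ` and smooth covering maps `p ℓ : M (ℓ + 1) → M ℓ`, each of a finite degree greater than `1`. -/
structure Presentation (d : ℕ) where
  M : ℕ → Type
  topologicalSpace : ∀ ℓ, TopologicalSpace (M ℓ)
  chartedSpace : ∀ ℓ, ChartedSpace (EuclideanSpace ℝ (Fin d)) (M ℓ)
  isManifold : ∀ ℓ, IsManifold (𝓡 d) ∞ (M ℓ)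
  t2Space : ∀ ℓ, T2Space (M ℓ)
  compactSpace : ∀ ℓ, CompactSpace (M ℓ)
  connectedSpace : ∀ ℓ, ConnectedSpace (M ℓ)
  p : ∀ ℓ, M (ℓ + 1) → M ℓ
  isCoveringMap : ∀ ℓ, IsCoveringMap (p ℓ)
  isLocalDiffeomorph : ∀ ℓ, IsLocalDiffeomorph (𝓡 d) (𝓡 d) ∞ (p ℓ)
  degree : ∀ ℓ, ∃ m : ℕ, 1 < m ∧ ∀ x, Nat.card (p ℓ ⁻¹' {x}) = m

attribute [instance] Presentation.topologicalSpace Presentation.chartedSpace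
  Presentation.isManifold Presentation.t2Space Presentation.compactSpace
  Presentation.connectedSpace

/-- The weak solenoid of a presentation: the inverse limit of the bonding maps, with the topology
induced from the product. -/
def Presentation.Solenoid {d : ℕ} (P : Presentation d) : Type :=
  {x : ∀ ℓ, P.M ℓ // ∀ ℓ, P.p ℓ (x (ℓ + 1)) = x ℓ}

instance {d : ℕ} (P : Presentation d) : TopologicalSpace P.Solenoid :=
  inferInstanceAs (TopologicalSpace {x : ∀ ℓ, P.M ℓ // ∀ ℓ, P.p ℓ (x (ℓ + 1)) = x ℓ})

/-- The projection of the weak solenoid onto the base manifold. -/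
def Presentation.baseProj {d : ℕ} (P : Presentation d) (x : P.Solenoid) : P.M 0 := x.1 0

/-- A space is homogeneous if its homeomorphisms act transitively on its points. -/
def IsHomogeneousSpace (X : Type*) [TopologicalSpace X] : Prop :=
  ∀ x y : X, ∃ h : X ≃ₜ X, h x = y

/-- A finite-to-one covering map with connected total space. -/
def IsFiniteConnectedCovering {M' M : Type*} [TopologicalSpace M'] [TopologicalSpace M]
    (q : M' → M) : Prop :=
  ConnectedSpace M' ∧ IsCoveringMap q ∧ ∀ x, (q ⁻¹' {x}).Finite

/-- The pullback of the weak solenoid along a map to the base: the fibre product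
`M' ×_{M 0} Solenoid`. -/
abbrev Presentation.Pullback {d : ℕ} (P : Presentation d) {M' : Type} (q : M' → P.M 0) : Type :=
  {z : M' × P.Solenoid // q z.1 = P.baseProj z.2}

/-- A weak solenoid is virtually homogeneous if its pullback along some finite covering of the
base manifold is homogeneous. -/
def Presentation.VirtuallyHomogeneous {d : ℕ} (P : Presentation d) : Prop :=
  ∃ (M' : Type) (_ : TopologicalSpace M') (q : M' → P.M 0),
    IsFiniteConnectedCovering q ∧ IsHomogeneousSpace (P.Pullback q)

/-- The leaf topology on a space: it is generated by the path components of open sets. In a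
foliated space with totally disconnected transversals these are generated by the open subsets of
the plaques. -/
@[reducible] def leafTopology (X : Type*) [TopologicalSpace X] : TopologicalSpace X :=
  TopologicalSpace.generateFrom {V | ∃ U : Set X, IsOpen U ∧ ∃ x ∈ U, V = pathComponentIn U x}

/-- The leaf through `x`: the path component of `x`, carrying the leaf topology. -/
def Leaf {X : Type*} [TopologicalSpace X] (x : X) : Type _ := {y : X // y ∈ pathComponent x}

instance {X : Type*} [TopologicalSpace X] (x : X) : TopologicalSpace (Leaf x) :=
  TopologicalSpace.induced Subtype.val (leafTopology X)

/-- The inclusion of a leaf in the ambient space. -/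
def Leaf.incl {X : Type*} [TopologicalSpace X] {x : X} (y : Leaf x) : X := y.1

/-- Smooth Riemannian metrics on a smooth manifold without boundary. -/
abbrev SmoothRiemannianMetric (d : ℕ) (M : Type*) [TopologicalSpace M]
    [ChartedSpace (EuclideanSpace ℝ (Fin d)) M] [IsManifold (𝓡 d) ∞ M] : Type _ :=
  Bundle.ContMDiffRiemannianMetric (𝓡 d) ∞ (EuclideanSpace ℝ (Fin d))
    (fun x : M => TangentSpace (𝓡 d) x)

/-- The length of a curve `c : [0, 1] → M` for the Riemannian metric `g`. -/
def SmoothRiemannianMetric.length {d : ℕ} {M : Type*} [TopologicalSpace M]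
    [ChartedSpace (EuclideanSpace ℝ (Fin d)) M] [IsManifold (𝓡 d) ∞ M]
    (g : SmoothRiemannianMetric d M) (c : ℝ → M) : ℝ≥0∞ :=
  letI : Bundle.RiemannianBundle (fun x : M => TangentSpace (𝓡 d) x) := ⟨g.toRiemannianMetric⟩
  pathELength (𝓡 d) c 0 1

/-- The leafwise metric of the weak solenoid for the leafwise Riemannian metric lifted from a
Riemannian metric `g` on the base: the infimum of the lengths of the leafwise `C^1` curves from `x`
to `y` (these are the continuous curves in the solenoid whose projection to the base is `C^1`, as
a leaf covers the base and a path never leaves its leaf). It is `∞` if there is no such curve, that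
is, if `x` and `y` lie in distinct leaves. -/
def Presentation.leafEDist {d : ℕ} (P : Presentation d) (g : SmoothRiemannianMetric d (P.M 0))
    (x y : P.Solenoid) : ℝ≥0∞ :=
  ⨅ (c : ℝ → P.Solenoid) (_ : ContinuousOn c (Icc 0 1))
    (_ : ContMDiffOn 𝓘(ℝ, ℝ) (𝓡 d) 1 (P.baseProj ∘ c) (Icc 0 1)) (_ : c 0 = x) (_ : c 1 = y),
    SmoothRiemannianMetric.length g (P.baseProj ∘ c)

/-- The `k`-dimensional Hausdorff (outer) measure of `A` for an extended distance function `ρ`.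
For the distance of a Riemannian `k`-manifold this is the Riemannian volume, up to a positive
constant that depends on `k` only. -/
def hausdorffVolume {X : Type*} (ρ : X → X → ℝ≥0∞) (k : ℕ) (A : Set X) : ℝ≥0∞ :=
  ⨆ (δ : ℝ≥0∞) (_ : 0 < δ), ⨅ (t : ℕ → Set X) (_ : A ⊆ ⋃ i, t i)
    (_ : ∀ i, ∀ x ∈ t i, ∀ y ∈ t i, ρ x y ≤ δ),
    ∑' i, ⨆ _ : (t i).Nonempty, (⨆ x ∈ t i, ⨆ y ∈ t i, ρ x y) ^ k

/-- The growth function at `x` of the leaf through `x`: the volume of the closed leafwise ball of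
radius `r`. -/
def Presentation.leafGrowth {d : ℕ} (P : Presentation d) (g : SmoothRiemannianMetric d (P.M 0))
    (x : P.Solenoid) (r : ℝ) : ℝ≥0∞ :=
  hausdorffVolume (P.leafEDist g) d {y | P.leafEDist g x y ≤ ENNReal.ofReal r}

/-- `f₁ (r) ≤ A * f₂ (B * r) + C` for all `r ≥ 0`, for some positive constants `A`, `B`, `C`. -/
def GrowthLE (f₁ f₂ : ℝ → ℝ≥0∞) : Prop :=
  ∃ A B C : ℝ, 0 < A ∧ 0 < B ∧ 0 < C ∧
    ∀ r : ℝ, 0 ≤ r → f₁ r ≤ ENNReal.ofReal A * f₂ (B * r) + ENNReal.ofReal C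

/-- The growth type is exactly polynomial of degree `k`: the function has the growth class of
`r ^ k`. -/
def HasExactPolynomialGrowth (f : ℝ → ℝ≥0∞) (k : ℕ) : Prop :=
  GrowthLE f (fun r => ENNReal.ofReal (r ^ k)) ∧ GrowthLE (fun r => ENNReal.ofReal (r ^ k)) f

/-- The Heisenberg space: `ℝ³`, as a smooth manifold, with the multiplication
`(x, y, z) * (x', y', z') = (x + x', y + y', z + z' + x y')`. -/
def Heisenberg : Type := EuclideanSpace ℝ (Fin 3)

namespace Heisenberg

instance : TopologicalSpace Heisenberg :=
  inferInstanceAs (TopologicalSpace (EuclideanSpace ℝ (Fin 3)))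

instance : ChartedSpace (EuclideanSpace ℝ (Fin 3)) Heisenberg :=
  inferInstanceAs (ChartedSpace (EuclideanSpace ℝ (Fin 3)) (EuclideanSpace ℝ (Fin 3)))

/-- The point with given coordinates. -/
def mk (x y z : ℝ) : Heisenberg := (!₂[x, y, z] : EuclideanSpace ℝ (Fin 3))

/-- The coordinates of a point. -/
def coord (a : Heisenberg) (i : Fin 3) : ℝ := (show EuclideanSpace ℝ (Fin 3) from a) i

@[simp] theorem coord_mk_zero (x y z : ℝ) : (mk x y z).coord 0 = x := rfl

@[simp] theorem coord_mk_one (x y z : ℝ) : (mk x y z).coord 1 = y := rfl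

@[simp] theorem coord_mk_two (x y z : ℝ) : (mk x y z).coord 2 = z := rfl

theorem ext_coord {a b : Heisenberg} (h0 : a.coord 0 = b.coord 0) (h1 : a.coord 1 = b.coord 1)
    (h2 : a.coord 2 = b.coord 2) : a = b := by
  refine PiLp.ext fun i => ?_
  fin_cases i
  · exact h0
  · exact h1
  · exact h2

instance : Group Heisenberg where
  mul a b := mk (a.coord 0 + b.coord 0) (a.coord 1 + b.coord 1)
    (a.coord 2 + b.coord 2 + a.coord 0 * b.coord 1)
  one := mk 0 0 0
  inv a := mk (-a.coord 0) (-a.coord 1) (-a.coord 2 + a.coord 0 * a.coord 1)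
  mul_assoc a b c := by
    change mk _ _ _ = mk _ _ _
    apply ext_coord <;> simp only [HMul.hMul, coord_mk_zero, coord_mk_one, coord_mk_two]
    · exact add_assoc _ _ _
    · exact add_assoc _ _ _
    · change a.coord 2 + b.coord 2 + a.coord 0 * b.coord 1 + c.coord 2
          + (a.coord 0 + b.coord 0) * c.coord 1
        = a.coord 2 + (b.coord 2 + c.coord 2 + b.coord 0 * c.coord 1)
          + a.coord 0 * (b.coord 1 + c.coord 1)
      ring
  one_mul a := by
    change mk (0 + a.coord 0) (0 + a.coord 1) (0 + a.coord 2 + 0 * a.coord 1) = a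
    apply ext_coord <;> simp
  mul_one a := by
    change mk (a.coord 0 + 0) (a.coord 1 + 0) (a.coord 2 + 0 + a.coord 0 * 0) = a
    apply ext_coord <;> simp
  inv_mul_cancel a := by
    change mk (-a.coord 0 + a.coord 0) (-a.coord 1 + a.coord 1)
      (-a.coord 2 + a.coord 0 * a.coord 1 + a.coord 2 + -a.coord 0 * a.coord 1) = mk 0 0 0
    apply ext_coord <;> simp

end Heisenberg

end

/-! The solenoid is the limit of the quotients `Heisenberg ⧸ lattice ℓ`, where the coordinates of
`lattice ℓ` run over the multiples of `5 ^ ℓ`, `2 ^ ℓ`, `5 ^ ℓ`. Left multiplication acts on every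
level and hence on the limit. Conjugation fixes the first two coordinates, and also the third once
those vanish, so an element with a fixed point in the limit has coordinates divisible by all powers
of `5` or `2`: the action is free. Lifting of paths shows that the path components are the orbits,
so every leaf is a copy of the Heisenberg space.

Growth. A metric on the compact base pulls back to a metric that is invariant under right
translation by `lattice 0`, hence is comparable to the right-invariant norm `|dx| + |dy| + |dz - y
dx|`. Curves with `dz = y dx` reach height `r ^ 2` in length of order `r`, and no curve does better
at large scale, so large balls are comparable to right-translated boxes of sides `r`, `r`, `r ^ 2`
(`exists_leafEDist_bounds`). Their volume is of order `r ^ 4`.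

Inhomogeneity. Over the identity coset, the first coordinates `i ℓ` of integral representatives of
the levels of a point define a 5-adic integer `i`. The integral element `(A, B, D)` fixes level `ℓ`
exactly if `5 ^ ℓ ∣ A`, `2 ^ ℓ ∣ B` and `5 ^ ℓ ∣ D - i B` (`HasResidues.smul_level_eq_iff`). If `i`
is an ordinary integer `r`, then `(0, 1, r) ^ (2 ^ ℓ)` fixes level `ℓ` for every `ℓ`. If `i` is
irrational, no nontrivial integral `δ` is such that every level is fixed by some `δ ^ (2 ^ ℓ)`,
because `2` is a unit modulo powers of `5`. A homeomorphism maps orbits to orbits and is uniformly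
continuous, and it thereby transports the first behaviour from a point to its image
(`exists_ne_one_of_homeomorph`). So it cannot send a point of the first kind to one of the second
(`homeomorph_ne_of_residues`).

Finite coverings. The action lifts to a finite covering of the base, and some `(N, 0, 0)` with `N ≠
0` fixes the given point of the covering. Limits along its orbit realize every invariant in `i + N
ℤ₅` inside one component of the pullback (`exists_component_hasResidues`). This coset contains an
ordinary integer, as well as an irrational: `i` itself or `i + N √-1`, with `√-1 ∈ ℤ₅`. -/

noncomputable section

/-! ### The Heisenberg group in coordinates -/

namespace Heisenberg

@[simp] theorem coord_mul_zero (a b : Heisenberg) : (a * b).coord 0 = a.coord 0 + b.coord 0 := rfl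

@[simp] theorem coord_mul_one (a b : Heisenberg) : (a * b).coord 1 = a.coord 1 + b.coord 1 := rfl

@[simp] theorem coord_mul_two (a b : Heisenberg) :
    (a * b).coord 2 = a.coord 2 + b.coord 2 + a.coord 0 * b.coord 1 := rfl

@[simp] theorem coord_one (i : Fin 3) : (1 : Heisenberg).coord i = 0 := by
  fin_cases i <;> rfl

@[simp] theorem coord_inv_zero (a : Heisenberg) : (a⁻¹).coord 0 = -a.coord 0 := rfl

@[simp] theorem coord_inv_one (a : Heisenberg) : (a⁻¹).coord 1 = -a.coord 1 := rfl

@[simp] theorem coord_inv_two (a : Heisenberg) :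
    (a⁻¹).coord 2 = -a.coord 2 + a.coord 0 * a.coord 1 := rfl

theorem mk_coord (a : Heisenberg) : mk (a.coord 0) (a.coord 1) (a.coord 2) = a :=
  ext_coord rfl rfl rfl

@[fun_prop] theorem continuous_coord (i : Fin 3) : Continuous fun a : Heisenberg => a.coord i :=
  (EuclideanSpace.proj (𝕜 := ℝ) i).continuous

theorem continuous_of_coord {X : Type*} [TopologicalSpace X] {f : X → Heisenberg}
    (h : ∀ i, Continuous fun x => (f x).coord i) : Continuous f :=
  (PiLp.continuous_toLp 2 fun _ : Fin 3 => ℝ).comp (continuous_pi h)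

instance : T2Space Heisenberg := inferInstanceAs (T2Space (EuclideanSpace ℝ (Fin 3)))

instance : LocallyCompactSpace Heisenberg :=
  inferInstanceAs (LocallyCompactSpace (EuclideanSpace ℝ (Fin 3)))

instance : LocallyPathConnectedSpace Heisenberg :=
  inferInstanceAs (LocallyPathConnectedSpace (EuclideanSpace ℝ (Fin 3)))

instance : SimplyConnectedSpace Heisenberg :=
  inferInstanceAs (SimplyConnectedSpace (EuclideanSpace ℝ (Fin 3)))

instance : IsTopologicalGroup Heisenberg where
  continuous_mul := continuous_of_coord fun i => by
    fin_cases i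
    · change Continuous fun p : Heisenberg × Heisenberg => p.1.coord 0 + p.2.coord 0
      fun_prop
    · change Continuous fun p : Heisenberg × Heisenberg => p.1.coord 1 + p.2.coord 1
      fun_prop
    · change Continuous fun p : Heisenberg × Heisenberg =>
        p.1.coord 2 + p.2.coord 2 + p.1.coord 0 * p.2.coord 1
      fun_prop
  continuous_inv := continuous_of_coord fun i => by
    fin_cases i
    · change Continuous fun p : Heisenberg => -p.coord 0
      fun_prop
    · change Continuous fun p : Heisenberg => -p.coord 1
      fun_prop
    · change Continuous fun p : Heisenberg => -p.coord 2 + p.coord 0 * p.coord 1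
      fun_prop

/-- The coordinates of a power. -/
theorem coord_pow (a : Heisenberg) (n : ℕ) : (a ^ n).coord 0 = n * a.coord 0 ∧
    (a ^ n).coord 1 = n * a.coord 1 ∧
    (a ^ n).coord 2 = n * a.coord 2 + n * (n - 1) / 2 * (a.coord 0 * a.coord 1) := by
  induction n with
  | zero => simp
  | succ n ih =>
    obtain ⟨h0, h1, h2⟩ := ih
    rw [pow_succ, coord_mul_zero, coord_mul_one, coord_mul_two, h0, h1, h2]
    push_cast
    refine ⟨by ring, by ring, by ring⟩

/-- Points of a compact set have bounded coordinates. -/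
theorem isCompact_box (R : ℝ) : IsCompact {a : Heisenberg | ∀ i, a.coord i ∈ Icc (-R) R} := by
  have h : IsCompact (univ.pi fun _ : Fin 3 => Icc (-R) R) := isCompact_univ_pi fun _ => isCompact_Icc
  convert! h.image (PiLp.continuous_toLp 2 fun _ : Fin 3 => ℝ) using 1
  ext a
  constructor
  · exact fun ha => ⟨fun i => a.coord i, fun i _ => ha i, rfl⟩
  · rintro ⟨b, hb, rfl⟩ i
    exact hb i (mem_univ i)

/-- Right translation, as a self-map of the Euclidean space. -/
def mulRight (b : Heisenberg) (a : EuclideanSpace ℝ (Fin 3)) : EuclideanSpace ℝ (Fin 3) :=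
  (show Heisenberg from a) * b

theorem contDiff_mulRight (b : Heisenberg) : ContDiff ℝ ω (mulRight b) := by
  rw [contDiff_euclidean]
  intro i
  fin_cases i
  · change ContDiff ℝ ω fun a : EuclideanSpace ℝ (Fin 3) => a 0 + b.coord 0
    fun_prop
  · change ContDiff ℝ ω fun a : EuclideanSpace ℝ (Fin 3) => a 1 + b.coord 1
    fun_prop
  · change ContDiff ℝ ω fun a : EuclideanSpace ℝ (Fin 3) => a 2 + b.coord 2 + a 0 * b.coord 1
    fun_prop

end Heisenberg

/-! ### Smooth structure on the quotients by discrete subgroups -/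

namespace Heisenberg

/-- Two local sections of the projection to a quotient differ by right translations, locally. -/
theorem contDiffOn_transition {Γ : Subgroup Heisenberg}
    {e e' : OpenPartialHomeomorph (Heisenberg ⧸ Γ) (EuclideanSpace ℝ (Fin 3))}
    (he : ∀ v, e.symm v = QuotientGroup.mk (s := Γ) (show Heisenberg from v))
    (he' : ∀ v, e'.symm v = QuotientGroup.mk (s := Γ) (show Heisenberg from v)) :
    ContDiffOn ℝ ∞ (e.symm ≫ₕ e') (e.symm ≫ₕ e').source := by
  intro v hv
  refine ContDiffAt.contDiffWithinAt ?_
  have hsrc : QuotientGroup.mk (s := Γ) (show Heisenberg from v) ∈ e'.source := by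
    rw [← he]
    exact hv.2
  let a : Heisenberg := v
  -- `a` and `w` lie in one coset, and near `v` the transition map is the right translation by `a⁻¹
  -- * w ∈ Γ`.
  let w : Heisenberg := e' (QuotientGroup.mk a)
  have hw : (QuotientGroup.mk a : Heisenberg ⧸ Γ) = QuotientGroup.mk w := by
    rw [← he' w, e'.left_inv hsrc]
  have hwt : mulRight (a⁻¹ * w) v = w := by
    change a * (a⁻¹ * w) = w
    simp
  have hγ : a⁻¹ * w ∈ Γ := QuotientGroup.eq.mp hw
  have hev : (e.symm ≫ₕ e' : EuclideanSpace ℝ (Fin 3) → _) =ᶠ[𝓝 v] mulRight (a⁻¹ * w) := by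
    have h1 : ∀ᶠ u in 𝓝 v, mulRight (a⁻¹ * w) u ∈ e'.target := by
      refine (contDiff_mulRight _).continuous.continuousAt.eventually_mem ?_
      rw [hwt]
      exact e'.open_target.mem_nhds (e'.map_source hsrc)
    filter_upwards [h1] with u hu
    rw [OpenPartialHomeomorph.trans_apply, he]
    have h2 := e'.right_inv hu
    rw [he'] at h2
    rw [← h2]
    congr 1
    exact (QuotientGroup.mk_mul_of_mem (show Heisenberg from u) hγ).symm
  exact ((contDiff_mulRight _).of_le le_top).contDiffAt.congr_of_eventuallyEq hev

section Quotient

variable (Γ : Subgroup Heisenberg) [hΓ : DiscreteTopology Γ]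

theorem isCoveringMap_mk : IsCoveringMap (QuotientGroup.mk : Heisenberg → Heisenberg ⧸ Γ) :=
  (Γ.isQuotientCoveringMap (isDiscrete_iff_discreteTopology.mpr hΓ)).isCoveringMap

instance t2Space_quotient : T2Space (Heisenberg ⧸ Γ) := by
  have h := Subgroup.properlyDiscontinuousSMul_opposite_of_tendsto_cofinite Γ
    (Γ.tendsto_coe_cofinite_of_discrete (isDiscrete_iff_discreteTopology.mpr hΓ))
  exact inferInstanceAs (T2Space (Quotient (MulAction.orbitRel Γ.op Heisenberg)))

instance chartedSpace_quotient : ChartedSpace (EuclideanSpace ℝ (Fin 3)) (Heisenberg ⧸ Γ) :=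
  (isCoveringMap_mk Γ).isLocalHomeomorph.chartedSpace QuotientGroup.mk_surjective

/-- The chart given by a local section of the projection. -/
def sectionChart (a : Heisenberg) :
    OpenPartialHomeomorph (Heisenberg ⧸ Γ) (EuclideanSpace ℝ (Fin 3)) :=
  (isCoveringMap_mk Γ).isLocalHomeomorph.localInverseAt a

theorem sectionChart_symm (a : Heisenberg) (v : EuclideanSpace ℝ (Fin 3)) :
    (sectionChart Γ a).symm v = QuotientGroup.mk (s := Γ) (show Heisenberg from v) :=
  congrFun ((isCoveringMap_mk Γ).isLocalHomeomorph.localInverseAt_symm a) v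

theorem mem_atlas_quotient {e : OpenPartialHomeomorph (Heisenberg ⧸ Γ) (EuclideanSpace ℝ (Fin 3))}
    (he : e ∈ atlas (EuclideanSpace ℝ (Fin 3)) (Heisenberg ⧸ Γ)) : ∃ a, e = sectionChart Γ a := by
  obtain ⟨q, rfl⟩ := he
  exact ⟨_, OpenPartialHomeomorph.trans_refl _⟩

instance isManifold_quotient : IsManifold (𝓡 3) ∞ (Heisenberg ⧸ Γ) := by
  refine isManifold_of_contDiffOn _ _ _ fun e e' he he' => ?_
  obtain ⟨a, rfl⟩ := mem_atlas_quotient Γ he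
  obtain ⟨a', rfl⟩ := mem_atlas_quotient Γ he'
  simpa using contDiffOn_transition (sectionChart_symm Γ a) (sectionChart_symm Γ a')

/-- The atlas has one chart for a chosen preimage of each point; local sections through the other
preimages differ from these by right translations, so they are compatible as well. -/
theorem sectionChart_mem_maximalAtlas (a : Heisenberg) :
    sectionChart Γ a ∈ IsManifold.maximalAtlas (𝓡 3) ∞ (Heisenberg ⧸ Γ) := by
  rw [IsManifold.maximalAtlas, mem_maximalAtlas_iff]
  intro e' he'
  obtain ⟨a', rfl⟩ := mem_atlas_quotient Γ he'
  have h1 := contDiffOn_transition (sectionChart_symm Γ a) (sectionChart_symm Γ a')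
  have h2 := contDiffOn_transition (sectionChart_symm Γ a') (sectionChart_symm Γ a)
  constructor <;> rw [contDiffGroupoid, mem_groupoid_of_pregroupoid] <;> constructor <;>
    simpa [contDiffPregroupoid] using (by assumption)

theorem isLocalDiffeomorph_mk :
    IsLocalDiffeomorph (𝓡 3) (𝓡 3) ∞ (QuotientGroup.mk : Heisenberg → Heisenberg ⧸ Γ) := by
  intro a
  have h := sectionChart_mem_maximalAtlas Γ a
  refine ⟨⟨(sectionChart Γ a).symm.toPartialEquiv, (sectionChart Γ a).open_target,
    (sectionChart Γ a).open_source, contMDiffOn_symm_of_mem_maximalAtlas h,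
    contMDiffOn_of_mem_maximalAtlas h⟩, ?_, ?_⟩
  · exact (isCoveringMap_mk Γ).isLocalHomeomorph.self_mem_localInverseAt_target
  · intro v _
    exact (sectionChart_symm Γ a v).symm

end Quotient

end Heisenberg

theorem IsLocalDiffeomorphAt.congr_of_eventuallyEq {E H M F K N : Type*} [NormedAddCommGroup E]
    [NormedSpace ℝ E] [TopologicalSpace H] {I : ModelWithCorners ℝ E H} [TopologicalSpace M]
    [ChartedSpace H M] [NormedAddCommGroup F] [NormedSpace ℝ F] [TopologicalSpace K]
    {J : ModelWithCorners ℝ F K} [TopologicalSpace N] [ChartedSpace K N] {n : WithTop ℕ∞}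
    {f g : M → N} {x : M} (hf : IsLocalDiffeomorphAt I J n f x) (h : g =ᶠ[𝓝 x] f) :
    IsLocalDiffeomorphAt I J n g x := by
  obtain ⟨Φ, hx, hΦ⟩ := hf
  obtain ⟨U, hU, hUo, hxU⟩ := eventually_nhds_iff.mp h
  let e := Φ.toOpenPartialHomeomorph.restrOpen U hUo
  have hs : e.source = Φ.source ∩ U := Φ.toOpenPartialHomeomorph.restrOpen_source U hUo
  refine ⟨⟨e.toPartialEquiv, e.open_source, e.open_target, ?_, ?_⟩, ?_, ?_⟩
  · exact Φ.contMDiffOn_toFun.mono (hs ▸ inter_subset_left)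
  · refine Φ.contMDiffOn_invFun.mono fun y hy => ?_
    exact hy.1
  · change x ∈ e.source
    rw [hs]
    exact ⟨hx, hxU⟩
  · intro y hy
    have hy' : y ∈ Φ.source ∩ U := hs ▸ hy
    exact (hU y hy'.2).trans (hΦ hy'.1)

/-! ### Coverings between quotients and the tower of lattices -/

namespace Heisenberg

section QuotientMap

variable {Γ Γ' : Subgroup Heisenberg} [DiscreteTopology Γ] [DiscreteTopology Γ'] (h : Γ' ≤ Γ)

/-- Locally the map is a smooth section into the Heisenberg space followed by the projection to the
coarser quotient. -/
theorem isLocalDiffeomorph_quotientMapOfLE :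
    IsLocalDiffeomorph (𝓡 3) (𝓡 3) ∞ (Subgroup.quotientMapOfLE h) := by
  intro q
  obtain ⟨a, rfl⟩ := QuotientGroup.mk_surjective q
  have h1 := isLocalDiffeomorph_mk Γ' a
  have h4 : IsLocalDiffeomorphAt (𝓡 3) (𝓡 3) ∞ (QuotientGroup.mk (s := Γ))
      (h1.localInverse (QuotientGroup.mk a)) := isLocalDiffeomorph_mk Γ _
  have h3 := h1.localInverse_isLocalDiffeomorphAt.comp (𝓡 3) (Heisenberg ⧸ Γ) h4
  refine h3.congr_of_eventuallyEq ?_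
  filter_upwards [h1.localInverse_eventuallyEq_right] with u hu
  simp only [Function.comp_apply, id] at hu ⊢
  conv_lhs => rw [← hu]
  rfl

/-- A local homeomorphism from a compact Hausdorff space to a Hausdorff connected space is a
covering. -/
theorem isCoveringMap_quotientMapOfLE [CompactSpace (Heisenberg ⧸ Γ')] :
    IsCoveringMap (Subgroup.quotientMapOfLE h) :=
  isLocalHomeomorph_iff_isCoveringMap.mp (isLocalDiffeomorph_quotientMapOfLE h).isLocalHomeomorph

omit [DiscreteTopology Γ] [DiscreteTopology Γ'] in
theorem quotientMapOfLE_smul (a : Heisenberg) (q : Heisenberg ⧸ Γ') :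
    Subgroup.quotientMapOfLE h (a • q) = a • Subgroup.quotientMapOfLE h q := by
  obtain ⟨b, rfl⟩ := QuotientGroup.mk_surjective q
  rfl

end QuotientMap

/-- The lattice of points whose coordinates are multiples of `5 ^ ℓ`, `2 ^ ℓ` and `5 ^ ℓ`. -/
def lattice (ℓ : ℕ) : Subgroup Heisenberg where
  carrier := {a | ∃ i j k : ℤ, a = mk (5 ^ ℓ * i) (2 ^ ℓ * j) (5 ^ ℓ * k)}
  one_mem' := ⟨0, 0, 0, ext_coord (by simp) (by simp) (by simp)⟩
  mul_mem' := by
    rintro _ _ ⟨i, j, k, rfl⟩ ⟨i', j', k', rfl⟩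
    -- The cross term `5 ^ ℓ * i * (2 ^ ℓ * j')` is a multiple of `5 ^ ℓ`, the modulus of the third
    -- coordinate.
    refine ⟨i + i', j + j', k + k' + i * (2 ^ ℓ * j'), ext_coord ?_ ?_ ?_⟩ <;> simp <;> ring
  inv_mem' := by
    rintro _ ⟨i, j, k, rfl⟩
    refine ⟨-i, -j, -k + i * (2 ^ ℓ * j), ext_coord ?_ ?_ ?_⟩ <;> simp
    ring

theorem mem_lattice {ℓ : ℕ} {a : Heisenberg} : a ∈ lattice ℓ ↔
    ∃ i j k : ℤ, a = mk (5 ^ ℓ * i) (2 ^ ℓ * j) (5 ^ ℓ * k) := Iff.rfl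

theorem lattice_succ_le (ℓ : ℕ) : lattice (ℓ + 1) ≤ lattice ℓ := by
  rintro _ ⟨i, j, k, rfl⟩
  refine ⟨5 * i, 2 * j, 5 * k, ?_⟩
  congr 1 <;> push_cast <;> ring

theorem lattice_antitone : Antitone lattice := antitone_nat_of_succ_le lattice_succ_le

theorem eq_zero_of_abs_pow_mul_lt_one {p ℓ : ℕ} (hp : 1 ≤ p) {i : ℤ}
    (h : |(p : ℝ) ^ ℓ * i| < 1) : i = 0 := by
  by_contra hi
  have h1 : (1 : ℝ) ≤ |(i : ℝ)| := by exact_mod_cast Int.one_le_abs hi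
  have h2 : (1 : ℝ) ≤ (p : ℝ) ^ ℓ := one_le_pow₀ (by exact_mod_cast hp)
  rw [abs_mul, abs_of_nonneg (by positivity)] at h
  nlinarith

theorem isOpen_abs_coord_lt (ε : ℝ) : IsOpen {a : Heisenberg | ∀ i, |a.coord i| < ε} := by
  rw [ofPred_forall]
  exact isOpen_iInter_of_finite fun i => isOpen_lt (continuous_coord i).abs continuous_const

theorem eq_one_of_mem_lattice {ℓ : ℕ} {a : Heisenberg} (ha : a ∈ lattice ℓ)
    (h : ∀ i, |a.coord i| < 1) : a = 1 := by
  obtain ⟨i, j, k, rfl⟩ := ha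
  have h0 := eq_zero_of_abs_pow_mul_lt_one (p := 5) (by norm_num) (by simpa using h 0)
  have h1 := eq_zero_of_abs_pow_mul_lt_one (p := 2) (by norm_num) (by simpa using h 1)
  have h2 := eq_zero_of_abs_pow_mul_lt_one (p := 5) (by norm_num) (by simpa using h 2)
  subst h0 h1 h2
  exact ext_coord (by simp) (by simp) (by simp)

instance discreteTopology_lattice (ℓ : ℕ) : DiscreteTopology (lattice ℓ) := by
  refine discreteTopology_of_isOpen_singleton_one ?_
  convert! (isOpen_abs_coord_lt 1).preimage (continuous_subtype_val (p := (· ∈ lattice ℓ))) using 1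
  ext ⟨a, ha⟩
  constructor
  · rintro h
    obtain rfl : a = 1 := congrArg Subtype.val h
    intro i
    simp
  · exact fun h => Subtype.ext (eq_one_of_mem_lattice ha h)

theorem exists_mem_Icc_add_mul {p : ℝ} (hp : 0 < p) (x : ℝ) : ∃ i : ℤ, x + p * i ∈ Icc 0 p := by
  refine ⟨-⌊x / p⌋, ?_⟩
  have h1 := Int.floor_le (x / p)
  have h2 := Int.lt_floor_add_one (x / p)
  rw [le_div_iff₀ hp] at h1
  rw [div_lt_iff₀ hp] at h2
  push_cast
  constructor <;> nlinarith

/-- A box is a fundamental domain of a lattice, up to multiplicity. -/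
theorem exists_mul_mem_box (ℓ : ℕ) (a : Heisenberg) :
    ∃ γ ∈ lattice ℓ, ∀ i, (a * γ).coord i ∈ Icc (-(5 ^ ℓ : ℝ)) (5 ^ ℓ) := by
  have h5 : (0 : ℝ) < 5 ^ ℓ := by positivity
  have h2 : (2 : ℝ) ^ ℓ ≤ 5 ^ ℓ := by gcongr; norm_num
  obtain ⟨i, hi⟩ := exists_mem_Icc_add_mul h5 (a.coord 0)
  obtain ⟨j, hj⟩ := exists_mem_Icc_add_mul (p := 2 ^ ℓ) (by positivity) (a.coord 1)
  -- The shift in the second coordinate also moves the third one by a cross term, so `k` is chosen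
  -- last.
  obtain ⟨k, hk⟩ := exists_mem_Icc_add_mul h5 (a.coord 2 + a.coord 0 * (2 ^ ℓ * j))
  refine ⟨mk (5 ^ ℓ * i) (2 ^ ℓ * j) (5 ^ ℓ * k), ⟨i, j, k, rfl⟩, fun m => ?_⟩
  fin_cases m
  · change a.coord 0 + 5 ^ ℓ * i ∈ _
    exact ⟨by linarith [hi.1], hi.2⟩
  · change a.coord 1 + 2 ^ ℓ * j ∈ _
    exact ⟨by linarith [hj.1], hj.2.trans h2⟩
  · change a.coord 2 + 5 ^ ℓ * k + a.coord 0 * (2 ^ ℓ * j) ∈ _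
    constructor <;> linarith [hk.1, hk.2]

instance compactSpace_quotient (ℓ : ℕ) : CompactSpace (Heisenberg ⧸ lattice ℓ) := by
  rw [← isCompact_univ_iff]
  convert! (isCompact_box (5 ^ ℓ)).image (isCoveringMap_mk (lattice ℓ)).continuous using 1
  refine (eq_univ_of_forall fun q => ?_).symm
  obtain ⟨a, rfl⟩ := QuotientGroup.mk_surjective q
  obtain ⟨γ, hγ, h⟩ := exists_mul_mem_box ℓ a
  exact ⟨a * γ, h, QuotientGroup.mk_mul_of_mem a hγ⟩

instance connectedSpace_quotient (Γ : Subgroup Heisenberg) : ConnectedSpace (Heisenberg ⧸ Γ) :=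
  QuotientGroup.mk_surjective.connectedSpace QuotientGroup.continuous_mk

/-- Left translations act transitively on the base and commute with the projection, so all fibres
have the size of the one over the identity coset. That fibre is compact and discrete, and `(5 ^ ℓ,
0, 0)` gives a second point in it. -/
theorem exists_card_fiber (ℓ : ℕ) : ∃ m : ℕ, 1 < m ∧
    ∀ x, Nat.card (Subgroup.quotientMapOfLE (lattice_succ_le ℓ) ⁻¹' {x}) = m := by
  set p := Subgroup.quotientMapOfLE (lattice_succ_le ℓ) with hp
  have hcov : IsCoveringMap p := isCoveringMap_quotientMapOfLE _
  refine ⟨Nat.card (p ⁻¹' {QuotientGroup.mk 1}), ?_, fun x => ?_⟩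
  · have hd : DiscreteTopology (p ⁻¹' {QuotientGroup.mk 1}) :=
      (hcov (QuotientGroup.mk 1)).discreteTopology_fiber
    have hc : CompactSpace (p ⁻¹' {QuotientGroup.mk 1}) :=
      isCompact_iff_compactSpace.mp ((isClosed_singleton.preimage hcov.continuous).isCompact)
    have hf : Finite (p ⁻¹' {QuotientGroup.mk 1}) := finite_of_compact_of_discrete
    rw [Finite.one_lt_card_iff_nontrivial]
    refine ⟨⟨QuotientGroup.mk 1, rfl⟩, ⟨QuotientGroup.mk (mk (5 ^ ℓ) 0 0), ?_⟩, fun h => ?_⟩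
    · refine (QuotientGroup.eq (s := lattice ℓ)).mpr ?_
      rw [mul_one]
      exact inv_mem ⟨1, 0, 0, by simp⟩
    · have h' := QuotientGroup.eq.mp (congrArg Subtype.val h)
      rw [inv_one, one_mul] at h'
      obtain ⟨i, j, k, h'⟩ := h'
      have h0 := congrArg (fun a => a.coord 0) h'
      simp only [coord_mk_zero, pow_succ] at h0
      have h1 : (5 : ℝ) * i = 1 := by
        have : (5 : ℝ) ^ ℓ ≠ 0 := by positivity
        apply mul_left_cancel₀ this
        linarith
      have h2 : (5 : ℤ) * i = 1 := by exact_mod_cast h1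
      omega
  · obtain ⟨a, rfl⟩ := QuotientGroup.mk_surjective x
    refine Nat.card_congr ((MulAction.toPerm (a⁻¹ : Heisenberg)).subtypeEquiv fun q => ?_)
    have h : p (a⁻¹ • q) = a⁻¹ • p q := quotientMapOfLE_smul _ _ _
    have h1 : (QuotientGroup.mk a : Heisenberg ⧸ lattice ℓ) = a • QuotientGroup.mk 1 := by
      change _ = QuotientGroup.mk (a * 1)
      rw [mul_one]
    simp only [mem_preimage, mem_singleton_iff, MulAction.toPerm_apply]
    rw [h, h1, inv_smul_eq_iff]

/-- The tower of the quotients of the Heisenberg space by the lattices. -/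
def tower : Presentation 3 where
  M ℓ := Heisenberg ⧸ lattice ℓ
  topologicalSpace _ := inferInstance
  chartedSpace _ := inferInstance
  isManifold _ := inferInstance
  t2Space _ := inferInstance
  compactSpace _ := inferInstance
  connectedSpace _ := inferInstance
  p ℓ := Subgroup.quotientMapOfLE (lattice_succ_le ℓ)
  isCoveringMap _ := isCoveringMap_quotientMapOfLE _
  isLocalDiffeomorph _ := isLocalDiffeomorph_quotientMapOfLE _
  degree := exists_card_fiber

end Heisenberg

/-- A member of an open partition of a preconnected space is the whole space if it is nonempty. -/
theorem eq_univ_of_open_partition {A ι : Type*} [TopologicalSpace A] [PreconnectedSpace A]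
    {B : ι → Set A} (ho : ∀ i, IsOpen (B i)) (hd : ∀ i j a, a ∈ B i → a ∈ B j → i = j)
    (hc : ∀ a, ∃ i, a ∈ B i) {i : ι} (hi : (B i).Nonempty) : B i = univ := by
  refine IsClopen.eq_univ ⟨⟨?_⟩, ho i⟩ hi
  have h : (B i)ᶜ = ⋃ j ∈ {j | j ≠ i}, B j := by
    ext a
    simp only [mem_compl_iff, mem_iUnion, mem_ofPred_eq, exists_prop]
    constructor
    · intro ha
      obtain ⟨j, hj⟩ := hc a
      exact ⟨j, fun hji => ha (hji ▸ hj), hj⟩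
    · rintro ⟨j, hji, hj⟩ ha
      exact hji (hd j i a hj ha)
  rw [h]
  exact isOpen_biUnion fun j _ => ho j

theorem isCoveringMap_homeomorph {X Y : Type*} [TopologicalSpace X] [T2Space X]
    [TopologicalSpace Y] (e : X ≃ₜ Y) : IsCoveringMap e :=
  isCoveringMap_iff_isCoveringMapOn_univ.mpr <|
    e.isClosedMap.isCoveringMapOn_of_isLocalHomeomorphOn
      (fun _ _ => (finite_singleton _).preimage e.injective.injOn)
      (e.isLocalHomeomorph.isLocalHomeomorphOn.mono (subset_univ _))

/-! ### The leaves as free orbits -/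

namespace Heisenberg

theorem smul_mk_eq_self {Γ : Subgroup Heisenberg} {a g : Heisenberg} :
    a • (QuotientGroup.mk g : Heisenberg ⧸ Γ) = QuotientGroup.mk g ↔ g⁻¹ * a * g ∈ Γ := by
  change (QuotientGroup.mk (a * g) : Heisenberg ⧸ Γ) = _ ↔ _
  rw [eq_comm, QuotientGroup.eq, mul_assoc]

@[simp] theorem coord_conj_zero (g a : Heisenberg) : (g⁻¹ * a * g).coord 0 = a.coord 0 := by simp

@[simp] theorem coord_conj_one (g a : Heisenberg) : (g⁻¹ * a * g).coord 1 = a.coord 1 := by simp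

/-- The term `g.coord 0 * a.coord 1` makes the stabilizers at the levels depend on the first
coordinate of a point; the 5-adic invariant comes from it. -/
theorem coord_conj_two (g a : Heisenberg) : (g⁻¹ * a * g).coord 2 =
    a.coord 2 - g.coord 0 * a.coord 1 + g.coord 1 * a.coord 0 := by
  simp
  ring

/-- The orbit maps on the quotients are coverings. -/
theorem isCoveringMap_smul {Γ : Subgroup Heisenberg} [DiscreteTopology Γ] (u : Heisenberg ⧸ Γ) :
    IsCoveringMap fun a : Heisenberg => a • u := by
  obtain ⟨g, rfl⟩ := QuotientGroup.mk_surjective u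
  exact (isCoveringMap_mk Γ).comp_homeomorph (Homeomorph.mulRight g)

/-- Small elements act without fixed points on the quotient by the first lattice. -/
theorem eq_one_of_smul_eq {s : Heisenberg} (hs : ∀ i, |s.coord i| < 1 / 3)
    {u : Heisenberg ⧸ lattice 0} (h : s • u = u) : s = 1 := by
  obtain ⟨g, rfl⟩ := QuotientGroup.mk_surjective u
  -- With a representative whose coordinates are at most `1` in absolute value, the third coordinate
  -- of the conjugate is a sum of three terms smaller than `1 / 3`.
  obtain ⟨γ, hγ, hg⟩ := exists_mul_mem_box 0 g
  rw [← QuotientGroup.mk_mul_of_mem g hγ] at h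
  generalize g * γ = g' at h hg
  have h1 := eq_one_of_mem_lattice (smul_mk_eq_self.mp h) fun i => by
    have h0 := hs 0
    have h1 := hs 1
    have h2 := hs 2
    fin_cases i
    · change |(g'⁻¹ * s * g').coord 0| < 1
      rw [coord_conj_zero]
      linarith
    · change |(g'⁻¹ * s * g').coord 1| < 1
      rw [coord_conj_one]
      linarith
    · change |(g'⁻¹ * s * g').coord 2| < 1
      have e0 : |g'.coord 0| ≤ 1 := abs_le.mpr (by simpa using hg 0)
      have e1 : |g'.coord 1| ≤ 1 := abs_le.mpr (by simpa using hg 1)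
      rw [coord_conj_two]
      have e3 : |g'.coord 0 * s.coord 1| ≤ |s.coord 1| := by
        rw [abs_mul]; exact mul_le_of_le_one_left (abs_nonneg _) e0
      have e4 : |g'.coord 1 * s.coord 0| ≤ |s.coord 0| := by
        rw [abs_mul]; exact mul_le_of_le_one_left (abs_nonneg _) e1
      have e5 := abs_add_le (s.coord 2 - g'.coord 0 * s.coord 1) (g'.coord 1 * s.coord 0)
      have e6 := abs_sub (s.coord 2) (g'.coord 0 * s.coord 1)
      linarith
  have h2 : s = g' * (g'⁻¹ * s * g') * g'⁻¹ := by group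
  rw [h2, h1, mul_one, mul_inv_cancel]

theorem exists_nhds_one_smul_ne : ∃ V ∈ 𝓝 (1 : Heisenberg), ∀ s ∈ V,
    ∀ u : Heisenberg ⧸ lattice 0, s • u = u → s = 1 :=
  ⟨{a | ∀ i, |a.coord i| < 1 / 3}, (isOpen_abs_coord_lt _).mem_nhds fun i => by simp,
    fun _ hs _ h => eq_one_of_smul_eq hs h⟩

/-- The projection of the solenoid to a level of the tower. -/
def level (ℓ : ℕ) (x : tower.Solenoid) : Heisenberg ⧸ lattice ℓ := x.1 ℓ

theorem map_level_succ (ℓ : ℕ) (x : tower.Solenoid) :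
    Subgroup.quotientMapOfLE (lattice_succ_le ℓ) (level (ℓ + 1) x) = level ℓ x := x.2 ℓ

theorem level_injective {x y : tower.Solenoid} (h : ∀ ℓ, level ℓ x = level ℓ y) : x = y :=
  Subtype.ext (funext h)

theorem level_eq_of_le {x y : tower.Solenoid} {k ℓ : ℕ} (hkl : k ≤ ℓ)
    (h : level ℓ x = level ℓ y) : level k x = level k y := by
  induction ℓ, hkl using Nat.le_induction with
  | base => exact h
  | succ n _ ih =>
    refine ih ?_
    rw [← map_level_succ n x, ← map_level_succ n y, h]

theorem continuous_level (ℓ : ℕ) : Continuous (level ℓ) :=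
  (continuous_apply ℓ).comp continuous_subtype_val

theorem continuous_of_level {X : Type*} [TopologicalSpace X] {f : X → tower.Solenoid}
    (h : ∀ ℓ, Continuous fun x => level ℓ (f x)) : Continuous f :=
  Continuous.subtype_mk (continuous_pi h) _

instance : MulAction Heisenberg tower.Solenoid where
  smul a x := ⟨fun ℓ => a • level ℓ x, fun ℓ =>
    (quotientMapOfLE_smul _ a _).trans (congrArg (a • ·) (map_level_succ ℓ x))⟩
  one_smul _ := level_injective fun _ => one_smul Heisenberg _
  mul_smul a b _ := level_injective fun _ => mul_smul a b _

@[simp] theorem level_smul (ℓ : ℕ) (a : Heisenberg) (x : tower.Solenoid) :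
    level ℓ (a • x) = a • level ℓ x := rfl

theorem continuous_smul_left (x : tower.Solenoid) : Continuous fun a : Heisenberg => a • x :=
  continuous_of_level fun ℓ => (isCoveringMap_smul (level ℓ x)).continuous

theorem eq_zero_of_forall_eq_pow_mul {p : ℕ} (hp : 2 ≤ p) {r : ℝ}
    (h : ∀ ℓ : ℕ, ∃ i : ℤ, r = p ^ ℓ * i) : r = 0 := by
  obtain ⟨ℓ, hℓ⟩ := pow_unbounded_of_one_lt |r| (show (1 : ℝ) < p by exact_mod_cast hp)
  obtain ⟨i, hi⟩ := h ℓ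
  by_cases h0 : i = 0
  · simpa [h0] using hi
  · have h1 : (1 : ℝ) ≤ |(i : ℝ)| := by exact_mod_cast Int.one_le_abs h0
    rw [hi, abs_mul, abs_of_nonneg (by positivity)] at hℓ
    have h2 : (0 : ℝ) < (p : ℝ) ^ ℓ := by
      have : (0 : ℝ) < p := by exact_mod_cast (by omega : 0 < p)
      positivity
    nlinarith

/-- The action of the Heisenberg group on the solenoid is free. -/
theorem eq_one_of_smul_eq_self {a : Heisenberg} {x : tower.Solenoid} (h : a • x = x) : a = 1 := by
  have key : ∀ ℓ, ∃ g : Heisenberg, g⁻¹ * a * g ∈ lattice ℓ := fun ℓ => by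
    obtain ⟨g, hg⟩ := QuotientGroup.mk_surjective (level ℓ x)
    refine ⟨g, smul_mk_eq_self.mp ?_⟩
    rw [hg, ← level_smul, h]
  have h0 : a.coord 0 = 0 := eq_zero_of_forall_eq_pow_mul (p := 5) (by norm_num) fun ℓ => by
    obtain ⟨g, i, j, k, hg⟩ := key ℓ
    exact ⟨i, by rw [← coord_conj_zero g a, hg]; rfl⟩
  have h1 : a.coord 1 = 0 := eq_zero_of_forall_eq_pow_mul (p := 2) (by norm_num) fun ℓ => by
    obtain ⟨g, i, j, k, hg⟩ := key ℓ
    exact ⟨j, by rw [← coord_conj_one g a, hg]; rfl⟩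
  have h2 : a.coord 2 = 0 := eq_zero_of_forall_eq_pow_mul (p := 5) (by norm_num) fun ℓ => by
    obtain ⟨g, i, j, k, hg⟩ := key ℓ
    refine ⟨k, ?_⟩
    have h3 := coord_conj_two g a
    rw [h0, h1, hg] at h3
    rw [coord_mk_two] at h3
    simp at h3
    simp [h3]
  exact ext_coord (by simpa using h0) (by simpa using h1) (by simpa using h2)

/-- Maps of a connected space to the solenoid are equal if they have the same projection to the
base and agree at a point. -/
theorem eq_of_level_zero_eq {A : Type*} [TopologicalSpace A] [PreconnectedSpace A]
    {c c' : A → tower.Solenoid} (hc : Continuous c) (hc' : Continuous c')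
    (h : ∀ a, level 0 (c a) = level 0 (c' a)) {a₀ : A} (h₀ : c a₀ = c' a₀) : c = c' := by
  have key : ∀ ℓ, (fun a => level ℓ (c a)) = fun a => level ℓ (c' a) := fun ℓ => by
    induction ℓ with
    | zero => exact funext h
    | succ ℓ ih =>
      refine (isCoveringMap_quotientMapOfLE (lattice_succ_le ℓ)).eq_of_comp_eq
        ((continuous_level _).comp hc) ((continuous_level _).comp hc') ?_ a₀ (by rw [h₀])
      funext a
      simp only [Function.comp_apply, map_level_succ]
      exact congrFun ih a
  exact funext fun a => level_injective fun ℓ => congrFun (key ℓ) a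

section Lift

variable {A : Type*} [TopologicalSpace A] [SimplyConnectedSpace A] [LocallyPathConnectedSpace A]

/-- Maps of a simply connected space to the solenoid lift to an orbit. -/
theorem exists_lift {c : A → tower.Solenoid} (hc : Continuous c) (a₀ : A) {x : tower.Solenoid}
    {g : Heisenberg} (h : c a₀ = g • x) :
    ∃ φ : A → Heisenberg, Continuous φ ∧ φ a₀ = g ∧ ∀ a, c a = φ a • x := by
  obtain ⟨φ, ⟨h0, h1⟩, -⟩ := (isCoveringMap_smul (level 0 x)).existsUnique_continuousMap_lifts
    ⟨fun a => level 0 (c a), (continuous_level 0).comp hc⟩ a₀ g (by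
      change g • level 0 x = level 0 (c a₀)
      rw [h, level_smul])
  refine ⟨φ, φ.continuous, h0, fun a => ?_⟩
  refine congrFun (eq_of_level_zero_eq (c' := fun a => φ a • x) hc
    ((continuous_smul_left x).comp φ.continuous) (fun a => ?_) (a₀ := a₀) ?_) a
  · exact (congrFun h1 a).symm
  · rw [h, ← h0]

end Lift

theorem joinedIn_smul {U : Set tower.Solenoid} {W : Set Heisenberg} {x : tower.Solenoid}
    (hU : ∀ b ∈ W, b • x ∈ U) {a b : Heisenberg} (h : JoinedIn W a b) :
    JoinedIn U (a • x) (b • x) := by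
  obtain ⟨γ, hγ⟩ := h
  exact ⟨γ.map (continuous_smul_left x), fun t => hU _ (hγ t)⟩

theorem exists_smul_of_joinedIn {U : Set tower.Solenoid} {x y : tower.Solenoid} {a : Heisenberg}
    (h : JoinedIn U (a • x) y) : ∃ φ : ℝ → Heisenberg, Continuous φ ∧ φ 0 = a ∧ φ 1 • x = y ∧
      ∀ t, φ t • x ∈ U := by
  obtain ⟨γ, hγ⟩ := h
  obtain ⟨φ, h1, h2, h3⟩ := exists_lift γ.continuous_extend 0 (x := x) (g := a) (by simp)
  refine ⟨φ, h1, h2, ?_, fun t => ?_⟩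
  · rw [← h3 1]
    simp
  · rw [← h3 t]
    exact hγ _

/-- The path components of the solenoid are the orbits. -/
theorem mem_pathComponent_iff {x y : tower.Solenoid} :
    y ∈ pathComponent x ↔ ∃ a : Heisenberg, a • x = y := by
  constructor
  · intro h
    have h1 : JoinedIn univ ((1 : Heisenberg) • x) y := by
      rw [one_smul]
      exact joinedIn_univ.mpr h
    obtain ⟨φ, -, -, h2, -⟩ := exists_smul_of_joinedIn h1
    exact ⟨_, h2⟩
  · rintro ⟨a, rfl⟩
    have h := joinedIn_smul (x := x) (U := univ) (W := univ) (fun _ _ => mem_univ _)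
      (joinedIn_univ.mpr (PathConnectedSpace.joined (1 : Heisenberg) a))
    rw [one_smul] at h
    exact h.joined

/-- The parametrization of a leaf by the Heisenberg space. -/
def orbitLeaf (x : tower.Solenoid) : Heisenberg ≃ Leaf x :=
  Equiv.ofBijective (fun a => ⟨a • x, mem_pathComponent_iff.mpr ⟨a, rfl⟩⟩) <| by
    constructor
    · intro a b h
      have h1 : a • x = b • x := congrArg Subtype.val h
      have h2 : (b⁻¹ * a) • x = x := by rw [mul_smul, h1, inv_smul_smul]
      exact (inv_mul_eq_one.mp (eq_one_of_smul_eq_self h2)).symm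
    · rintro ⟨y, hy⟩
      obtain ⟨a, rfl⟩ := mem_pathComponent_iff.mp hy
      exact ⟨a, rfl⟩

/-- The Heisenberg space is locally path connected: close to `a`, points are joined to it inside the
preimage of `U`, so their images stay in one path component of `U`. -/
theorem continuous_orbitLeaf (x : tower.Solenoid) : Continuous (orbitLeaf x) := by
  refine continuous_induced_rng.mpr (continuous_generateFrom_iff.mpr ?_)
  rintro _ ⟨U, hU, y, -, rfl⟩
  rw [isOpen_iff_mem_nhds]
  intro a ha
  have ha : a • x ∈ pathComponentIn U y := ha
  have hW : IsOpen {b : Heisenberg | b • x ∈ U} := hU.preimage (continuous_smul_left x)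
  have haW : a ∈ {b : Heisenberg | b • x ∈ U} :=
    (pathComponentIn_subset : pathComponentIn U y ⊆ U) ha
  filter_upwards [(hW.pathComponentIn a).mem_nhds (mem_pathComponentIn_self haW)] with b hb
  exact ha.trans (joinedIn_smul (fun _ h => h) hb)

/-- In the preimage of a small open set `V • u` of the base, a path `φ t • x` has `φ t` in the union
of the sets `V * a * γ`, with `γ` in the stabilizer of the base point. These are open and, as small
elements act freely, disjoint. A path starting at `a • x` therefore keeps `φ t` in `V * a`. -/
theorem isOpenMap_orbitLeaf (x : tower.Solenoid) : IsOpenMap (orbitLeaf x) := by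
  intro W hW
  rw [isOpen_iff_mem_nhds]
  rintro _ ⟨a, ha, rfl⟩
  obtain ⟨V₀, hV₀, hfree⟩ := exists_nhds_one_smul_ne
  have h1 : ∀ᶠ p : Heisenberg × Heisenberg in 𝓝 (1, 1), p.1⁻¹ * p.2 ∈ V₀ := by
    refine ContinuousAt.eventually_mem (by fun_prop) ?_
    simpa using hV₀
  have h2 : ∀ᶠ s : Heisenberg in 𝓝 1, s * a ∈ W := by
    refine ContinuousAt.eventually_mem (by fun_prop) ?_
    simpa using hW.mem_nhds ha
  rw [nhds_prod_eq] at h1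
  obtain ⟨V₁, hV₁, h1⟩ := Filter.eventually_prod_self_iff'.mp h1
  obtain ⟨V, hV, hVo, h1V⟩ := mem_nhds_iff.mp (Filter.inter_mem hV₁ h2)
  let u := level 0 (a • x)
  have hO : IsOpen ((fun s : Heisenberg => s • u) '' V) := (isCoveringMap_smul u).isOpenMap V hVo
  have hU : IsOpen (level 0 ⁻¹' ((fun s : Heisenberg => s • u) '' V)) :=
    hO.preimage (continuous_level 0)
  have haU : a • x ∈ level 0 ⁻¹' ((fun s : Heisenberg => s • u) '' V) :=
    ⟨1, h1V, one_smul _ _⟩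
  have hP : IsOpen[leafTopology tower.Solenoid]
      (pathComponentIn (level 0 ⁻¹' ((fun s : Heisenberg => s • u) '' V)) (a • x)) :=
    TopologicalSpace.isOpen_generateFrom_of_mem ⟨_, hU, _, haU, rfl⟩
  have hP' : IsOpen (Subtype.val ⁻¹' pathComponentIn (level 0 ⁻¹' ((fun s : Heisenberg => s • u)
      '' V)) (a • x) : Set (Leaf x)) := ⟨_, hP, rfl⟩
  refine Filter.mem_of_superset (hP'.mem_nhds (mem_pathComponentIn_self haU)) ?_
  intro z hz
  obtain ⟨b, rfl⟩ := (orbitLeaf x).surjective z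
  have hz : b • x ∈ pathComponentIn _ (a • x) := hz
  obtain ⟨φ, hφ, hφ0, hφ1, hφU⟩ := exists_smul_of_joinedIn hz
  refine ⟨φ 1, ?_, Subtype.ext hφ1⟩
  let B : {γ : Heisenberg // γ • level 0 x = level 0 x} → Set ℝ :=
    fun γ => {t | φ t * γ.1⁻¹ * a⁻¹ ∈ V}
  have hB : B ⟨1, one_smul _ _⟩ = univ := by
    refine eq_univ_of_open_partition (B := B) (fun γ => hVo.preimage (by fun_prop)) ?_ ?_ ⟨0, ?_⟩
    · rintro ⟨γ, hγ⟩ ⟨γ', hγ'⟩ t h h'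
      have h3 : (φ t * γ⁻¹ * a⁻¹)⁻¹ * (φ t * γ'⁻¹ * a⁻¹) = a * (γ * γ'⁻¹) * a⁻¹ := by group
      have h4 := hfree _ (h1 _ (hV h).1 _ (hV h').1) (a • level 0 x) (by
        rw [h3, mul_smul, mul_smul, inv_smul_smul, mul_smul, inv_smul_eq_iff.mpr hγ'.symm, hγ])
      rw [h3] at h4
      have h5 : γ * γ'⁻¹ = 1 := by
        rwa [conj_eq_one_iff] at h4
      exact Subtype.ext (mul_inv_eq_one.mp h5)
    · intro t
      obtain ⟨v, hv, hvt⟩ := hφU t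
      refine ⟨⟨a⁻¹ * v⁻¹ * φ t, ?_⟩, ?_⟩
      · have hvt : v • a • level 0 x = φ t • level 0 x := hvt
        rw [mul_smul, ← hvt, mul_smul, inv_smul_smul, inv_smul_smul]
      · change φ t * (a⁻¹ * v⁻¹ * φ t)⁻¹ * a⁻¹ ∈ V
        convert! hv using 1
        group
    · change φ 0 * 1⁻¹ * a⁻¹ ∈ V
      rw [hφ0]
      simpa using h1V
  have h6 : (1 : ℝ) ∈ B ⟨1, one_smul _ _⟩ := hB ▸ mem_univ _
  have h7 : φ 1 * 1⁻¹ * a⁻¹ ∈ V := h6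
  simpa using (hV h7).2

/-- A leaf is homeomorphic to the Heisenberg space. -/
def orbitLeafHomeomorph (x : tower.Solenoid) : Heisenberg ≃ₜ Leaf x :=
  (orbitLeaf x).toHomeomorphOfContinuousOpen (continuous_orbitLeaf x) (isOpenMap_orbitLeaf x)

theorem nonempty_chartedSpace_leaf (x : tower.Solenoid) :
    Nonempty (ChartedSpace (EuclideanSpace ℝ (Fin 3)) (Leaf x)) :=
  ⟨(orbitLeafHomeomorph x).chartedSpace⟩

/-- The orbit map is precomposed with right translation by `g⁻¹`, where `g` represents the base
point of `x`; this makes it lie over the quotient map. -/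
theorem exists_isCoveringMap_leaf (x : tower.Solenoid) : ∃ f : Heisenberg → Leaf x,
    IsCoveringMap f ∧ Function.Surjective f ∧
      ∀ a, level 0 (f a).incl = QuotientGroup.mk a := by
  obtain ⟨g, hg⟩ := QuotientGroup.mk_surjective (level 0 x)
  let e := (Homeomorph.mulRight g⁻¹).trans (orbitLeafHomeomorph x)
  refine ⟨e, isCoveringMap_homeomorph e, e.surjective, fun a => ?_⟩
  change (a * g⁻¹) • level 0 x = _
  rw [← hg]
  change QuotientGroup.mk (a * g⁻¹ * g) = _
  rw [inv_mul_cancel_right]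

end Heisenberg

/-! ### Comparison of the leafwise metric with a right-invariant one -/

/-- Two continuous families of norms are uniformly comparable over a compact set. -/
theorem exists_le_mul_of_homogeneous {X E : Type*} [TopologicalSpace X] [NormedAddCommGroup E]
    [NormedSpace ℝ E] [FiniteDimensional ℝ E] {f₁ f₂ : X → E → ℝ}
    (h₁ : Continuous fun p : X × E => f₁ p.1 p.2) (h₂ : Continuous fun p : X × E => f₂ p.1 p.2)
    (hom₁ : ∀ x (t : ℝ) v, f₁ x (t • v) = |t| * f₁ x v)
    (hom₂ : ∀ x (t : ℝ) v, f₂ x (t • v) = |t| * f₂ x v)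
    (pos₂ : ∀ x v, v ≠ 0 → 0 < f₂ x v) {K : Set X} (hK : IsCompact K) :
    ∃ C : ℝ, 0 < C ∧ ∀ x ∈ K, ∀ v, f₁ x v ≤ C * f₂ x v := by
  -- Both families scale alike, so it suffices to bound their ratio over the unit sphere.
  have hS : IsCompact (K ×ˢ Metric.sphere (0 : E) 1) := hK.prod (isCompact_sphere 0 1)
  have hne : ∀ p ∈ K ×ˢ Metric.sphere (0 : E) 1, f₂ p.1 p.2 ≠ 0 := fun p hp =>
    (pos₂ _ _ (ne_zero_of_mem_unit_sphere ⟨p.2, hp.2⟩)).ne'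
  obtain ⟨C, hC⟩ := hS.exists_bound_of_continuousOn (h₁.continuousOn.div h₂.continuousOn hne)
  refine ⟨max C 1, by positivity, fun x hx v => ?_⟩
  by_cases hv : v = 0
  · have e₁ := hom₁ x 0 0
    have e₂ := hom₂ x 0 0
    simp only [smul_zero, abs_zero, zero_mul] at e₁ e₂
    rw [hv, e₁, e₂, mul_zero]
  · have hv0 : 0 < ‖v‖ := norm_pos_iff.mpr hv
    set u := ‖v‖⁻¹ • v with hu
    have hu1 : u ∈ Metric.sphere (0 : E) 1 := by
      rw [mem_sphere_zero_iff_norm, hu, norm_smul, norm_inv, norm_norm, inv_mul_cancel₀ hv0.ne']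
    have hvu : v = ‖v‖ • u := by rw [hu, smul_inv_smul₀ hv0.ne']
    have h3 : f₁ x u / f₂ x u ≤ C := (le_abs_self _).trans (hC (x, u) ⟨hx, hu1⟩)
    have h4 : 0 < f₂ x u := pos₂ _ _ (ne_zero_of_mem_unit_sphere ⟨u, hu1⟩)
    rw [div_le_iff₀ h4] at h3
    rw [hvu, hom₁, hom₂, abs_norm]
    have h5 : C * f₂ x u ≤ max C 1 * f₂ x u := by gcongr; exact le_max_left _ _
    nlinarith

namespace Heisenberg

/-- The norm of a right-invariant metric on the Heisenberg group. -/
def refNorm (a v : EuclideanSpace ℝ (Fin 3)) : ℝ := |v 0| + |v 1| + |v 2 - a 1 * v 0|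

theorem refNorm_nonneg (a v : EuclideanSpace ℝ (Fin 3)) : 0 ≤ refNorm a v := by
  unfold refNorm
  positivity

theorem refNorm_smul (a : EuclideanSpace ℝ (Fin 3)) (t : ℝ) (v : EuclideanSpace ℝ (Fin 3)) :
    refNorm a (t • v) = |t| * refNorm a v := by
  simp only [refNorm, PiLp.smul_apply, smul_eq_mul, abs_mul]
  rw [show t * v 2 - a 1 * (t * v 0) = t * (v 2 - a 1 * v 0) by ring, abs_mul]
  ring

theorem refNorm_pos (a : EuclideanSpace ℝ (Fin 3)) {v : EuclideanSpace ℝ (Fin 3)} (hv : v ≠ 0) :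
    0 < refNorm a v := by
  refine (refNorm_nonneg a v).lt_of_ne fun h => hv ?_
  unfold refNorm at h
  have h0 := abs_nonneg (v 0)
  have h1 := abs_nonneg (v 1)
  have h2 := abs_nonneg (v 2 - a 1 * v 0)
  have e0 : v 0 = 0 := abs_eq_zero.mp (by linarith)
  have e1 : v 1 = 0 := abs_eq_zero.mp (by linarith)
  have e2 : v 2 - a 1 * v 0 = 0 := abs_eq_zero.mp (by linarith)
  rw [e0, mul_zero, sub_zero] at e2
  ext i
  fin_cases i <;> assumption

theorem continuous_refNorm :
    Continuous fun p : EuclideanSpace ℝ (Fin 3) × EuclideanSpace ℝ (Fin 3) => refNorm p.1 p.2 := by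
  unfold refNorm
  fun_prop

/-- The differential of the right translations by the points with second coordinate `s`. -/
def shear (s : ℝ) : EuclideanSpace ℝ (Fin 3) →L[ℝ] EuclideanSpace ℝ (Fin 3) :=
  ContinuousLinearMap.id ℝ _ +
    s • (EuclideanSpace.proj (𝕜 := ℝ) (0 : Fin 3)).smulRight (EuclideanSpace.single 2 1)

theorem shear_zero (s : ℝ) (v : EuclideanSpace ℝ (Fin 3)) : shear s v 0 = v 0 := by
  simp [shear]

theorem shear_one (s : ℝ) (v : EuclideanSpace ℝ (Fin 3)) : shear s v 1 = v 1 := by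
  simp [shear]

theorem shear_two (s : ℝ) (v : EuclideanSpace ℝ (Fin 3)) : shear s v 2 = v 2 + s * v 0 := by
  simp [shear]

theorem mulRight_eq (b : Heisenberg) :
    mulRight b = fun a => shear (b.coord 1) a + (show EuclideanSpace ℝ (Fin 3) from b) := by
  funext a
  ext i
  fin_cases i
  · change a 0 + b.coord 0 = shear (b.coord 1) a 0 + b.coord 0
    rw [shear_zero]
  · change a 1 + b.coord 1 = shear (b.coord 1) a 1 + b.coord 1
    rw [shear_one]
  · change a 2 + b.coord 2 + a 0 * b.coord 1 = shear (b.coord 1) a 2 + b.coord 2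
    rw [shear_two]
    ring

theorem hasFDerivAt_mulRight (b : Heisenberg) (a : EuclideanSpace ℝ (Fin 3)) :
    HasFDerivAt (mulRight b) (shear (b.coord 1)) a := by
  rw [mulRight_eq]
  exact (shear (b.coord 1)).hasFDerivAt.add_const _

/-- The form `dz - y dx` is right-invariant: the translation adds `b.coord 1` to `y` and `b.coord 1
* dx` to `dz`. -/
theorem refNorm_mulRight (b : Heisenberg) (a v : EuclideanSpace ℝ (Fin 3)) :
    refNorm (mulRight b a) (shear (b.coord 1) v) = refNorm a v := by
  have h : mulRight b a 1 = a 1 + b.coord 1 := rfl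
  rw [refNorm, refNorm, shear_zero, shear_one, shear_two, h]
  congr 2
  ring

/-- The projection to a quotient, as a map on the Euclidean space. -/
def quotMk (Γ : Subgroup Heisenberg) (a : EuclideanSpace ℝ (Fin 3)) : Heisenberg ⧸ Γ :=
  QuotientGroup.mk (show Heisenberg from a)

section Metric

variable (Γ : Subgroup Heisenberg) [DiscreteTopology Γ]

theorem isLocalDiffeomorph_quotMk : IsLocalDiffeomorph (𝓡 3) (𝓡 3) ∞ (quotMk Γ) :=
  isLocalDiffeomorph_mk Γ

/-- Chain rule for `quotMk Γ ∘ mulRight b = quotMk Γ`; it makes the pulled back metric invariant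
under `Γ`. -/
theorem tangentMap_quotMk_mulRight {b : Heisenberg} (hb : b ∈ Γ)
    (a v : EuclideanSpace ℝ (Fin 3)) :
    tangentMap (𝓡 3) (𝓡 3) (quotMk Γ) ⟨mulRight b a, shear (b.coord 1) v⟩ =
      tangentMap (𝓡 3) (𝓡 3) (quotMk Γ) ⟨a, v⟩ := by
  have h1 : quotMk Γ ∘ mulRight b = quotMk Γ := by
    funext u
    exact QuotientGroup.mk_mul_of_mem (show Heisenberg from u) hb
  have h2 : MDifferentiableAt (𝓡 3) (𝓡 3) (mulRight b) a :=
    (hasFDerivAt_mulRight b a).differentiableAt.mdifferentiableAt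
  have h3 := tangentMap_comp_at (⟨a, v⟩ : TangentBundle (𝓡 3) (EuclideanSpace ℝ (Fin 3)))
    ((isLocalDiffeomorph_quotMk Γ).mdifferentiable (by simp) _) h2
  rw [h1] at h3
  rw [h3]
  congr 1
  simp only [tangentMap, mfderiv_eq_fderiv, (hasFDerivAt_mulRight b a).fderiv]
  rfl

variable {Γ} (g : SmoothRiemannianMetric 3 (Heisenberg ⧸ Γ))

/-- The norm of a tangent vector of the Heisenberg space, in a metric of the quotient. -/
def pullNorm (a v : EuclideanSpace ℝ (Fin 3)) : ℝ :=
  letI : Bundle.RiemannianBundle (fun x : Heisenberg ⧸ Γ => TangentSpace (𝓡 3) x) :=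
    ⟨g.toRiemannianMetric⟩
  ‖(tangentMap (𝓡 3) (𝓡 3) (quotMk Γ) ⟨a, v⟩).2‖

theorem pullNorm_nonneg (a v : EuclideanSpace ℝ (Fin 3)) : 0 ≤ pullNorm g a v :=
  letI : Bundle.RiemannianBundle (fun x : Heisenberg ⧸ Γ => TangentSpace (𝓡 3) x) :=
    ⟨g.toRiemannianMetric⟩
  norm_nonneg (tangentMap (𝓡 3) (𝓡 3) (quotMk Γ) ⟨a, v⟩).2

theorem pullNorm_mulRight {b : Heisenberg} (hb : b ∈ Γ) (a v : EuclideanSpace ℝ (Fin 3)) :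
    pullNorm g (mulRight b a) (shear (b.coord 1) v) = pullNorm g a v := by
  unfold pullNorm
  rw [tangentMap_quotMk_mulRight Γ hb]

theorem pullNorm_smul (a : EuclideanSpace ℝ (Fin 3)) (t : ℝ) (v : EuclideanSpace ℝ (Fin 3)) :
    pullNorm g a (t • v) = |t| * pullNorm g a v := by
  let _ : Bundle.RiemannianBundle (fun x : Heisenberg ⧸ Γ => TangentSpace (𝓡 3) x) :=
    ⟨g.toRiemannianMetric⟩
  have h : mfderiv (𝓡 3) (𝓡 3) (quotMk Γ) a (t • v) = t • mfderiv (𝓡 3) (𝓡 3) (quotMk Γ) a v :=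
    (mfderiv (𝓡 3) (𝓡 3) (quotMk Γ) a).map_smul t v
  have h2 : ∀ w : TangentSpace (𝓡 3) (quotMk Γ a), ‖w‖ = √(g.inner _ w w) := fun w =>
    norm_eq_sqrt_real_inner w
  have h3 : ∀ w : TangentSpace (𝓡 3) (quotMk Γ a),
      √(g.inner _ (t • w) (t • w)) = |t| * √(g.inner _ w w) := fun w => by
    simp only [map_smul, smul_apply]
    rw [smul_smul, smul_eq_mul, Real.sqrt_mul (mul_self_nonneg t), Real.sqrt_mul_self_eq_abs]
  exact (((congrArg norm h).trans (h2 _)).trans (h3 _)).trans (congrArg (|t| * ·) (h2 _)).symm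

theorem pullNorm_pos (a : EuclideanSpace ℝ (Fin 3)) {v : EuclideanSpace ℝ (Fin 3)}
    (hv : v ≠ 0) : 0 < pullNorm g a v := by
  let _ : Bundle.RiemannianBundle (fun x : Heisenberg ⧸ Γ => TangentSpace (𝓡 3) x) :=
    ⟨g.toRiemannianMetric⟩
  change 0 < ‖mfderiv (𝓡 3) (𝓡 3) (quotMk Γ) a v‖
  refine norm_pos_iff.mpr fun h => hv ?_
  let e := (isLocalDiffeomorph_quotMk Γ).mfderivToContinuousLinearEquiv (by simp) a
  exact e.injective (h.trans e.map_zero.symm)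

theorem continuous_pullNorm :
    Continuous fun p : EuclideanSpace ℝ (Fin 3) × EuclideanSpace ℝ (Fin 3) =>
      pullNorm g p.1 p.2 := by
  let _ : Bundle.RiemannianBundle (fun x : Heisenberg ⧸ Γ => TangentSpace (𝓡 3) x) :=
    ⟨g.toRiemannianMetric⟩
  have h1 : Continuous fun p : EuclideanSpace ℝ (Fin 3) × EuclideanSpace ℝ (Fin 3) =>
      (⟨p.1, p.2⟩ : TangentBundle (𝓡 3) (EuclideanSpace ℝ (Fin 3))) :=
    (tangentBundleModelSpaceHomeomorph (𝓡 3)).symm.continuous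
  have h2 := ((isLocalDiffeomorph_quotMk Γ).contMDiff.continuous_tangentMap (by simp)).comp h1
  have _ : IsContinuousRiemannianBundle (EuclideanSpace ℝ (Fin 3))
      (fun x : Heisenberg ⧸ Γ => TangentSpace (𝓡 3) x) :=
    ⟨g.inner, g.contMDiff.continuous, fun _ _ _ => rfl⟩
  have h3 := Continuous.inner_bundle (F := EuclideanSpace ℝ (Fin 3))
    (E := fun x : Heisenberg ⧸ Γ => TangentSpace (𝓡 3) x)
    (b := fun p : EuclideanSpace ℝ (Fin 3) × EuclideanSpace ℝ (Fin 3) => quotMk Γ p.1)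
    (v := fun p => mfderiv (𝓡 3) (𝓡 3) (quotMk Γ) p.1 p.2)
    (w := fun p => mfderiv (𝓡 3) (𝓡 3) (quotMk Γ) p.1 p.2) h2 h2
  exact (h3.sqrt).congr fun p => (norm_eq_sqrt_real_inner _).symm

/-- A Riemannian metric of a compact quotient is comparable to the right-invariant one. -/
theorem exists_pullNorm_bounds {K : Set (EuclideanSpace ℝ (Fin 3))} (hK : IsCompact K)
    (hΓ : ∀ a, ∃ γ ∈ Γ, mulRight γ a ∈ K) : ∃ C : ℝ, 0 < C ∧ ∀ a v,
      pullNorm g a v ≤ C * refNorm a v ∧ refNorm a v ≤ C * pullNorm g a v := by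
  obtain ⟨C₁, h₁, hC₁⟩ := exists_le_mul_of_homogeneous (continuous_pullNorm g) continuous_refNorm
    (pullNorm_smul g) refNorm_smul (fun a _ hv => refNorm_pos a hv) hK
  obtain ⟨C₂, h₂, hC₂⟩ := exists_le_mul_of_homogeneous continuous_refNorm (continuous_pullNorm g)
    refNorm_smul (pullNorm_smul g) (fun a _ hv => pullNorm_pos g a hv) hK
  refine ⟨max C₁ C₂, by positivity, fun a v => ?_⟩
  obtain ⟨γ, hγ, ha⟩ := hΓ a
  -- Both norms are invariant under `γ`, so the tangent vector can be moved over `K`.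
  rw [← pullNorm_mulRight g hγ, ← refNorm_mulRight γ]
  have h3 : 0 ≤ pullNorm g (mulRight γ a) (shear (γ.coord 1) v) := pullNorm_nonneg g _ _
  have h4 := refNorm_nonneg (mulRight γ a) (shear (γ.coord 1) v)
  exact ⟨(hC₁ _ ha _).trans (mul_le_mul_of_nonneg_right (le_max_left _ _) h4),
    (hC₂ _ ha _).trans (mul_le_mul_of_nonneg_right (le_max_right _ _) h3)⟩

/-- The length of the projection of a curve to the quotient. -/
theorem length_quotMk_comp {c : ℝ → EuclideanSpace ℝ (Fin 3)}
    (hc : ContDiffOn ℝ 1 c (Icc 0 1)) : SmoothRiemannianMetric.length g (quotMk Γ ∘ c) =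
      ∫⁻ t in Ioo (0 : ℝ) 1, ENNReal.ofReal (pullNorm g (c t) (deriv c t)) := by
  let _ : Bundle.RiemannianBundle (fun x : Heisenberg ⧸ Γ => TangentSpace (𝓡 3) x) :=
    ⟨g.toRiemannianMetric⟩
  change pathELength (𝓡 3) (quotMk Γ ∘ c) 0 1 = _
  rw [pathELength_eq_lintegral_mfderiv_Ioo]
  refine setLIntegral_congr_fun measurableSet_Ioo fun t ht => ?_
  have h1 : DifferentiableAt ℝ c t :=
    ((hc t ⟨ht.1.le, ht.2.le⟩).contDiffAt (Icc_mem_nhds ht.1 ht.2)).differentiableAt one_ne_zero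
  have h2 := mfderiv_comp_apply (I := 𝓘(ℝ, ℝ)) t
    ((isLocalDiffeomorph_quotMk Γ).mdifferentiable (by simp) (c t)) h1.mdifferentiableAt (1 : ℝ)
  change ‖mfderiv 𝓘(ℝ, ℝ) (𝓡 3) (quotMk Γ ∘ c) t (1 : ℝ)‖ₑ = _
  rw [h2, mfderiv_eq_fderiv]
  change _ = ENNReal.ofReal ‖mfderiv (𝓡 3) (𝓡 3) (quotMk Γ) (c t) (deriv c t)‖
  rw [ofReal_norm]
  rfl

end Metric

end Heisenberg

/-! ### Lengths of curves and lifts of leafwise curves -/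

namespace Heisenberg

/-- The length of a curve for the right-invariant metric. -/
def refLength (c : ℝ → EuclideanSpace ℝ (Fin 3)) : ℝ≥0∞ :=
  ∫⁻ t in Ioo (0 : ℝ) 1, ENNReal.ofReal (refNorm (c t) (deriv c t))

theorem hasDerivAt_coord {c : ℝ → EuclideanSpace ℝ (Fin 3)} {t : ℝ} {v : EuclideanSpace ℝ (Fin 3)}
    (h : HasDerivAt c v t) (i : Fin 3) : HasDerivAt (fun t => c t i) (v i) t :=
  (EuclideanSpace.proj (𝕜 := ℝ) i).hasFDerivAt.comp_hasDerivAt t h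

theorem hasDerivAt_of_contDiffOn {c : ℝ → EuclideanSpace ℝ (Fin 3)}
    (hc : ContDiffOn ℝ 1 c (Icc 0 1)) {t : ℝ} (ht : t ∈ Ioo (0 : ℝ) 1) :
    HasDerivAt c (deriv c t) t :=
  (((hc t ⟨ht.1.le, ht.2.le⟩).contDiffAt
    (Icc_mem_nhds ht.1 ht.2)).differentiableAt one_ne_zero).hasDerivAt

/-- A function whose derivative is bounded by the speed of a curve. -/
theorem abs_sub_le_of_refLength_le {c : ℝ → EuclideanSpace ℝ (Fin 3)} {l B : ℝ}
    (hB : 0 ≤ B) (hl : 0 ≤ l) (hL : refLength c ≤ ENNReal.ofReal l) {f : ℝ → ℝ}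
    (hf : ContDiffOn ℝ 1 f (Icc 0 1))
    (h : ∀ t ∈ Ioo (0 : ℝ) 1, |deriv f t| ≤ B * refNorm (c t) (deriv c t))
    {s : ℝ} (hs : s ∈ Icc (0 : ℝ) 1) : |f s - f 0| ≤ B * l := by
  have h1 := enorm_sub_le_lintegral_deriv_of_contDiffOn_Icc
    (hf.mono (Icc_subset_Icc le_rfl hs.2)) hs.1
  have h2 : ∫⁻ t in Icc 0 s, ‖deriv f t‖ₑ ≤ ENNReal.ofReal (B * l) := by
    calc ∫⁻ t in Icc 0 s, ‖deriv f t‖ₑ ≤ ∫⁻ t in Icc (0 : ℝ) 1, ‖deriv f t‖ₑ :=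
          lintegral_mono_set (Icc_subset_Icc le_rfl hs.2)
      _ = ∫⁻ t in Ioo (0 : ℝ) 1, ‖deriv f t‖ₑ := by rw [restrict_Ioo_eq_restrict_Icc]
      _ ≤ ∫⁻ t in Ioo (0 : ℝ) 1, ENNReal.ofReal B *
            ENNReal.ofReal (refNorm (c t) (deriv c t)) := by
          refine setLIntegral_mono' measurableSet_Ioo fun t ht => ?_
          rw [← ENNReal.ofReal_mul hB, ← ofReal_norm, Real.norm_eq_abs]
          exact ENNReal.ofReal_le_ofReal (h t ht)
      _ = ENNReal.ofReal B * refLength c := by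
          rw [lintegral_const_mul' _ _ ENNReal.ofReal_ne_top]
          rfl
      _ ≤ ENNReal.ofReal (B * l) := by
          rw [ENNReal.ofReal_mul hB]
          gcongr
  have h3 := h1.trans h2
  rw [← ofReal_norm, Real.norm_eq_abs, ENNReal.ofReal_le_ofReal_iff (by positivity)] at h3
  exact h3

/-- The displacement along a curve is controlled by its length. -/
theorem displacement_le_of_refLength_le {c : ℝ → EuclideanSpace ℝ (Fin 3)}
    (hc : ContDiffOn ℝ 1 c (Icc 0 1)) {l : ℝ} (hl : 0 ≤ l)
    (hL : refLength c ≤ ENNReal.ofReal l) : |c 1 0 - c 0 0| ≤ l ∧ |c 1 1 - c 0 1| ≤ l ∧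
      |c 1 2 - c 0 2 - c 0 1 * (c 1 0 - c 0 0)| ≤ l + l ^ 2 := by
  have hci : ∀ i, ContDiffOn ℝ 1 (fun t => c t i) (Icc 0 1) := fun i =>
    (EuclideanSpace.proj (𝕜 := ℝ) i).contDiff.comp_contDiffOn hc
  have hder : ∀ t ∈ Ioo (0 : ℝ) 1, ∀ i, HasDerivAt (fun t => c t i) (deriv c t i) t :=
    fun t ht i => hasDerivAt_coord (hasDerivAt_of_contDiffOn hc ht) i
  have hy : ∀ s ∈ Icc (0 : ℝ) 1, |c s 1 - c 0 1| ≤ l := fun s hs => by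
    refine (abs_sub_le_of_refLength_le zero_le_one hl hL (hci 1) (fun t ht => ?_) hs).trans_eq
      (one_mul l)
    rw [(hder t ht 1).deriv, one_mul, refNorm]
    linarith [abs_nonneg (deriv c t 0), abs_nonneg (deriv c t 2 - c t 1 * deriv c t 0)]
  refine ⟨?_, hy 1 (by simp), ?_⟩
  · refine (abs_sub_le_of_refLength_le zero_le_one hl hL (hci 0) (fun t ht => ?_)
      (by simp : (1 : ℝ) ∈ Icc (0 : ℝ) 1)).trans_eq (one_mul l)
    rw [(hder t ht 0).deriv, one_mul, refNorm]
    linarith [abs_nonneg (deriv c t 1), abs_nonneg (deriv c t 2 - c t 1 * deriv c t 0)]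
  -- The derivative of `z - y(0) x` is `(z' - y x') + (y - y(0)) x'`. As `y` moves by at most `l`,
  -- this is at most `1 + l` times the speed.
  · have h := abs_sub_le_of_refLength_le (c := c) (B := 1 + l) (f := fun t => c t 2 - c 0 1 * c t 0)
      (by positivity) hl hL ((hci 2).sub (contDiffOn_const.mul (hci 0))) (fun t ht => ?_)
      (by simp : (1 : ℝ) ∈ Icc (0 : ℝ) 1)
    · convert! h using 1
      · congr 1
        ring
      · ring
    · have h0 : HasDerivAt (fun t => c t 2 - c 0 1 * c t 0)
          (deriv c t 2 - c 0 1 * deriv c t 0) t :=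
        (hder t ht 2).sub ((hder t ht 0).const_mul (c 0 1))
      rw [h0.deriv, refNorm]
      have h1 : deriv c t 2 - c 0 1 * deriv c t 0 =
        (deriv c t 2 - c t 1 * deriv c t 0) + (c t 1 - c 0 1) * deriv c t 0 := by ring
      rw [h1]
      refine (abs_add_le _ _).trans ?_
      rw [abs_mul]
      have h2 := mul_le_mul_of_nonneg_right (hy t ⟨ht.1.le, ht.2.le⟩) (abs_nonneg (deriv c t 0))
      have h3 := mul_nonneg hl (abs_nonneg (deriv c t 1))
      have h4 := mul_nonneg hl (abs_nonneg (deriv c t 2 - c t 1 * deriv c t 0))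
      nlinarith [abs_nonneg (deriv c t 0), abs_nonneg (deriv c t 1)]

/-- The curve with given coordinates, translated on the right. -/
def coordCurve (p q s : ℝ → ℝ) (a : Heisenberg) (t : ℝ) : EuclideanSpace ℝ (Fin 3) :=
  mulRight a !₂[p t, q t, s t]

theorem contDiff_coordCurve {p q s : ℝ → ℝ} (hp : ContDiff ℝ ∞ p) (hq : ContDiff ℝ ∞ q)
    (hs : ContDiff ℝ ∞ s) (a : Heisenberg) : ContDiff ℝ ∞ (coordCurve p q s a) := by
  refine ((contDiff_mulRight a).of_le le_top).comp (contDiff_euclidean.mpr fun i => ?_)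
  fin_cases i <;> assumption

theorem refLength_coordCurve_le {p q s p' q' s' : ℝ → ℝ} (hp : ∀ t, HasDerivAt p (p' t) t)
    (hq : ∀ t, HasDerivAt q (q' t) t) (hs : ∀ t, HasDerivAt s (s' t) t) (a : Heisenberg) {B : ℝ}
    (hB : ∀ t ∈ Ioo (0 : ℝ) 1, |p' t| + |q' t| + |s' t - q t * p' t| ≤ B) :
    refLength (coordCurve p q s a) ≤ ENNReal.ofReal B := by
  have h1 : ∀ t, deriv (coordCurve p q s a) t = shear (a.coord 1) !₂[p' t, q' t, s' t] := by
    intro t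
    refine ((hasFDerivAt_mulRight a _).comp_hasDerivAt t ?_).deriv
    refine (PiLp.continuousLinearEquiv 2 ℝ fun _ : Fin 3 => ℝ).symm.toContinuousLinearMap
      |>.hasFDerivAt.comp_hasDerivAt t (f' := ![p' t, q' t, s' t]) (hasDerivAt_pi.mpr fun i => ?_)
    fin_cases i
    · exact hp t
    · exact hq t
    · exact hs t
  calc refLength (coordCurve p q s a) ≤ ∫⁻ t in Ioo (0 : ℝ) 1, ENNReal.ofReal B := by
        refine setLIntegral_mono' measurableSet_Ioo fun t ht => ENNReal.ofReal_le_ofReal ?_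
        rw [h1, coordCurve, refNorm_mulRight]
        exact hB t ht
    _ = ENNReal.ofReal B := by simp

section Leaf

variable (g : SmoothRiemannianMetric 3 (Heisenberg ⧸ lattice 0))

theorem exists_length_bounds : ∃ C : ℝ, 0 < C ∧ ∀ c, ContDiffOn ℝ 1 c (Icc 0 1) →
    SmoothRiemannianMetric.length g (quotMk (lattice 0) ∘ c) ≤ ENNReal.ofReal C * refLength c ∧
      refLength c ≤ ENNReal.ofReal C *
        SmoothRiemannianMetric.length g (quotMk (lattice 0) ∘ c) := by
  obtain ⟨C, hC, h⟩ := exists_pullNorm_bounds g (isCompact_box (5 ^ 0)) (exists_mul_mem_box 0)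
  refine ⟨C, hC, fun c hc => ?_⟩
  rw [length_quotMk_comp g hc, refLength, ← lintegral_const_mul' _ _ ENNReal.ofReal_ne_top,
    ← lintegral_const_mul' _ _ ENNReal.ofReal_ne_top]
  constructor <;> refine lintegral_mono fun t => ?_ <;> rw [← ENNReal.ofReal_mul hC.le] <;>
    apply ENNReal.ofReal_le_ofReal
  exacts [(h _ _).1, (h _ _).2]

/-- The parametrization of a leaf that lifts the projection of the Heisenberg space, for a point
`b` over the base point of the leaf. -/
def leafParam (x : tower.Solenoid) (b a : Heisenberg) : tower.Solenoid := (a * b⁻¹) • x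

variable {x : tower.Solenoid} {b : Heisenberg}

theorem level_zero_leafParam (hb : level 0 x = QuotientGroup.mk b) (a : Heisenberg) :
    level 0 (leafParam x b a) = QuotientGroup.mk a := by
  rw [leafParam, level_smul, hb]
  change QuotientGroup.mk (a * b⁻¹ * b) = _
  rw [inv_mul_cancel_right]

theorem leafParam_self : leafParam x b b = x := by simp [leafParam]

theorem leafParam_injective : Function.Injective (leafParam x b) := by
  intro a a' h
  have h1 : (a' * b⁻¹)⁻¹ • (a * b⁻¹) • x = x := by
    rw [inv_smul_eq_iff]
    exact h
  rw [← mul_smul] at h1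
  exact mul_right_cancel (inv_mul_eq_one.mp (eq_one_of_smul_eq_self h1)).symm

theorem continuous_leafParam : Continuous (leafParam x b) :=
  (continuous_smul_left x).comp (continuous_mul_const _)

/-- A leafwise curve lifts to the Heisenberg space. -/
theorem exists_lift_curve (hb : level 0 x = QuotientGroup.mk b) {c : ℝ → tower.Solenoid}
    (hc : ContinuousOn c (Icc 0 1))
    (hc' : ContMDiffOn 𝓘(ℝ, ℝ) (𝓡 3) 1 (fun t => level 0 (c t)) (Icc 0 1)) {a : Heisenberg}
    (h0 : c 0 = leafParam x b a) : ∃ φ : ℝ → EuclideanSpace ℝ (Fin 3),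
      ContDiffOn ℝ 1 φ (Icc 0 1) ∧ φ 0 = a ∧
        ∀ t ∈ Icc (0 : ℝ) 1, c t = leafParam x b (φ t) := by
  -- The curve is extended by constants to the whole line, which is simply connected.
  have hc1 : Continuous fun t => c (projIcc (0 : ℝ) 1 zero_le_one t) :=
    hc.comp_continuous (continuous_subtype_val.comp continuous_projIcc) fun t => (projIcc _ _ _ t).2
  obtain ⟨ψ, hψ, hψ0, hψ1⟩ := exists_lift hc1 0 (x := x) (g := a * b⁻¹)
    (by rw [projIcc_left]; exact h0)
  let φ : ℝ → Heisenberg := fun t => ψ t * b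
  have hφ : Continuous φ := by fun_prop
  have hφc : ∀ t ∈ Icc (0 : ℝ) 1, c t = leafParam x b (φ t) := by
    intro t ht
    have h := hψ1 t
    rw [projIcc_of_mem zero_le_one ht] at h
    rw [h]
    simp [leafParam, φ]
  refine ⟨φ, ?_, ?_, hφc⟩
  -- Near `t` the lift is a smooth local inverse of the projection applied to the projected curve.
  · intro t ht
    have hld := isLocalDiffeomorph_quotMk (lattice 0) (φ t)
    have h1 : ContMDiffWithinAt 𝓘(ℝ, ℝ) (𝓡 3) 1 (fun t => hld.localInverse (level 0 (c t)))
        (Icc 0 1) t := by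
      have e : level 0 (c t) = quotMk (lattice 0) (φ t) := by
        rw [hφc t ht]
        exact level_zero_leafParam hb _
      have h2 : ContMDiffAt (𝓡 3) (𝓡 3) 1 hld.localInverse (level 0 (c t)) := by
        rw [e]
        exact hld.localInverse_contMDiffAt.of_le (by simp)
      exact h2.comp_contMDiffWithinAt t (hc' t ht)
    refine ContMDiffWithinAt.contDiffWithinAt (h1.congr_of_eventuallyEq ?_ ?_)
    · have h3 := (hφ.tendsto t).eventually hld.localInverse_eventuallyEq_left
      filter_upwards [nhdsWithin_le_nhds h3, self_mem_nhdsWithin] with u hu hu'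
      rw [hφc u hu', level_zero_leafParam hb]
      exact hu.symm
    · rw [hφc t ht, level_zero_leafParam hb]
      exact hld.localInverse_eventuallyEq_left.eq_of_nhds.symm
  · change ψ 0 * b = a
    rw [hψ0, inv_mul_cancel_right]

theorem leafEDist_le_length (hb : level 0 x = QuotientGroup.mk b)
    {φ : ℝ → EuclideanSpace ℝ (Fin 3)} (hφ : ContDiff ℝ ∞ φ) :
    tower.leafEDist g (leafParam x b (φ 0)) (leafParam x b (φ 1)) ≤
      SmoothRiemannianMetric.length g (quotMk (lattice 0) ∘ φ) := by
  have h : (tower.baseProj ∘ fun t => leafParam x b (φ t)) = quotMk (lattice 0) ∘ φ :=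
    funext fun t => level_zero_leafParam hb _
  have h1 : Continuous fun t => leafParam x b (φ t) := continuous_leafParam.comp hφ.continuous
  have h2 : ContMDiffOn 𝓘(ℝ, ℝ) (𝓡 3) 1 (tower.baseProj ∘ fun t => leafParam x b (φ t))
      (Icc 0 1) := by
    rw [h]
    exact (((isLocalDiffeomorph_quotMk (lattice 0)).contMDiff.comp
      hφ.contMDiff).of_le (by simp)).contMDiffOn
  unfold Presentation.leafEDist
  refine iInf_le_of_le (fun t => leafParam x b (φ t)) (iInf_le_of_le h1.continuousOn
    (iInf_le_of_le h2 (iInf_le_of_le rfl (iInf_le_of_le rfl ?_))))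
  rw [h]
  exact le_rfl

theorem exists_curve_of_leafEDist_lt (hb : level 0 x = QuotientGroup.mk b) {a : Heisenberg}
    {y : tower.Solenoid} {d : ℝ≥0∞} (h : tower.leafEDist g (leafParam x b a) y < d) :
    ∃ φ : ℝ → EuclideanSpace ℝ (Fin 3), ContDiffOn ℝ 1 φ (Icc 0 1) ∧
      φ 0 = a ∧ leafParam x b (φ 1) = y ∧
        SmoothRiemannianMetric.length g (quotMk (lattice 0) ∘ φ) < d := by
  unfold Presentation.leafEDist at h
  simp only [iInf_lt_iff] at h
  obtain ⟨c, hc, hc', h0, h1, hd⟩ := h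
  obtain ⟨φ, hφ, hφ0, hφc⟩ := exists_lift_curve hb hc hc' h0
  refine ⟨φ, hφ, hφ0, ?_, ?_⟩
  · rw [← hφc 1 (by simp), h1]
  · convert! hd using 1
    let _ : Bundle.RiemannianBundle (fun x : Heisenberg ⧸ lattice 0 => TangentSpace (𝓡 3) x) :=
      ⟨g.toRiemannianMetric⟩
    refine pathELength_congr (I := 𝓡 3) fun t ht => ?_
    change _ = level 0 (c t)
    rw [hφc t ht]
    exact (level_zero_leafParam hb _).symm

end Leaf

end Heisenberg

/-! ### Leafwise balls and boxes -/

namespace Heisenberg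

/-- This bound is linear in `Z`, as needed for the diameters of small sets; horizontal curves would
only give the order of `√|Z|`. -/
theorem refLength_line_le (X Y Z : ℝ) (a : Heisenberg) :
    refLength (coordCurve (fun t => t * X) (fun t => t * Y) (fun t => t * Z) a) ≤
      ENNReal.ofReal (|X| + |Y| + |Z| + |X| * |Y|) := by
  have h : ∀ W t : ℝ, HasDerivAt (fun t : ℝ => t * W) W t := fun W t => by
    simpa using (hasDerivAt_id t).mul_const W
  refine refLength_coordCurve_le (h X) (h Y) (h Z) a fun t ht => ?_
  have h1 := abs_sub Z (t * Y * X)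
  have h2 : |t * Y * X| ≤ |X| * |Y| := by
    rw [abs_mul, abs_mul, abs_of_pos ht.1, mul_comm |X|]
    have h3 := mul_nonneg (abs_nonneg Y) (abs_nonneg X)
    nlinarith [ht.2]
  linarith

/-- The height of the horizontal curve over a plane curve. -/
def liftHeight (X Y r m t : ℝ) : ℝ :=
  Y * (X + r) * t ^ 2 / 2 - 2 * r * Y * t ^ 3 / 3 +
    m * ((X + r) * t ^ 2 / 2 - (X + r) * t ^ 3 + (X + r) * t ^ 4 / 2 - 2 * r * t ^ 3 / 3 +
      3 * r * t ^ 4 / 2 - 4 * r * t ^ 5 / 5)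

/-- If `s' = q p'`, the speed is `|p'| + |q'|` and the height gained is the integral of `q p'`. The
segment to `(X, Y)` is perturbed by `r (t - t²)` in the first coordinate and by `m t (1 - t) (1 - 2
t)` in the second, both vanishing at the ends. The second bump has mean zero, so the `m`-part of the
height is `m r / 30`, and an `m` of order `r` attains every height up to `r ^ 2`. -/
theorem refLength_horizontal_le {X Y Z r : ℝ} (hr : 0 < r) (hX : |X| ≤ r) (hY : |Y| ≤ r)
    (hZ : |Z| ≤ r ^ 2) (a : Heisenberg) : ∃ p q s : ℝ → ℝ, ContDiff ℝ ∞ p ∧ ContDiff ℝ ∞ q ∧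
      ContDiff ℝ ∞ s ∧ p 0 = 0 ∧ q 0 = 0 ∧ s 0 = 0 ∧ p 1 = X ∧ q 1 = Y ∧ s 1 = Z ∧
        refLength (coordCurve p q s a) ≤ ENNReal.ofReal (83 * r) := by
  -- Solution of `s 1 = Z`, as the endpoint height is `Y (X + r) / 2 - 2 r Y / 3 + m r / 30`.
  set m := 30 * (Z - Y * (X + r) / 2 + 2 * r * Y / 3) / r with hm
  have hmr : m * r = 30 * (Z - Y * (X + r) / 2 + 2 * r * Y / 3) := by
    rw [hm, div_mul_cancel₀ _ hr.ne']
  have hX' := abs_le.mp hX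
  have hY' := abs_le.mp hY
  have hZ' := abs_le.mp hZ
  -- The three terms are at most `r²`, `r²` and `2 r² / 3`, and `30 * (8 / 3) = 80`.
  have hm80 : |m| ≤ 80 * r := by
    have h1 : |Y * (X + r)| ≤ r * (2 * r) := by
      rw [abs_mul]
      exact mul_le_mul hY (abs_le.mpr ⟨by linarith, by linarith⟩) (abs_nonneg _) hr.le
    have h1' := abs_le.mp h1
    have h2 : |m| * r ≤ 80 * r * r := by
      rw [← abs_of_pos hr, ← abs_mul, abs_of_pos hr, hmr, abs_le]
      constructor <;> nlinarith
    exact le_of_mul_le_mul_right h2 hr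
  refine ⟨fun t => X * t + r * (t - t ^ 2), fun t => Y * t + m * (t - 3 * t ^ 2 + 2 * t ^ 3),
    liftHeight X Y r m, by fun_prop, by fun_prop, by unfold liftHeight; fun_prop, by simp, by simp,
    by simp [liftHeight], by simp, ?_, ?_, ?_⟩
  · ring
  · simp only [liftHeight]
    linear_combination hmr / 30
  · refine refLength_coordCurve_le (p' := fun t => X + r * (1 - 2 * t))
      (q' := fun t => Y + m * (1 - 6 * t + 6 * t ^ 2))
      (s' := fun t => (Y * t + m * (t - 3 * t ^ 2 + 2 * t ^ 3)) * (X + r * (1 - 2 * t)))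
      (fun t => ?_) (fun t => ?_) (fun t => ?_) a fun t ht => ?_
    · have h1 := ((hasDerivAt_id t).const_mul X).add
        (((hasDerivAt_id t).sub (hasDerivAt_pow 2 t)).const_mul r)
      refine HasDerivAt.congr_deriv h1 ?_
      push_cast
      ring
    · have h1 := ((hasDerivAt_id t).const_mul Y).add
        ((((hasDerivAt_id t).sub ((hasDerivAt_pow 2 t).const_mul 3)).add
          ((hasDerivAt_pow 3 t).const_mul 2)).const_mul m)
      refine HasDerivAt.congr_deriv h1 ?_
      push_cast
      ring
    · have h1 := (((hasDerivAt_pow 2 t).const_mul (Y * (X + r))).div_const 2).sub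
        (((hasDerivAt_pow 3 t).const_mul (2 * r * Y)).div_const 3) |>.add
        ((((((((hasDerivAt_pow 2 t).const_mul (X + r)).div_const 2).sub
          ((hasDerivAt_pow 3 t).const_mul (X + r))).add
          (((hasDerivAt_pow 4 t).const_mul (X + r)).div_const 2)).sub
          (((hasDerivAt_pow 3 t).const_mul (2 * r)).div_const 3)).add
          (((hasDerivAt_pow 4 t).const_mul (3 * r)).div_const 2)).sub
          (((hasDerivAt_pow 5 t).const_mul (4 * r)).div_const 5) |>.const_mul m)
      refine HasDerivAt.congr_deriv h1 ?_
      push_cast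
      ring
    · have e1 : |X + r * (1 - 2 * t)| ≤ 2 * r := by
        rw [abs_le]
        constructor <;> nlinarith [ht.1, ht.2]
      have e2 : |Y + m * (1 - 6 * t + 6 * t ^ 2)| ≤ 81 * r := by
        refine (abs_add_le _ _).trans ?_
        have e3 : |1 - 6 * t + 6 * t ^ 2| ≤ 1 := by
          rw [abs_le]
          constructor <;> nlinarith [ht.1, ht.2, sq_nonneg (2 * t - 1)]
        have e4 : |m * (1 - 6 * t + 6 * t ^ 2)| ≤ |m| := by
          rw [abs_mul]
          exact mul_le_of_le_one_right (abs_nonneg _) e3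
        linarith
      rw [sub_self, abs_zero]
      linarith

section Leaf

variable (g : SmoothRiemannianMetric 3 (Heisenberg ⧸ lattice 0))

theorem coordCurve_of_eq {p q s : ℝ → ℝ} {t X Y Z : ℝ} (a : Heisenberg) (hp : p t = X)
    (hq : q t = Y) (hs : s t = Z) : coordCurve p q s a t = mk X Y Z * a := by
  rw [coordCurve, hp, hq, hs]
  rfl

theorem mk_zero : mk 0 0 0 = 1 := rfl

/-- The leafwise distance is comparable to a right-invariant distance of the Heisenberg group:
a ball is comparable to a box. -/
theorem exists_leafEDist_bounds : ∃ C : ℝ, 0 < C ∧ ∀ (x : tower.Solenoid) (b : Heisenberg),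
    level 0 x = QuotientGroup.mk b → ∀ a : Heisenberg,
      (∀ y d, 0 ≤ d → tower.leafEDist g (leafParam x b a) y ≤ ENNReal.ofReal d →
        ∃ w : Heisenberg, y = leafParam x b (w * a) ∧ |w.coord 0| ≤ C * d ∧
          |w.coord 1| ≤ C * d ∧ |w.coord 2| ≤ C * d + (C * d) ^ 2) ∧
      (∀ X Y Z : ℝ, tower.leafEDist g (leafParam x b a) (leafParam x b (mk X Y Z * a)) ≤
        ENNReal.ofReal (C * (|X| + |Y| + |Z| + |X| * |Y|))) ∧
      (∀ X Y Z r : ℝ, 0 < r → |X| ≤ r → |Y| ≤ r → |Z| ≤ r ^ 2 →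
        tower.leafEDist g (leafParam x b a) (leafParam x b (mk X Y Z * a)) ≤
          ENNReal.ofReal (C * (83 * r))) := by
  obtain ⟨C, hC, hlen⟩ := exists_length_bounds g
  refine ⟨C, hC, fun x b hb a => ⟨fun y d hd h => ?_, ?_, ?_⟩⟩
  -- The infimum of lengths need not be attained, so curves exist only for `l > C * d`. Their lifted
  -- endpoint does not depend on `l`, as `leafParam` is injective, and the bounds pass to the limit.
  · have key : ∀ l, C * d < l → ∃ φ : ℝ → EuclideanSpace ℝ (Fin 3), ContDiffOn ℝ 1 φ (Icc 0 1) ∧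
        φ 0 = a ∧ leafParam x b (φ 1) = y ∧ refLength φ ≤ ENNReal.ofReal l := fun l hl => by
      have h1 : tower.leafEDist g (leafParam x b a) y < ENNReal.ofReal (l / C) := by
        have h2 : d < l / C := by
          rw [lt_div_iff₀ hC]
          linarith
        exact h.trans_lt ((ENNReal.ofReal_lt_ofReal_iff (hd.trans_lt h2)).mpr h2)
      obtain ⟨φ, h2, h3, h4, h5⟩ := exists_curve_of_leafEDist_lt g hb h1
      refine ⟨φ, h2, h3, h4, (hlen φ h2).2.trans ?_⟩
      calc _ ≤ ENNReal.ofReal C * ENNReal.ofReal (l / C) := by gcongr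
        _ = ENNReal.ofReal l := by rw [← ENNReal.ofReal_mul hC.le, mul_div_cancel₀ _ hC.ne']
    obtain ⟨φ₀, -, -, hy, -⟩ := key (C * d + 1) (by linarith)
    let w : Heisenberg := (show Heisenberg from φ₀ 1) * a⁻¹
    have hw : leafParam x b (w * a) = y := by
      rw [← hy, inv_mul_cancel_right]
    have bound : ∀ l, C * d < l → |w.coord 0| ≤ l ∧ |w.coord 1| ≤ l ∧ |w.coord 2| ≤ l + l ^ 2 :=
        fun l hl => by
      obtain ⟨φ, h1, h2, h3, h4⟩ := key l hl
      have h5 : (show Heisenberg from φ 1) = w * a := leafParam_injective (h3.trans hw.symm)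
      have h6 := displacement_le_of_refLength_le h1 ((mul_nonneg hC.le hd).trans hl.le) h4
      rw [h2] at h6
      have e0 : φ 1 0 = w.coord 0 + a.coord 0 := congrArg (fun u => u.coord 0) h5
      have e1 : φ 1 1 = w.coord 1 + a.coord 1 := congrArg (fun u => u.coord 1) h5
      have e2 : φ 1 2 = w.coord 2 + a.coord 2 + w.coord 0 * a.coord 1 :=
        congrArg (fun u => u.coord 2) h5
      rw [e0, e1, e2] at h6
      change |w.coord 0 + a.coord 0 - a.coord 0| ≤ l ∧ |w.coord 1 + a.coord 1 - a.coord 1| ≤ l ∧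
        |w.coord 2 + a.coord 2 + w.coord 0 * a.coord 1 - a.coord 2 -
          a.coord 1 * (w.coord 0 + a.coord 0 - a.coord 0)| ≤ l + l ^ 2 at h6
      refine ⟨by simpa using h6.1, by simpa using h6.2.1, ?_⟩
      convert! h6.2.2 using 2
      ring
    refine ⟨w, hw.symm, le_of_forall_gt_imp_ge_of_dense fun l hl => (bound l hl).1,
      le_of_forall_gt_imp_ge_of_dense fun l hl => (bound l hl).2.1, ?_⟩
    have hcont : Continuous fun l : ℝ => l + l ^ 2 := by fun_prop
    refine ge_of_tendsto ((hcont.tendsto (C * d)).mono_left (nhdsWithin_le_nhds (s := Ioi (C * d)))) ?_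
    filter_upwards [self_mem_nhdsWithin] with l hl using (bound l hl).2.2
  · intro X Y Z
    have h1 := leafEDist_le_length g hb (φ := coordCurve (fun t => t * X) (fun t => t * Y)
      (fun t => t * Z) a) (contDiff_coordCurve (by fun_prop) (by fun_prop) (by fun_prop) a)
    rw [coordCurve_of_eq (p := fun t => t * X) (q := fun t => t * Y) (s := fun t => t * Z) a
      (zero_mul X) (zero_mul Y) (zero_mul Z), coordCurve_of_eq (p := fun t => t * X)
      (q := fun t => t * Y) (s := fun t => t * Z) a (one_mul X) (one_mul Y) (one_mul Z), mk_zero,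
      one_mul] at h1
    refine h1.trans ((hlen _ (contDiff_coordCurve (by fun_prop) (by fun_prop) (by fun_prop)
      a |>.of_le (by simp)).contDiffOn).1.trans ?_)
    rw [ENNReal.ofReal_mul hC.le]
    gcongr
    exact refLength_line_le X Y Z a
  · intro X Y Z r hr hX hY hZ
    obtain ⟨p, q, s, hp, hq, hs, p0, q0, s0, p1, q1, s1, hL⟩ :=
      refLength_horizontal_le hr hX hY hZ a
    have h1 := leafEDist_le_length g hb (contDiff_coordCurve hp hq hs a)
    rw [coordCurve_of_eq a p0 q0 s0, coordCurve_of_eq a p1 q1 s1, mk_zero, one_mul] at h1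
    refine h1.trans ((hlen _ (contDiff_coordCurve hp hq hs a |>.of_le (by simp)).contDiffOn).1.trans
      ?_)
    rw [ENNReal.ofReal_mul hC.le]
    gcongr

end Leaf

end Heisenberg

/-! ### Volume of leafwise balls -/

/-- An upper bound of the Hausdorff volume by finite covers. -/
theorem hausdorffVolume_le {X : Type*} {ρ : X → X → ℝ≥0∞} {k : ℕ} {A : Set X}
    {M : ℝ≥0∞}
    (h : ∀ δ : ℝ≥0∞, 0 < δ → ∃ (m : ℕ) (t : Fin m → Set X) (d : ℝ≥0∞), A ⊆ ⋃ i, t i ∧ d ≤ δ ∧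
      (∀ i, ∀ x ∈ t i, ∀ y ∈ t i, ρ x y ≤ d) ∧ m * d ^ k ≤ M) :
    hausdorffVolume ρ k A ≤ M := by
  refine iSup₂_le fun δ hδ => ?_
  obtain ⟨m, t, d, hA, hd, ht, hM⟩ := h δ hδ
  let t' : ℕ → Set X := fun n => if hn : n < m then t ⟨n, hn⟩ else ∅
  have ht' : ∀ n, ∀ x ∈ t' n, ∀ y ∈ t' n, ρ x y ≤ d := fun n x hx y hy => by
    by_cases hn : n < m
    · simp only [t', hn, dif_pos] at hx hy
      exact ht _ x hx y hy
    · simp [t', hn] at hx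
  refine iInf_le_of_le t' (iInf_le_of_le (fun x hx => ?_) (iInf_le_of_le
    (fun n x hx y hy => (ht' n x hx y hy).trans hd) ?_))
  · obtain ⟨i, hi⟩ := mem_iUnion.mp (hA hx)
    exact mem_iUnion.mpr ⟨i, by simpa [t'] using hi⟩
  · rw [tsum_eq_sum (s := Finset.range m) fun n hn => ?_]
    · refine (Finset.sum_le_card_nsmul _ _ (d ^ k) fun n _ => ?_).trans (by simpa using hM)
      refine iSup_le fun _ => ?_
      gcongr
      exact iSup₂_le fun x hx => iSup₂_le fun y hy => ht' n x hx y hy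
    · have : ¬ n < m := by simpa using hn
      simp [t', this]

namespace Heisenberg

/-- A box of the Heisenberg space. -/
def box (A B D : ℝ) : Set (EuclideanSpace ℝ (Fin 3)) := {w | |w 0| ≤ A ∧ |w 1| ≤ B ∧ |w 2| ≤ D}

theorem volume_box (A B D : ℝ) : volume (box A B D) =
    ENNReal.ofReal (2 * A) * ENNReal.ofReal (2 * B) * ENNReal.ofReal (2 * D) := by
  have h1 : box A B D = (MeasurableEquiv.toLp 2 (Fin 3 → ℝ)).symm ⁻¹'
      Icc (fun i => -![A, B, D] i) ![A, B, D] := by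
    ext w
    simp only [box, mem_ofPred_eq, mem_preimage, mem_Icc, Pi.le_def, Fin.forall_fin_succ, abs_le]
    simp
    tauto
  rw [h1, (PiLp.volume_preserving_ofLp (Fin 3)).measure_preimage_equiv, Real.volume_Icc_pi,
    Fin.prod_univ_three]
  simp [two_mul]

theorem det_shear (s : ℝ) : LinearMap.det (shear s : EuclideanSpace ℝ (Fin 3) →ₗ[ℝ] _) = 1 := by
  have h : (shear s : EuclideanSpace ℝ (Fin 3) →ₗ[ℝ] _) = LinearMap.transvection
      (EuclideanSpace.proj (𝕜 := ℝ) (0 : Fin 3)).toLinearMap (s • EuclideanSpace.single 2 1) := by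
    ext v i
    simp [shear, LinearMap.transvection.apply]
    ring_nf
  rw [h, LinearMap.transvection.det]
  simp

/-- Right translations preserve the volume. -/
theorem volume_image_mulRight (b : Heisenberg) (s : Set (EuclideanSpace ℝ (Fin 3))) :
    volume (mulRight b '' s) = volume s := by
  have h : mulRight b '' s = (fun a : EuclideanSpace ℝ (Fin 3) => a + (show EuclideanSpace ℝ (Fin 3) from b)) '' (shear (b.coord 1) '' s) := by
    rw [image_image, mulRight_eq]
  rw [h, image_add_right, measure_preimage_add_right, Measure.addHaar_image_continuousLinearMap,
    det_shear]
  simp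

section Leaf

variable (g : SmoothRiemannianMetric 3 (Heisenberg ⧸ lattice 0))

/-- The lower bound of the volume of the leafwise balls. -/
theorem exists_le_leafGrowth : ∃ K B : ℝ, 0 < K ∧ 0 < B ∧ ∀ (x : tower.Solenoid) (r : ℝ), 0 < r →
    ENNReal.ofReal (r ^ 4) ≤ ENNReal.ofReal K * tower.leafGrowth g x (B * r) := by
  obtain ⟨C, hC, hbound⟩ := exists_leafEDist_bounds g
  refine ⟨C * C * (C + C ^ 2), C * 83, by positivity, by positivity, fun x r hr => ?_⟩
  obtain ⟨b, hb⟩ := QuotientGroup.mk_surjective (level 0 x)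
  have hbd := hbound x b hb.symm
  set S : Set tower.Solenoid := {y | tower.leafEDist g x y ≤ ENNReal.ofReal (C * 83 * r)} with hS
  set P : EuclideanSpace ℝ (Fin 3) → tower.Solenoid := leafParam x b with hP
  have hPb : P b = x := leafParam_self
  have hbox : mulRight b '' box r r (r ^ 2) ⊆ P ⁻¹' S := by
    rintro _ ⟨w, ⟨h0, h1, h2⟩, rfl⟩
    have h3 := (hbd b).2.2 (w 0) (w 1) (w 2) r hr h0 h1 h2
    rw [hPb] at h3
    have h4 : mk (w 0) (w 1) (w 2) = w := mk_coord w
    rw [h4, ← mul_assoc] at h3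
    exact h3
  have hvol : ENNReal.ofReal (8 * r ^ 4) ≤ volume (P ⁻¹' S) := by
    refine le_of_eq_of_le ?_ (measure_mono hbox)
    rw [volume_image_mulRight, volume_box, ← ENNReal.ofReal_mul (by positivity),
      ← ENNReal.ofReal_mul (by positivity)]
    congr 1
    ring
  -- Mass distribution: a set of diameter `d ≤ 1` lies in a right-translated box of volume of order
  -- `d ^ 3`, because `d ^ 2 ≤ d`. Covers at the scale `δ = 1` thus already bound the Hausdorff
  -- volume from below.
  have key : ∀ t : Set tower.Solenoid,
      (∀ y ∈ t, ∀ z ∈ t, tower.leafEDist g y z ≤ 1) → volume (P ⁻¹' t) ≤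
        ENNReal.ofReal (8 * (C * C * (C + C ^ 2))) *
          ⨆ _ : t.Nonempty, (⨆ y ∈ t, ⨆ z ∈ t, tower.leafEDist g y z) ^ 3 := by
    intro t ht
    rcases (P ⁻¹' t).eq_empty_or_nonempty with he | ⟨a, ha⟩
    · simp [he]
    · have hne : t.Nonempty := ⟨_, ha⟩
      rw [iSup_pos hne]
      set D := ⨆ y ∈ t, ⨆ z ∈ t, tower.leafEDist g y z with hD
      have hD1 : D ≤ 1 := iSup₂_le fun y hy => iSup₂_le fun z hz => ht y hy z hz
      have hDtop : D ≠ ⊤ := (hD1.trans_lt ENNReal.one_lt_top).ne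
      obtain ⟨d, hd0, hd⟩ : ∃ d : ℝ, 0 ≤ d ∧ D = ENNReal.ofReal d :=
        ⟨D.toReal, ENNReal.toReal_nonneg, (ENNReal.ofReal_toReal hDtop).symm⟩
      have hd1 : d ≤ 1 := by
        rw [hd, ← ENNReal.ofReal_one] at hD1
        exact (ENNReal.ofReal_le_ofReal_iff zero_le_one).mp hD1
      have hsub : P ⁻¹' t ⊆ mulRight a '' box (C * d) (C * d) ((C + C ^ 2) * d) := by
        intro a' ha'
        have h1 : tower.leafEDist g (P a) (P a') ≤ ENNReal.ofReal d := by
          rw [← hd]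
          exact le_iSup₂_of_le (P a) ha (le_iSup₂_of_le (P a') ha' le_rfl)
        obtain ⟨w, hw, h2, h3, h4⟩ := (hbd a).1 _ d hd0 h1
        refine ⟨w, ⟨h2, h3, h4.trans ?_⟩, (leafParam_injective hw).symm⟩
        have : d ^ 2 ≤ d := by nlinarith
        nlinarith [sq_nonneg C]
      refine (measure_mono hsub).trans (le_of_eq ((volume_image_mulRight a _).trans ?_))
      rw [volume_box, hd, ← ENNReal.ofReal_pow hd0,
        ← ENNReal.ofReal_mul (by positivity), ← ENNReal.ofReal_mul (by positivity),
        ← ENNReal.ofReal_mul (by positivity)]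
      congr 1
      ring
  have hH : volume (P ⁻¹' S) ≤ ENNReal.ofReal (8 * (C * C * (C + C ^ 2))) *
      tower.leafGrowth g x (C * 83 * r) := by
    have hK0 : ENNReal.ofReal (8 * (C * C * (C + C ^ 2))) ≠ 0 := by
      rw [ne_eq, ENNReal.ofReal_eq_zero, not_le]
      positivity
    refine ((ENNReal.div_le_iff_le_mul (Or.inl hK0) (Or.inl ENNReal.ofReal_ne_top)).1 ?_).trans_eq
      (mul_comm _ _)
    refine le_iSup₂_of_le 1 zero_lt_one (le_iInf fun t => le_iInf fun hcov => le_iInf fun ht => ?_)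
    rw [ENNReal.div_le_iff_le_mul (Or.inl hK0) (Or.inl ENNReal.ofReal_ne_top), mul_comm,
      ← ENNReal.tsum_mul_left]
    calc volume (P ⁻¹' S) ≤ volume (⋃ i, P ⁻¹' t i) := by
          rw [← preimage_iUnion]
          exact measure_mono (preimage_mono hcov)
      _ ≤ ∑' i, volume (P ⁻¹' t i) := measure_iUnion_le _
      _ ≤ _ := ENNReal.tsum_le_tsum fun i => key (t i) (ht i)
  have h8 := hvol.trans hH
  rw [ENNReal.ofReal_mul (by norm_num), ENNReal.ofReal_mul (p := 8) (by norm_num), mul_assoc] at h8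
  exact (ENNReal.mul_le_mul_iff_right (by simp) ENNReal.ofReal_ne_top).mp h8

/-- A box is covered by right translates of a small cube. -/
theorem exists_cube_mul {N T : ℕ} (hN : 0 < N) {w : Heisenberg} (h0 : |w.coord 0| ≤ T)
    (h1 : |w.coord 1| ≤ T) (h2 : |w.coord 2| ≤ T + T ^ 2) (hT : 1 ≤ T) :
    ∃ i ∈ Finset.Icc (-(N * T * 2 : ℤ)) (N * T * 2), ∃ j ∈ Finset.Icc (-(N * T * 2 : ℤ)) (N * T * 2),
      ∃ k ∈ Finset.Icc (-(N * T ^ 2 * 5 : ℤ)) (N * T ^ 2 * 5), ∃ q : Heisenberg,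
        (∀ m, q.coord m ∈ Icc 0 (1 / N : ℝ)) ∧ w = q * mk (i / N) (j / N) (k / N) := by
  have hN' : (0 : ℝ) < N := by exact_mod_cast hN
  have hN1 : (1 : ℝ) ≤ N := by exact_mod_cast hN
  have hT1 : (1 : ℝ) ≤ T := by exact_mod_cast hT
  have hNT : (1 : ℝ) ≤ N * T := by nlinarith
  have hNTT : (N * T : ℝ) ≤ N * T ^ 2 := by
    have : (T : ℝ) ≤ T ^ 2 := by nlinarith
    gcongr
  have hfl : ∀ u : ℝ, u - ⌊N * u⌋ / N ∈ Icc 0 (1 / N : ℝ) := fun u => by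
    have e1 := Int.floor_le (N * u)
    have e2 := Int.lt_floor_add_one (N * u)
    constructor
    · rw [sub_nonneg, div_le_iff₀ hN']
      linarith
    · rw [sub_le_iff_le_add, ← add_div, le_div_iff₀ hN']
      linarith
  have habs : ∀ u s : ℝ, |u| ≤ s → |(⌊N * u⌋ : ℝ)| ≤ N * s + 1 := fun u s hu => by
    have e1 := Int.floor_le (N * u)
    have e2 := Int.lt_floor_add_one (N * u)
    have e3 := abs_le.mp hu
    rw [abs_le]
    constructor <;> nlinarith
  have hmem : ∀ (i : ℤ) (m : ℤ), |(i : ℝ)| ≤ m → i ∈ Finset.Icc (-m) m := fun i m h => by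
    rw [Finset.mem_Icc, ← abs_le]
    exact_mod_cast h
  set i := ⌊N * w.coord 0⌋
  set j := ⌊N * w.coord 1⌋
  set qx := w.coord 0 - i / N with hqx
  -- The cross term of the product is removed before rounding the third coordinate. Then `|u| ≤ 3 T
  -- + T ^ 2 ≤ 4 T ^ 2`, and rounding accounts for the fifth `N * T ^ 2`.
  set u := w.coord 2 - qx * (j / N) with hu
  have hi : |(i : ℝ)| ≤ N * T * 2 := (habs _ _ h0).trans (by nlinarith)
  have hj : |(j : ℝ)| ≤ N * T * 2 := (habs _ _ h1).trans (by nlinarith)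
  have hqx' := hfl (w.coord 0)
  have hqj : |qx * (j / N)| ≤ 2 * T := by
    rw [abs_mul, abs_div, abs_of_pos hN', abs_of_nonneg hqx'.1]
    calc qx * (|(j : ℝ)| / N) ≤ 1 * (N * T * 2 / N) := by
          gcongr
          exact hqx'.2.trans (by rw [div_le_one hN']; exact hN1)
      _ = 2 * T := by field_simp
  have hk : |(⌊N * u⌋ : ℝ)| ≤ N * T ^ 2 * 5 := by
    have e1 : |u| ≤ T + T ^ 2 + 2 * T := (abs_sub _ _).trans (by linarith)
    refine (habs _ _ e1).trans ?_
    nlinarith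
  refine ⟨i, hmem _ _ (by push_cast; exact hi), j, hmem _ _ (by push_cast; exact hj), ⌊N * u⌋,
    hmem _ _ (by push_cast; exact hk), mk qx (w.coord 1 - j / N) (u - ⌊N * u⌋ / N), fun m => ?_, ?_⟩
  · fin_cases m
    · exact hqx'
    · exact hfl (w.coord 1)
    · exact hfl u
  · refine ext_coord ?_ ?_ ?_ <;> simp [hqx, hu]

/-- The upper bound of the volume of the leafwise balls. -/
theorem exists_leafGrowth_le : ∃ K C : ℝ, 0 < K ∧ 0 < C ∧ ∀ (x : tower.Solenoid) (R : ℝ), 0 ≤ R →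
    tower.leafGrowth g x R ≤ ENNReal.ofReal (K * (2 + C * R) ^ 4) := by
  obtain ⟨C, hC, hbound⟩ := exists_leafEDist_bounds g
  refine ⟨5 * 5 * 11 * (5 * C) ^ 3, C, by positivity, hC, fun x R hR => ?_⟩
  obtain ⟨b, hb⟩ := QuotientGroup.mk_surjective (level 0 x)
  have hbd := hbound x b hb.symm
  set T := ⌈C * R⌉₊ + 1 with hT
  have hT1 : 1 ≤ T := by omega
  have hCT : C * R ≤ T := (Nat.le_ceil _).trans (by rw [hT]; push_cast; linarith)
  have hTC : (T : ℝ) ≤ 2 + C * R := by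
    have := Nat.ceil_lt_add_one (mul_nonneg hC.le hR)
    rw [hT]
    push_cast
    linarith
  refine hausdorffVolume_le fun δ hδ => ?_
  obtain ⟨N, hN, hNδ⟩ : ∃ N : ℕ, 0 < N ∧ ENNReal.ofReal (5 * C / N) ≤ δ := by
    obtain ⟨ε, hε, hεδ⟩ : ∃ ε : ℝ, 0 < ε ∧ ENNReal.ofReal ε ≤ δ := by
      rcases eq_or_ne δ ⊤ with rfl | h
      · exact ⟨1, one_pos, le_top⟩
      · exact ⟨δ.toReal, ENNReal.toReal_pos hδ.ne' h, ENNReal.ofReal_toReal_le⟩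
    obtain ⟨N, hN⟩ := exists_nat_gt (5 * C / ε)
    have h1 : (0 : ℝ) < N := lt_trans (by positivity) hN
    refine ⟨N, by exact_mod_cast h1, (ENNReal.ofReal_le_ofReal ?_).trans hεδ⟩
    rw [div_lt_iff₀ hε] at hN
    rw [div_le_iff₀ h1]
    linarith
  have hN' : (0 : ℝ) < N := by exact_mod_cast hN
  have hN1 : (1 : ℝ) ≤ N := by exact_mod_cast hN
  -- The order of `N ^ 3 * T ^ 4` right translates of a cube of side `1 / N` cover the ball. Right
  -- translation keeps the diameter bound `5 * C / N`, where `5 = 1 + 1 + 2 + 1` comes from `|X| +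
  -- |Y| + |Z| + |X| |Y|`. The resulting sum does not depend on `N`.
  let s : Finset (ℤ × ℤ × ℤ) := Finset.Icc (-(N * T * 2 : ℤ)) (N * T * 2) ×ˢ
    Finset.Icc (-(N * T * 2 : ℤ)) (N * T * 2) ×ˢ Finset.Icc (-(N * T ^ 2 * 5 : ℤ)) (N * T ^ 2 * 5)
  let c : ℤ × ℤ × ℤ → Set tower.Solenoid := fun n => {y | ∃ q : Heisenberg,
    (∀ m, q.coord m ∈ Icc 0 (1 / N : ℝ)) ∧
      y = leafParam x b (q * (mk (n.1 / N) (n.2.1 / N) (n.2.2 / N) * b))}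
  refine ⟨s.card, fun i => c (s.equivFin.symm i), ENNReal.ofReal (5 * C / N), ?_, hNδ, ?_, ?_⟩
  · intro y hy
    have hy : tower.leafEDist g x y ≤ ENNReal.ofReal R := hy
    rw [← leafParam_self (x := x) (b := b)] at hy
    obtain ⟨w, hw, h0, h1, h2⟩ := (hbd b).1 _ R hR hy
    have hCR : 0 ≤ C * R := by positivity
    obtain ⟨i, hi, j, hj, k, hk, q, hq, hwq⟩ := exists_cube_mul hN (h0.trans hCT) (h1.trans hCT)
      (h2.trans (by gcongr)) hT1
    have hs : (i, j, k) ∈ s := by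
      simp only [s, Finset.mem_product]
      exact ⟨hi, hj, hk⟩
    refine mem_iUnion.mpr ⟨s.equivFin ⟨_, hs⟩, ?_⟩
    rw [Equiv.symm_apply_apply]
    refine ⟨q, hq, ?_⟩
    rw [hw, hwq, mul_assoc]
  · rintro n _ ⟨q, hq, rfl⟩ _ ⟨q', hq', rfl⟩
    generalize mk _ _ _ * b = u
    have h1 := (hbd (q * u)).2.1 ((q' * q⁻¹).coord 0) ((q' * q⁻¹).coord 1) ((q' * q⁻¹).coord 2)
    rw [mk_coord, ← mul_assoc, inv_mul_cancel_right] at h1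
    refine h1.trans (ENNReal.ofReal_le_ofReal ?_)
    set ε := (1 / N : ℝ) with hε
    have hε0 : 0 < ε := by positivity
    have hε1 : ε ≤ 1 := by
      rw [hε, div_le_one hN']
      exact hN1
    have e0 : |(q' * q⁻¹).coord 0| ≤ ε := by
      rw [coord_mul_zero, coord_inv_zero, abs_le]
      constructor <;> linarith [(hq 0).1, (hq 0).2, (hq' 0).1, (hq' 0).2]
    have e1 : |(q' * q⁻¹).coord 1| ≤ ε := by
      rw [coord_mul_one, coord_inv_one, abs_le]
      constructor <;> linarith [(hq 1).1, (hq 1).2, (hq' 1).1, (hq' 1).2]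
    have e2 : |(q' * q⁻¹).coord 2| ≤ 2 * ε := by
      have e3 : (q' * q⁻¹).coord 2 =
          (q'.coord 2 - q.coord 2) - (q' * q⁻¹).coord 0 * q.coord 1 := by
        simp
        ring
      have e4 : |q'.coord 2 - q.coord 2| ≤ ε := by
        rw [abs_le]
        constructor <;> linarith [(hq 2).1, (hq 2).2, (hq' 2).1, (hq' 2).2]
      have e5 : |(q' * q⁻¹).coord 0 * q.coord 1| ≤ ε := by
        rw [abs_mul, abs_of_nonneg (hq 1).1]
        exact (mul_le_mul e0 ((hq 1).2.trans hε1) (hq 1).1 hε0.le).trans_eq (mul_one ε)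
      rw [e3]
      exact (abs_sub _ _).trans (by linarith)
    have e6 : |(q' * q⁻¹).coord 0| * |(q' * q⁻¹).coord 1| ≤ ε :=
      (mul_le_mul e0 (e1.trans hε1) (abs_nonneg _) hε0.le).trans_eq (mul_one ε)
    have e7 : 5 * C / N = C * (5 * ε) := by
      rw [hε]
      ring
    rw [e7]
    gcongr
    linarith
  · have hcard : (s.card : ℝ) ≤ 5 * 5 * 11 * (N * T) ^ 2 * (N * T ^ 2) := by
      have hz : ∀ m : ℕ, ((Finset.Icc (-(m : ℤ)) m).card : ℝ) = 2 * m + 1 := fun m => by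
        rw [Int.card_Icc]
        have : ((m : ℤ) + 1 - -(m : ℤ)).toNat = 2 * m + 1 := by omega
        rw [this]
        push_cast
        ring
      have hz1 := hz (N * T * 2)
      have hz2 := hz (N * T ^ 2 * 5)
      push_cast at hz1 hz2
      have hT1' : (1 : ℝ) ≤ T := by exact_mod_cast hT1
      have hNT : (1 : ℝ) ≤ N * T := by nlinarith
      have hNTT : (1 : ℝ) ≤ N * T ^ 2 := by nlinarith
      rw [Finset.card_product, Finset.card_product]
      push_cast
      rw [hz1, hz2]
      calc (2 * (N * T * 2 : ℝ) + 1) * ((2 * (N * T * 2) + 1) * (2 * (N * T ^ 2 * 5) + 1))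
          ≤ (5 * (N * T)) * ((5 * (N * T)) * (11 * (N * T ^ 2))) := by
            gcongr <;> linarith
        _ = _ := by ring
    rw [← ENNReal.ofReal_pow (by positivity), ← ENNReal.ofReal_natCast,
      ← ENNReal.ofReal_mul (by positivity)]
    refine ENNReal.ofReal_le_ofReal ?_
    calc (s.card : ℝ) * (5 * C / N) ^ 3
        ≤ 5 * 5 * 11 * (N * T) ^ 2 * (N * T ^ 2) * (5 * C / N) ^ 3 := by gcongr
      _ = 5 * 5 * 11 * (5 * C) ^ 3 * T ^ 4 := by field_simp
      _ ≤ _ := by gcongr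

theorem hasExactPolynomialGrowth_leafGrowth (x : tower.Solenoid) :
    HasExactPolynomialGrowth (tower.leafGrowth g x) 4 := by
  constructor
  · obtain ⟨K, C, hK, hC, h⟩ := exists_leafGrowth_le g
    refine ⟨K * 8 * C ^ 4, 1, K * 8 * 16, by positivity, by positivity, by positivity,
      fun r hr => (h x r hr).trans ?_⟩
    rw [one_mul, ← ENNReal.ofReal_mul (by positivity), ← ENNReal.ofReal_add (by positivity)
      (by positivity)]
    refine ENNReal.ofReal_le_ofReal ?_
    have h1 : (2 + C * r) ^ 2 ≤ 2 * (4 + (C * r) ^ 2) := by nlinarith [sq_nonneg (2 - C * r)]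
    have h2 : (2 + C * r) ^ 4 ≤ 8 * (16 + (C * r) ^ 4) := by
      have h3 : ((2 + C * r) ^ 2) ^ 2 ≤ (2 * (4 + (C * r) ^ 2)) ^ 2 := by gcongr
      nlinarith [sq_nonneg (4 - (C * r) ^ 2)]
    calc K * (2 + C * r) ^ 4 ≤ K * (8 * (16 + (C * r) ^ 4)) := by gcongr
      _ = _ := by ring
  · obtain ⟨K, B, hK, hB, h⟩ := exists_le_leafGrowth g
    refine ⟨K, B, 1, hK, hB, one_pos, fun r hr => ?_⟩
    rcases hr.eq_or_lt with rfl | hr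
    · simp
    · exact (h x r hr).trans le_self_add

end Leaf

end Heisenberg

/-! ### Homeomorphisms and stabilizers -/

section Rigidity

variable {G C : Type*} {Y : ℕ → Type*} [Group G] [TopologicalSpace G] [∀ ℓ, MulAction G (Y ℓ)]
  {pr : ∀ ℓ, C → Y ℓ}

/-- A homeomorphism of the limit of a sequence of spaces is uniformly continuous with respect to
the projections. -/
theorem exists_forall_proj_eq [TopologicalSpace C] [CompactSpace C]
    [∀ ℓ, TopologicalSpace (Y ℓ)] [∀ ℓ, T2Space (Y ℓ)]
    (hpr : ∀ ℓ, Continuous (pr ℓ))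
    (hanti : ∀ k ℓ, k ≤ ℓ → ∀ z w, pr ℓ z = pr ℓ w → pr k z = pr k w)
    (hinj : ∀ z w, (∀ ℓ, pr ℓ z = pr ℓ w) → z = w)
    (hnhds : ∀ k, ∀ V ∈ 𝓝 (1 : G), ∀ z : C, ∀ᶠ p in 𝓝 (z, z), ∃ s ∈ V, s • pr k p.1 = pr k p.2)
    {h : C → C} (hh : Continuous h) (k : ℕ) {V : Set G} (hV : V ∈ 𝓝 1) :
    ∃ ℓ, ∀ z w, pr ℓ z = pr ℓ w → ∃ s ∈ V, s • pr k (h z) = pr k (h w) := by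
  have hcl : ∀ ℓ, IsClosed {p : C × C | pr ℓ p.1 = pr ℓ p.2} := fun ℓ =>
    isClosed_eq ((hpr ℓ).comp continuous_fst) ((hpr ℓ).comp continuous_snd)
  have hdir : Directed (· ⊇ ·) fun ℓ => {p : C × C | pr ℓ p.1 = pr ℓ p.2} :=
    Antitone.directed_ge fun k ℓ hkl p hp => hanti k ℓ hkl _ _ hp
  -- The closed relations "equal at level `ℓ`" decrease to the diagonal, so by compactness one of
  -- them lies in the given neighbourhood of it.
  obtain ⟨ℓ, hℓ⟩ := exists_subset_nhds_of_isCompact' hdir (fun ℓ => (hcl ℓ).isCompact) hcl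
    (U := {p | ∃ s ∈ V, s • pr k (h p.1) = pr k (h p.2)}) (by
      rintro ⟨z, w⟩ hzw
      obtain rfl : z = w := hinj z w (mem_iInter.mp hzw)
      have h1 : Filter.Tendsto (Prod.map h h) (𝓝 (z, z)) (𝓝 (h z, h z)) :=
        (hh.prodMap hh).continuousAt
      exact h1.eventually (hnhds k V hV (h z)))
  exact ⟨ℓ, fun z w hzw => hℓ (show (z, w) ∈ _ from hzw)⟩

variable [IsTopologicalGroup G] [PreconnectedSpace G] [MulAction G C]

/-- The holonomy homomorphism which a map induces between the stabilizers of nearby points. -/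
theorem exists_smul_eq_forall_mem
    (hsmul : ∀ (ℓ : ℕ) (a : G) (z : C), pr ℓ (a • z) = a • pr ℓ z) {k ℓ : ℕ} {V V₀ : Set G} (hVo : IsOpen V)
    (hVV : ∀ a ∈ V, ∀ b ∈ V, a⁻¹ * b ∈ V₀)
    (hfree : ∀ s ∈ V₀, ∀ u : C, s • pr k u = pr k u → s = 1)
    {h : C → C} {z : C} {φ : G → G} (hφ : Continuous φ) (hφz : ∀ a, h (a • z) = φ a • h z)
    (hℓ : ∀ z w, pr ℓ z = pr ℓ w → ∃ s ∈ V, s • pr k (h z) = pr k (h w)) {β : G}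
    (hβ : β • pr ℓ z = pr ℓ z) :
    ∃ δ : G, δ • pr k (h z) = pr k (h z) ∧ ∀ b, φ (b * β) * δ⁻¹ * (φ b)⁻¹ ∈ V := by
  -- As `β` fixes `pr ℓ z`, the points `(b * β) • z` and `b • z` agree at level `ℓ`, and their
  -- images differ at level `k` by an element of `V`. This puts each `b` in some `B γ`; freeness
  -- makes these open sets disjoint, and connectedness gives one `γ` for all `b`.
  let B : {γ : G // γ • pr k (h z) = pr k (h z)} → Set G :=
    fun γ => {b | φ (b * β) * γ.1⁻¹ * (φ b)⁻¹ ∈ V}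
  have hc : ∀ b, ∃ γ, b ∈ B γ := by
    intro b
    obtain ⟨s, hs, hsb⟩ := hℓ (b • z) ((b * β) • z) (by rw [hsmul, hsmul, mul_smul, hβ])
    rw [hφz, hφz, hsmul, hsmul] at hsb
    refine ⟨⟨(φ b)⁻¹ * s⁻¹ * φ (b * β), ?_⟩, ?_⟩
    · rw [mul_smul, mul_smul, ← hsb, inv_smul_smul, inv_smul_smul]
    · change φ (b * β) * ((φ b)⁻¹ * s⁻¹ * φ (b * β))⁻¹ * (φ b)⁻¹ ∈ V
      convert! hs using 1
      group
  obtain ⟨γ, hγ⟩ := hc 1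
  refine ⟨γ.1, γ.2, fun b => ?_⟩
  have hB : B γ = univ := by
    refine eq_univ_of_open_partition (B := B) (fun γ => hVo.preimage (by fun_prop)) ?_ hc ⟨1, hγ⟩
    rintro ⟨γ, hγ⟩ ⟨γ', hγ'⟩ b h1 h2
    have h3 : (φ (b * β) * γ⁻¹ * (φ b)⁻¹)⁻¹ * (φ (b * β) * γ'⁻¹ * (φ b)⁻¹)
        = φ b * (γ * γ'⁻¹) * (φ b)⁻¹ := by group
    have h4 := hfree _ (hVV _ h1 _ h2) (φ b • h z) (by
      rw [h3, hsmul, mul_smul, mul_smul, inv_smul_smul, mul_smul, inv_smul_eq_iff.mpr hγ'.symm, hγ])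
    rw [h3, conj_eq_one_iff, mul_inv_eq_one] at h4
    exact Subtype.ext h4
  exact (hB ▸ mem_univ b : b ∈ B γ)

/-- A homeomorphism of the limit of a sequence of spaces which maps orbits to orbits relates the
stabilizers of a point and of its image. -/
theorem exists_ne_one_of_homeomorph [TopologicalSpace C] [CompactSpace C]
    [∀ ℓ, TopologicalSpace (Y ℓ)] [∀ ℓ, T2Space (Y ℓ)]
    [WeaklyLocallyCompactSpace G]
    (hpr : ∀ ℓ, Continuous (pr ℓ)) (hsmul : ∀ (ℓ : ℕ) (a : G) (z : C), pr ℓ (a • z) = a • pr ℓ z)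
    (hanti : ∀ k ℓ, k ≤ ℓ → ∀ z w, pr ℓ z = pr ℓ w → pr k z = pr k w)
    (hinj : ∀ z w, (∀ ℓ, pr ℓ z = pr ℓ w) → z = w)
    (hnhds : ∀ k, ∀ V ∈ 𝓝 (1 : G), ∀ z : C, ∀ᶠ p in 𝓝 (z, z), ∃ s ∈ V, s • pr k p.1 = pr k p.2)
    {V₀ : Set G} (hV₀ : V₀ ∈ 𝓝 1) (hfree₀ : ∀ s ∈ V₀, ∀ u : C, s • pr 0 u = pr 0 u → s = 1)
    (hfree : ∀ (a : G) (z : C), a • z = z → a = 1)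
    (hlift : ∀ (h : C ≃ₜ C) (z : C), ∃ φ : G → G, Continuous φ ∧ φ 1 = 1 ∧
      ∀ a, h (a • z) = φ a • h z) (h : C ≃ₜ C) (z : C) :
    ∃ ℓ₀, ∀ β : G, β • pr ℓ₀ z = pr ℓ₀ z → (∀ K : Set G, IsCompact K → ∃ n : ℕ, β ^ n ∉ K) →
      ∃ δ : G, δ ≠ 1 ∧ δ • pr 0 (h z) = pr 0 (h z) ∧
        ∀ k, ∃ ℓ, ∀ n : ℕ, β ^ n • pr ℓ z = pr ℓ z → δ ^ n • pr k (h z) = pr k (h z) := by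
  obtain ⟨φ, hφ, hφ1, hφz⟩ := hlift h z
  obtain ⟨φ', hφ', -, hφz'⟩ := hlift h.symm (h z)
  have hinv : ∀ a, φ' (φ a) = a := fun a => by
    have h1 := hφz' (φ a)
    rw [← hφz, h.symm_apply_apply, h.symm_apply_apply] at h1
    refine (inv_mul_eq_one.mp (hfree _ z ?_)).symm
    rw [mul_smul, ← h1, inv_smul_smul]
  have hfreek : ∀ k, ∀ s ∈ V₀, ∀ u : C, s • pr k u = pr k u → s = 1 := fun k s hs u hu =>
    hfree₀ s hs u (by
      rw [← hsmul] at hu ⊢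
      exact hanti 0 k k.zero_le _ _ hu)
  obtain ⟨K, hK, hK1⟩ := exists_compact_mem_nhds (1 : G)
  obtain ⟨W, hW, hWW⟩ := exists_nhds_one_split hV₀
  have h1 : ∀ᶠ p : G × G in 𝓝 (1, 1), p.1⁻¹ * p.2 ∈ W := by
    refine ContinuousAt.eventually_mem (by fun_prop) ?_
    simpa using hW
  rw [nhds_prod_eq] at h1
  obtain ⟨V₁, hV₁, h1⟩ := Filter.eventually_prod_self_iff'.mp h1
  obtain ⟨V, hV, hVo, h1V⟩ := mem_nhds_iff.mp (Filter.inter_mem hV₁ (Filter.inter_mem hW hK1))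
  have hV3 : ∀ a ∈ V, ∀ b ∈ V, ∀ c ∈ V, a⁻¹ * b * c ∈ V₀ := fun a ha b hb c hc =>
    hWW _ (h1 a (hV ha).1 b (hV hb).1) _ (hV hc).2.1
  have hV2 : ∀ a ∈ V, ∀ b ∈ V, a⁻¹ * b ∈ V₀ := fun a ha b hb => by
    simpa using hV3 a ha b hb 1 h1V
  have hU := fun k => exists_forall_proj_eq hpr hanti hinj hnhds h.continuous k (hVo.mem_nhds h1V)
  obtain ⟨ℓ₀, hℓ₀⟩ := hU 0
  refine ⟨ℓ₀, fun β hβ hβK => ?_⟩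
  have hβn : ∀ n : ℕ, β ^ n • pr ℓ₀ z = pr ℓ₀ z := fun n =>
    pow_mem (show β ∈ MulAction.stabilizer G (pr ℓ₀ z) from hβ) n
  choose δ hδ hδV using fun n =>
    exists_smul_eq_forall_mem hsmul hVo hV2 hfree₀ hφ hφz hℓ₀ (hβn n)
  -- Discreteness: elements of the stabilizer are equal if a conjugate of their quotient lies in
  -- `V₀`.
  have huniq : ∀ s ∈ V₀, ∀ γ γ' : G, γ • pr 0 (h z) = pr 0 (h z) → γ' • pr 0 (h z) = pr 0 (h z) →
      ∀ c, s = c * (γ * γ'⁻¹) * c⁻¹ → γ = γ' := by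
    intro s hs γ γ' hγ hγ' c hc
    have h4 := hfree₀ s hs (c • h z) (by
      rw [hc, hsmul, mul_smul, mul_smul, inv_smul_smul, mul_smul, inv_smul_eq_iff.mpr hγ'.symm, hγ])
    rwa [hc, conj_eq_one_iff, mul_inv_eq_one] at h4
  have hδn : ∀ n : ℕ, δ n = δ 1 ^ n := by
    intro n
    induction n with
    | zero =>
      rw [pow_zero]
      refine huniq _ (hV2 _ (hδV 0 1) _ h1V) _ _ (hδ 0) (one_smul _ _) 1 ?_
      simp [hφ1]
    | succ n ih =>
      -- The three closeness relations, for `β ^ (n + 1)` at `1`, for `β` at `β ^ n` and for `β ^ n`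
      -- at `1`, telescope to `δ (n + 1) * (δ n * δ 1)⁻¹`.
      rw [pow_succ, ← ih]
      refine huniq _ (hV3 _ (hδV (n + 1) 1) _ (hδV 1 (β ^ n)) _ (hδV n 1)) _ _ (hδ (n + 1))
        (by rw [mul_smul, hδ, hδ]) 1 ?_
      simp only [hφ1, one_mul, pow_succ]
      group
  refine ⟨δ 1, fun h1 => ?_, hδ 1, fun k => ?_⟩
  -- If `δ 1 = 1`, every `φ (β ^ n)` stays in `K`, so the powers of `β` stay in the compact set `φ'
  -- '' K`.
  · obtain ⟨n, hn⟩ := hβK (φ' '' K) (hK.image hφ')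
    refine hn ⟨φ (β ^ n), (hV ?_).2.2, hinv _⟩
    have h2 := hδV n 1
    rw [hδn, h1] at h2
    simpa [hφ1] using h2
  · obtain ⟨ℓ, hℓ⟩ := hU k
    refine ⟨ℓ, fun n hn => ?_⟩
    obtain ⟨γ, hγ, hγV⟩ := exists_smul_eq_forall_mem hsmul hVo hV2 (hfreek k) hφ hφz hℓ hn
    -- An element found at level `k` also fixes level `0`, where uniqueness identifies it with `δ 1
    -- ^ n`.
    have h2 : γ • pr 0 (h z) = pr 0 (h z) := by
      rw [← hsmul] at hγ ⊢
      exact hanti 0 k k.zero_le _ _ hγ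
    have h3 : γ = δ 1 ^ n := by
      rw [← hδn]
      refine huniq _ (hV2 _ (hγV 1) _ (hδV n 1)) _ _ h2 (hδ n) 1 ?_
      simp only [hφ1]
      group
    rw [← h3, hγ]

end Rigidity

/-! ### Five-adic integers in a coset -/

section Arithmetic

theorem five_pow_dvd_sub_of_le {i : ℕ → ℤ} (hi : ∀ ℓ, (5 : ℤ) ^ ℓ ∣ i (ℓ + 1) - i ℓ) {k ℓ : ℕ}
    (h : k ≤ ℓ) : (5 : ℤ) ^ k ∣ i ℓ - i k := by
  induction ℓ, h using Nat.le_induction with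
  | base => simp
  | succ ℓ hkℓ ih => simpa using ((pow_dvd_pow (5 : ℤ) hkℓ).trans (hi ℓ)).add ih

/-- A five-adic integer, given by its residues, differs from an integer by a multiple of a given
natural number. -/
theorem exists_seq_dvd_add_mul_sub {i : ℕ → ℤ} (hi : ∀ ℓ, (5 : ℤ) ^ ℓ ∣ i (ℓ + 1) - i ℓ) {N : ℕ}
    (hN : N ≠ 0) : ∃ (r : ℤ) (n : ℕ → ℤ), (∀ ℓ, (5 : ℤ) ^ ℓ ∣ n (ℓ + 1) - n ℓ) ∧
      ∀ ℓ, (5 : ℤ) ^ ℓ ∣ i ℓ + N * n ℓ - r := by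
  -- Since `N = 5 ^ v * u` with `u` a 5-adic unit, and `i - i v` is divisible by `5 ^ v`, the
  -- equation `i + N n = i v` is solvable in the 5-adic integers.
  obtain ⟨v, u, hu, hNu⟩ := Nat.exists_eq_pow_mul_and_not_dvd hN 5 (by norm_num)
  have hcop : ∀ ℓ, IsCoprime (u : ℤ) (5 ^ ℓ) := fun ℓ => by
    refine IsCoprime.pow_right ?_
    rw [show (5 : ℤ) = ((5 : ℕ) : ℤ) by norm_num, Nat.isCoprime_iff_coprime, Nat.coprime_comm]
    exact (Nat.Prime.coprime_iff_not_dvd (by norm_num)).mpr hu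
  have hsol : ∀ ℓ, ∃ n : ℤ, (5 : ℤ) ^ (v + ℓ) ∣ i (v + ℓ) + N * n - i v := fun ℓ => by
    obtain ⟨a, b, hab⟩ := hcop ℓ
    obtain ⟨t, ht⟩ := five_pow_dvd_sub_of_le hi (Nat.le_add_right v ℓ)
    refine ⟨-(a * t), t * b, ?_⟩
    rw [hNu, pow_add]
    push_cast
    linear_combination ht - 5 ^ v * t * hab
  choose n hn using hsol
  refine ⟨i v, n, fun ℓ => ?_, fun ℓ => ?_⟩
  · have h1 := hn ℓ
    have h2 := (pow_dvd_pow (5 : ℤ) (Nat.le_succ (v + ℓ))).trans (hn (ℓ + 1))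
    have h3 := (h2.sub h1).sub (hi (v + ℓ))
    have h4 : (5 : ℤ) ^ v * 5 ^ ℓ ∣ 5 ^ v * (u * (n (ℓ + 1) - n ℓ)) := by
      rw [← pow_add]
      convert! h3 using 1
      rw [hNu, add_assoc v ℓ 1]
      push_cast
      ring
    exact (hcop ℓ).symm.dvd_of_dvd_mul_left
      ((mul_dvd_mul_iff_left (by positivity)).mp h4)
  · have h1 := (pow_dvd_pow (5 : ℤ) (Nat.le_add_left ℓ v)).trans (hn ℓ)
    have h2 := five_pow_dvd_sub_of_le hi (Nat.le_add_left ℓ v)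
    convert! h1.sub h2 using 1
    ring

theorem eq_zero_of_forall_five_pow_dvd {a : ℤ} (h : ∀ ℓ : ℕ, (5 : ℤ) ^ ℓ ∣ a) : a = 0 := by
  by_contra ha
  obtain ⟨ℓ, hℓ⟩ := pow_unbounded_of_one_lt (|a|) (show (1 : ℤ) < 5 by norm_num)
  have := Int.le_of_dvd (abs_pos.mpr ha) ((dvd_abs _ _).mpr (h ℓ))
  omega

/-- A coset of the multiples of a natural number in the five-adic integers has an irrational
member. -/
theorem exists_seq_irrational (i : ℕ → ℤ) {N : ℕ} (hN : N ≠ 0) :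
    ∃ n : ℕ → ℤ, (∀ ℓ, (5 : ℤ) ^ ℓ ∣ n (ℓ + 1) - n ℓ) ∧
      ∀ B D : ℤ, (∀ ℓ, (5 : ℤ) ^ ℓ ∣ D - (i ℓ + N * n ℓ) * B) → B = 0 := by
  by_cases hirr : ∀ B D : ℤ, (∀ ℓ, (5 : ℤ) ^ ℓ ∣ D - i ℓ * B) → B = 0
  · exact ⟨fun _ => 0, fun ℓ => by simp, fun B D h => hirr B D (by simpa using h)⟩
  push Not at hirr
  obtain ⟨B, D, hBD, hB⟩ := hirr
  -- Here `i` is rational. The sequence `2 ^ 5 ^ ℓ` converges to a 5-adic square root of `-1`, as `2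
  -- ^ 2 ≡ -1` modulo `5`, and adding `N √-1` to `i` makes it irrational.
  have h1 : ∀ ℓ : ℕ, (5 : ℤ) ^ (ℓ + 1) ∣ 2 ^ 5 ^ (ℓ + 1) - 2 ^ 5 ^ ℓ := fun ℓ => by
    have := dvd_sub_pow_of_dvd_sub (R := ℤ) (p := 5) (a := 2 ^ 5) (b := 2) (by norm_num) ℓ
    rwa [← pow_mul, ← pow_succ'] at this
  have h2 : ∀ ℓ : ℕ, (5 : ℤ) ^ (ℓ + 1) ∣ (2 ^ 5 ^ ℓ) ^ 2 + 1 := fun ℓ => by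
    have := dvd_sub_pow_of_dvd_sub (R := ℤ) (p := 5) (a := 4) (b := -1) (by norm_num) ℓ
    rw [(Odd.pow (by decide : Odd 5)).neg_one_pow, sub_neg_eq_add] at this
    rw [← pow_mul, mul_comm, pow_mul]
    exact this
  refine ⟨fun ℓ => 2 ^ 5 ^ ℓ, fun ℓ => (pow_dvd_pow _ ℓ.le_succ).trans (h1 ℓ), fun B' D' h => ?_⟩
  -- From `B i = D` and `B' (i + N √-1) = D'` follows `B D' - B' D = N B B' √-1`; squaring gives a
  -- vanishing sum of integer squares.
  have h3 : (B * D' - B' * D) ^ 2 + (N * B * B') ^ 2 = 0 :=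
    eq_zero_of_forall_five_pow_dvd fun ℓ => by
      have e1 := ((h ℓ).mul_left B).sub ((hBD ℓ).mul_left B')
      have e2 := e1.mul_left (B * D' - B' * D + N * B * B' * 2 ^ 5 ^ ℓ)
      have e3 := (((pow_dvd_pow (5 : ℤ) ℓ.le_succ).trans (h2 ℓ)).mul_left ((N * B * B') ^ 2)).add e2
      convert! e3 using 1
      ring
  have h4 : (N * B * B' : ℤ) ^ 2 = 0 :=
    ((add_eq_zero_iff_of_nonneg (sq_nonneg _) (sq_nonneg _)).mp h3).2
  simpa [hB, hN] using h4

end Arithmetic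

/-! ### Pullbacks to finite coverings of the base -/

namespace Heisenberg

instance : CompactSpace tower.Solenoid := by
  refine isCompact_iff_compactSpace.mp (IsClosed.isCompact ?_)
  have h : {x : ∀ ℓ, tower.M ℓ | ∀ ℓ, tower.p ℓ (x (ℓ + 1)) = x ℓ} =
      ⋂ ℓ, {x : ∀ ℓ, tower.M ℓ | tower.p ℓ (x (ℓ + 1)) = x ℓ} := by
    ext x
    simp
  change IsClosed {x : ∀ ℓ, tower.M ℓ | ∀ ℓ, tower.p ℓ (x (ℓ + 1)) = x ℓ}
  rw [h]
  exact isClosed_iInter fun ℓ => isClosed_eq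
    ((tower.isCoveringMap ℓ).continuous.comp (continuous_apply (ℓ + 1))) (continuous_apply ℓ)

/-- A finite covering of the base with a compatible action of the Heisenberg group. -/
class IsEquivariantCovering {M : Type} [TopologicalSpace M] [MulAction Heisenberg M]
    (q : M → Heisenberg ⧸ lattice 0) : Prop where
  isCoveringMap : IsCoveringMap q
  finite_fiber : ∀ u, (q ⁻¹' {u}).Finite
  map_smul : ∀ (a : Heisenberg) (m : M), q (a • m) = a • q m
  continuous_smul_left : ∀ m : M, Continuous fun a : Heisenberg => a • m

section LiftAction

variable {M : Type} [TopologicalSpace M] {q : M → Heisenberg ⧸ lattice 0}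

theorem exists_orbit_lift (hq : IsCoveringMap q) (m : M) :
    ∃ F : C(Heisenberg, M), F 1 = m ∧ ∀ a, q (F a) = a • q m := by
  obtain ⟨F, ⟨h1, h2⟩, -⟩ := hq.existsUnique_continuousMap_lifts
    ⟨fun a : Heisenberg => a • q m, (isCoveringMap_smul (q m)).continuous⟩ 1 m
    (one_smul Heisenberg _).symm
  exact ⟨F, h1, congrFun h2⟩

/-- The lift of the action of the Heisenberg group to a covering of the base. -/
@[reducible] def liftAction (hq : IsCoveringMap q) : MulAction Heisenberg M where
  smul a m := Classical.choose (exists_orbit_lift hq m) a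
  one_smul m := (Classical.choose_spec (exists_orbit_lift hq m)).1
  mul_smul a b m := by
    let F := fun m => Classical.choose (exists_orbit_lift hq m)
    have hF : ∀ m, F m 1 = m ∧ ∀ a, q (F m a) = a • q m :=
      fun m => Classical.choose_spec (exists_orbit_lift hq m)
    change F m (a * b) = F (F m b) a
    refine congrFun (hq.eq_of_comp_eq (g₁ := fun a => F m (a * b)) (g₂ := F (F m b))
      (by fun_prop) (F (F m b)).continuous ?_ 1 ?_) a
    · funext a
      simp only [Function.comp_apply, (hF _).2, mul_smul]
    · simp only [one_mul, (hF _).1]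

theorem isEquivariantCovering_liftAction (hq : IsCoveringMap q)
    (hfin : ∀ u, (q ⁻¹' {u}).Finite) :
    letI := liftAction hq
    IsEquivariantCovering q :=
  letI := liftAction hq
  { isCoveringMap := hq
    finite_fiber := hfin
    map_smul := fun a m => (Classical.choose_spec (exists_orbit_lift hq m)).2 a
    continuous_smul_left := fun m => (Classical.choose (exists_orbit_lift hq m)).continuous }

end LiftAction

/-- The pullback of the solenoid to a covering of the base. -/
abbrev FiberProduct {M : Type} (q : M → Heisenberg ⧸ lattice 0) : Type :=
  {z : M × tower.Solenoid // q z.1 = level 0 z.2}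

section ComponentLevel

variable {M : Type} [TopologicalSpace M] {q : M → Heisenberg ⧸ lattice 0} {z : FiberProduct q}

/-- The projection of a component of the fibre product to a level of the tower. -/
def componentLevel (ℓ : ℕ) (w : connectedComponent z) :
    M × (Heisenberg ⧸ lattice ℓ) := (w.1.1.1, level ℓ w.1.1.2)

theorem continuous_componentLevel (ℓ : ℕ) :
    Continuous (componentLevel ℓ : connectedComponent z → _) := by
  have := continuous_level ℓ
  unfold componentLevel
  fun_prop

end ComponentLevel

section Covering

variable {M : Type} [TopologicalSpace M] [MulAction Heisenberg M]
  {q : M → Heisenberg ⧸ lattice 0}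

theorem t2Space_of_isEquivariantCovering (hq : IsEquivariantCovering q) : T2Space M := by
  refine ⟨fun x y hxy => ?_⟩
  by_cases h : q x = q y
  · exact hq.isCoveringMap.isSeparatedMap x y h hxy
  · exact separated_by_continuous hq.isCoveringMap.continuous h

/-- The translates of one finite fibre by a compact box fill the space. -/
theorem compactSpace_of_isEquivariantCovering (hq : IsEquivariantCovering q) : CompactSpace M := by
  rw [← isCompact_univ_iff]
  convert! (hq.finite_fiber (QuotientGroup.mk 1)).isCompact_biUnion fun m _ =>
    (isCompact_box (5 ^ 0)).image (hq.continuous_smul_left m) using 1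
  refine (eq_univ_of_forall fun m => ?_).symm
  obtain ⟨a, ha⟩ := QuotientGroup.mk_surjective (q m)
  obtain ⟨γ, hγ, h⟩ := exists_mul_mem_box 0 a
  refine mem_biUnion (x := (a * γ)⁻¹ • m) ?_ ⟨a * γ, h, smul_inv_smul _ _⟩
  change q ((a * γ)⁻¹ • m) = _
  rw [hq.map_smul, ← ha, inv_smul_eq_iff]
  change _ = QuotientGroup.mk (a * γ * 1)
  rw [mul_one, QuotientGroup.mk_mul_of_mem a hγ]

theorem isOpenMap_smul_left (hq : IsEquivariantCovering q) (m : M) : IsOpenMap fun a : Heisenberg => a • m := by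
  refine (IsLocalHomeomorph.of_comp (g := q) (f := fun a => a • m) ?_
    hq.isCoveringMap.isLocalHomeomorph (hq.continuous_smul_left m)).isOpenMap
  convert! (isCoveringMap_smul (q m)).isLocalHomeomorph using 1
  funext a
  exact hq.map_smul a m

end Covering

section FiberProduct

variable {M : Type} [TopologicalSpace M] [MulAction Heisenberg M]
  {q : M → Heisenberg ⧸ lattice 0} [hq : IsEquivariantCovering q]

variable (q) in
theorem compactSpace_fiberProduct : CompactSpace (FiberProduct q) := by
  have := compactSpace_of_isEquivariantCovering hq
  refine isCompact_iff_compactSpace.mp (IsClosed.isCompact ?_)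
  exact isClosed_eq (hq.isCoveringMap.continuous.comp continuous_fst)
    ((continuous_level 0).comp continuous_snd)

instance : MulAction Heisenberg (FiberProduct q) where
  smul a z := ⟨a • z.1, by
    change q (a • z.1.1) = level 0 (a • z.1.2)
    rw [hq.map_smul, level_smul, z.2]⟩
  one_smul z := Subtype.ext (one_smul Heisenberg z.1)
  mul_smul a b z := Subtype.ext (mul_smul a b z.1)

theorem continuous_smul_fiberProduct (z : FiberProduct q) :
    Continuous fun a : Heisenberg => a • z :=
  Continuous.subtype_mk ((hq.continuous_smul_left z.1.1).prodMk (continuous_smul_left z.1.2)) _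

theorem smul_mem_connectedComponent (a : Heisenberg) (z : FiberProduct q) :
    a • z ∈ connectedComponent z := by
  refine (isPreconnected_range (continuous_smul_fiberProduct z)).subset_connectedComponent
    ⟨1, one_smul _ _⟩ ⟨a, rfl⟩

instance (z : FiberProduct q) : MulAction Heisenberg (connectedComponent z) where
  smul a w := ⟨a • w.1, (connectedComponent_eq w.2).symm.subset
    (smul_mem_connectedComponent a w.1)⟩
  one_smul w := Subtype.ext (one_smul Heisenberg w.1)
  mul_smul a b w := Subtype.ext (mul_smul a b w.1)

theorem continuous_smul_component {z : FiberProduct q} (w : connectedComponent z) :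
    Continuous fun a : Heisenberg => a • w :=
  Continuous.subtype_mk (continuous_smul_fiberProduct w.1) _

theorem componentLevel_smul {z : FiberProduct q} (ℓ : ℕ) (a : Heisenberg)
    (w : connectedComponent z) : componentLevel ℓ (a • w) = a • componentLevel ℓ w := rfl

/-- Near `w`, the point in `M` and the point at level `k` are moved by small elements `a` and `a'`.
They agree over the base, so freeness gives `a = a'`. Two points near `w` are then compared through
`w`. -/
theorem eventually_exists_smul_componentLevel_eq {z : FiberProduct q} (k : ℕ)
    {V : Set Heisenberg} (hV : V ∈ 𝓝 1) (w : connectedComponent z) :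
    ∀ᶠ p in 𝓝 (w, w), ∃ s ∈ V, s • componentLevel k p.1 = componentLevel k p.2 := by
  obtain ⟨V₀, hV₀, hfree⟩ := exists_nhds_one_smul_ne
  have h1 : ∀ᶠ p : Heisenberg × Heisenberg in 𝓝 (1, 1), p.1 * p.2⁻¹ ∈ V ∧ p.1⁻¹ * p.2 ∈ V₀ := by
    refine Filter.Eventually.and ?_ ?_ <;> refine ContinuousAt.eventually_mem (by fun_prop) ?_
    · simpa using hV
    · simpa using hV₀
  rw [nhds_prod_eq] at h1
  obtain ⟨W, hW, h1⟩ := Filter.eventually_prod_self_iff'.mp h1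
  have h2 : ∀ᶠ w' in 𝓝 w, ∃ a ∈ W, a • componentLevel k w = componentLevel k w' := by
    have e1 : ∀ᶠ w' in 𝓝 w, w'.1.1.1 ∈ (fun a : Heisenberg => a • w.1.1.1) '' W := by
      refine ContinuousAt.eventually_mem (by fun_prop) ?_
      simpa using (isOpenMap_smul_left hq w.1.1.1).image_mem_nhds hW
    have e2 : ∀ᶠ w' in 𝓝 w,
        level k w'.1.1.2 ∈ (fun a : Heisenberg => a • level k w.1.1.2) '' W := by
      refine ContinuousAt.eventually_mem (f := fun w' : connectedComponent z => level k w'.1.1.2)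
        ((continuous_level k).comp (by fun_prop)).continuousAt ?_
      have := (isCoveringMap_smul (level k w.1.1.2)).isOpenMap.image_mem_nhds hW
      rwa [one_smul] at this
    filter_upwards [e1, e2] with w' h h'
    obtain ⟨a, ha, haw⟩ := h
    obtain ⟨a', ha', haw'⟩ := h'
    have h3 : level 0 (a' • w.1.1.2) = level 0 w'.1.1.2 := level_eq_of_le k.zero_le haw'
    have haw0 : a • w.1.1.1 = w'.1.1.1 := haw
    rw [← w'.1.2, ← haw0, hq.map_smul, w.1.2, level_smul] at h3
    have h4 := hfree _ (h1 a ha a' ha').2 (level 0 w.1.1.2) (by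
      rw [mul_smul, h3, inv_smul_smul])
    obtain rfl : a = a' := inv_mul_eq_one.mp h4
    exact ⟨a, ha, Prod.ext haw haw'⟩
  have h3 := h2.prod_mk h2
  rw [← nhds_prod_eq] at h3
  filter_upwards [h3] with p hp
  obtain ⟨⟨a, ha, hap⟩, b, hb, hbp⟩ := hp
  refine ⟨b * a⁻¹, (h1 b hb a ha).1, ?_⟩
  rw [← hap, ← hbp, mul_smul, inv_smul_smul]

/-- The solenoid coordinate of the image of an orbit lifts to the Heisenberg space; uniqueness of
lifts through `q` makes the coordinate in `M` follow. -/
theorem exists_lift_homeomorph {z : FiberProduct q}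
    (h : connectedComponent z ≃ₜ connectedComponent z) (w : connectedComponent z) :
    ∃ φ : Heisenberg → Heisenberg, Continuous φ ∧ φ 1 = 1 ∧ ∀ a, h (a • w) = φ a • h w := by
  have hc : Continuous fun a : Heisenberg => h (a • w) :=
    h.continuous.comp (continuous_smul_component w)
  obtain ⟨φ, hφ, hφ1, hφc⟩ := exists_lift (c := fun a => (h (a • w)).1.1.2)
    (continuous_snd.comp (continuous_subtype_val.comp (continuous_subtype_val.comp hc)))
    (1 : Heisenberg) (x := (h w).1.1.2) (g := 1) (by simp only [one_smul])
  refine ⟨φ, hφ, hφ1, fun a => Subtype.ext (Subtype.ext (Prod.ext ?_ (hφc a)))⟩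
  refine congrFun (hq.isCoveringMap.eq_of_comp_eq (g₁ := fun a => (h (a • w)).1.1.1)
    (g₂ := fun a => φ a • (h w).1.1.1)
    (continuous_fst.comp (continuous_subtype_val.comp (continuous_subtype_val.comp hc)))
    ((hq.continuous_smul_left _).comp hφ) ?_ 1 ?_) a
  · funext a
    simp only [Function.comp_apply]
    rw [(h (a • w)).1.2, hφc, hq.map_smul, level_smul, (h w).1.2]
  · simp only [hφ1, one_smul]

theorem exists_ne_one_of_component_homeomorph {z : FiberProduct q}
    (h : connectedComponent z ≃ₜ connectedComponent z) (w : connectedComponent z) :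
    ∃ ℓ₀, ∀ β : Heisenberg, β • componentLevel ℓ₀ w = componentLevel ℓ₀ w →
      (∀ K : Set Heisenberg, IsCompact K → ∃ n : ℕ, β ^ n ∉ K) →
      ∃ δ : Heisenberg, δ ≠ 1 ∧ δ • componentLevel 0 (h w) = componentLevel 0 (h w) ∧
        ∀ k, ∃ ℓ, ∀ n : ℕ, β ^ n • componentLevel ℓ w = componentLevel ℓ w →
          δ ^ n • componentLevel k (h w) = componentLevel k (h w) := by
  have := compactSpace_fiberProduct q
  have := t2Space_of_isEquivariantCovering hq
  have : CompactSpace (connectedComponent z) :=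
    isCompact_iff_compactSpace.mp isClosed_connectedComponent.isCompact
  obtain ⟨V₀, hV₀, hfree⟩ := exists_nhds_one_smul_ne
  refine exists_ne_one_of_homeomorph (pr := fun ℓ => componentLevel ℓ) continuous_componentLevel
    componentLevel_smul (fun k ℓ hkl v w h => ?_) (fun v w h => ?_)
    (fun k V hV w => eventually_exists_smul_componentLevel_eq k hV w) hV₀ (fun s hs u hu => ?_)
    (fun a v hv => ?_) exists_lift_homeomorph h w
  · exact Prod.ext (congrArg Prod.fst h :) (level_eq_of_le hkl (congrArg Prod.snd h :))
  · exact Subtype.ext (Subtype.ext (Prod.ext (congrArg Prod.fst (h 0) :)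
      (level_injective fun ℓ => (congrArg Prod.snd (h ℓ) :))))
  · exact hfree s hs _ (congrArg Prod.snd hu :)
  · exact eq_one_of_smul_eq_self (x := v.1.1.2) (congrArg (fun v => v.1.1.2) hv :)

/-- An element which fixes a point of the base has a power which fixes a given point above it. -/
theorem exists_pow_smul_eq {a : Heisenberg} {m : M} (h : a • q m = q m) :
    ∃ N : ℕ, N ≠ 0 ∧ a ^ N • m = m := by
  have hmem : ∀ n : ℕ, q (a ^ n • m) = q m := fun n => by
    rw [hq.map_smul]
    exact pow_mem (show a ∈ MulAction.stabilizer Heisenberg (q m) from h) n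
  have hfin : Finite (q ⁻¹' {q m}) := hq.finite_fiber (q m)
  obtain ⟨i, j, hij, h1⟩ := Finite.exists_ne_map_eq_of_infinite
    fun n : ℕ => (⟨a ^ n • m, hmem n⟩ : q ⁻¹' {q m})
  have h1 : a ^ i • m = a ^ j • m := congrArg Subtype.val h1
  rcases hij.lt_or_gt with hlt | hlt
  · obtain ⟨d, rfl⟩ := Nat.exists_eq_add_of_lt hlt
    refine ⟨d + 1, by omega, ?_⟩
    rwa [add_assoc, pow_add, mul_smul, eq_comm, smul_left_cancel_iff] at h1
  · obtain ⟨d, rfl⟩ := Nat.exists_eq_add_of_lt hlt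
    refine ⟨d + 1, by omega, ?_⟩
    rwa [add_assoc, pow_add, mul_smul, smul_left_cancel_iff] at h1

end FiberProduct

end Heisenberg

/-! ### Homogeneity of components -/

theorem IsHomogeneousSpace.of_homeomorph {X Y : Type*} [TopologicalSpace X] [TopologicalSpace Y]
    (h : IsHomogeneousSpace X) (e : X ≃ₜ Y) : IsHomogeneousSpace Y := fun x y => by
  obtain ⟨f, hf⟩ := h (e.symm x) (e.symm y)
  exact ⟨(e.symm.trans f).trans e, by simp [hf]⟩

/-- Homeomorphisms permute components, so one that sends `x` to a point of its own component
preserves that component. -/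
theorem IsHomogeneousSpace.component {X : Type*} [TopologicalSpace X]
    (h : IsHomogeneousSpace X) (z : X) : IsHomogeneousSpace (connectedComponent z) := by
  rintro ⟨x, hx⟩ ⟨y, hy⟩
  obtain ⟨f, rfl⟩ := h x y
  have hf : f '' connectedComponent z = connectedComponent z := by
    rw [connectedComponent_eq hx, ← connectedComponentIn_univ,
      f.image_connectedComponentIn (mem_univ x), image_univ, f.surjective.range_eq,
      connectedComponentIn_univ, ← connectedComponent_eq hy, connectedComponent_eq hx,
      connectedComponentIn_univ]
  exact ⟨(f.image _).trans (Homeomorph.setCongr hf), rfl⟩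

/-! ### The five-adic invariant and inhomogeneity -/

namespace Heisenberg

/-- The levels of the point have integral representatives with given first coordinates. -/
def HasResidues (i : ℕ → ℤ) (x : tower.Solenoid) : Prop :=
  ∀ ℓ, ∃ j k : ℤ, level ℓ x = QuotientGroup.mk (mk (i ℓ) j k)

/-- The third coordinate of the conjugate is `D - i ℓ * B + j * A`, and `j * A` drops out modulo `5
^ ℓ`; the coordinates `j` and `k` of the representative are irrelevant. -/
theorem HasResidues.smul_level_eq_iff {i : ℕ → ℤ} {x : tower.Solenoid} (hx : HasResidues i x)
    {ℓ : ℕ} {A B D : ℤ} : mk A B D • level ℓ x = level ℓ x ↔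
      (5 : ℤ) ^ ℓ ∣ A ∧ (2 : ℤ) ^ ℓ ∣ B ∧ (5 : ℤ) ^ ℓ ∣ D - i ℓ * B := by
  obtain ⟨j, k, h⟩ := hx ℓ
  have h2 := coord_conj_two (mk (i ℓ) j k) (mk A B D)
  simp only [coord_mk_zero, coord_mk_one, coord_mk_two] at h2
  rw [h, smul_mk_eq_self, mem_lattice]
  constructor
  · rintro ⟨I, J, K, e⟩
    rw [e, coord_mk_two] at h2
    have h0 := coord_conj_zero (mk (i ℓ) j k) (mk A B D)
    have h1 := coord_conj_one (mk (i ℓ) j k) (mk A B D)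
    rw [e, coord_mk_zero, coord_mk_zero] at h0
    rw [e, coord_mk_one, coord_mk_one] at h1
    have e0 : A = 5 ^ ℓ * I := by exact_mod_cast h0.symm
    have e1 : B = 2 ^ ℓ * J := by exact_mod_cast h1.symm
    have e2 : 5 ^ ℓ * K = D - i ℓ * B + j * A := by exact_mod_cast h2
    exact ⟨⟨I, e0⟩, ⟨J, e1⟩, K - j * I, by linear_combination -e2 - j * e0⟩
  · rintro ⟨⟨I, rfl⟩, ⟨J, rfl⟩, K, hK⟩
    refine ⟨I, J, K + j * I, ext_coord ?_ ?_ ?_⟩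
    · rw [coord_conj_zero]
      simp
    · rw [coord_conj_one]
      simp
    · have hK' : (D - i ℓ * (2 ^ ℓ * J) : ℝ) = 5 ^ ℓ * K := by exact_mod_cast hK
      push_cast at h2 ⊢
      rw [h2, hK', coord_mk_two]
      ring

/-- Over the identity coset all representatives are integral, and consecutive ones differ on the
right by an element of `lattice ℓ`, whose first coordinate is a multiple of `5 ^ ℓ`. -/
theorem exists_hasResidues {x : tower.Solenoid} (h : level 0 x = QuotientGroup.mk 1) :
    ∃ i : ℕ → ℤ, (∀ ℓ, (5 : ℤ) ^ ℓ ∣ i (ℓ + 1) - i ℓ) ∧ HasResidues i x := by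
  choose g hg using fun ℓ => QuotientGroup.mk_surjective (level ℓ x)
  have hsucc : ∀ ℓ, (g ℓ)⁻¹ * g (ℓ + 1) ∈ lattice ℓ := fun ℓ => by
    rw [← QuotientGroup.eq, hg, ← map_level_succ ℓ x, ← hg]
    rfl
  have hint : ∀ ℓ, ∃ i j k : ℤ, g ℓ = mk i j k := fun ℓ => by
    have h1 : g ℓ ∈ lattice 0 := by
      induction ℓ with
      | zero =>
        rw [← inv_mem_iff, ← mul_one (g 0)⁻¹, ← QuotientGroup.eq, hg, h]
      | succ ℓ ih =>
        have := mul_mem ih (lattice_antitone ℓ.zero_le (hsucc ℓ))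
        rwa [mul_inv_cancel_left] at this
    obtain ⟨i, j, k, h2⟩ := h1
    exact ⟨i, j, k, by simpa using h2⟩
  choose i j k hijk using hint
  refine ⟨i, fun ℓ => ?_, fun ℓ => ⟨j ℓ, k ℓ, by rw [← hijk, hg]⟩⟩
  obtain ⟨I, J, K, e⟩ := hsucc ℓ
  have h0 := congrArg (fun a => a.coord 0) e
  simp only [hijk, coord_mul_zero, coord_inv_zero, coord_mk_zero] at h0
  refine ⟨I, ?_⟩
  have : -i ℓ + i (ℓ + 1) = 5 ^ ℓ * I := by exact_mod_cast h0
  linarith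

theorem HasResidues.smul_level_eq_smul_level {i : ℕ → ℤ} {x : tower.Solenoid}
    (hx : HasResidues i x) {ℓ : ℕ} {m n : ℤ} (h : (5 : ℤ) ^ ℓ ∣ m - n) :
    mk m 0 0 • level ℓ x = mk n 0 0 • level ℓ x := by
  have h1 : (mk n 0 0)⁻¹ * mk m 0 0 = mk ((m - n : ℤ) : ℝ) (0 : ℤ) (0 : ℤ) := by
    refine ext_coord ?_ ?_ ?_ <;> simp
    ring
  have h2 := hx.smul_level_eq_iff.mpr (⟨h, by simp, by simp⟩ :
    (5 : ℤ) ^ ℓ ∣ m - n ∧ (2 : ℤ) ^ ℓ ∣ 0 ∧ (5 : ℤ) ^ ℓ ∣ 0 - i ℓ * 0)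
  rwa [← h1, mul_smul, inv_smul_eq_iff] at h2

/-- The closure of an orbit contains points with prescribed residues. -/
theorem HasResidues.exists_tendsto {i : ℕ → ℤ} {x : tower.Solenoid} (hx : HasResidues i x) (N : ℕ)
    {n : ℕ → ℤ} (hn : ∀ ℓ, (5 : ℤ) ^ ℓ ∣ n (ℓ + 1) - n ℓ) :
    ∃ y, HasResidues (fun ℓ => i ℓ + N * n ℓ) y ∧
      Filter.Tendsto (fun ℓ => mk ((N * n ℓ : ℤ) : ℝ) 0 0 • x) Filter.atTop (𝓝 y) := by
  have hdvd : ∀ k ℓ, k ≤ ℓ → (5 : ℤ) ^ k ∣ N * n ℓ - N * n k := fun k ℓ hkl => by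
    rw [← mul_sub]
    exact (five_pow_dvd_sub_of_le hn hkl).mul_left _
  -- The translate of `x` by the 5-adic number `N n`: at level `ℓ` only its class modulo `5 ^ ℓ`
  -- matters.
  let y : tower.Solenoid := ⟨fun ℓ => mk ((N * n ℓ : ℤ) : ℝ) 0 0 • level ℓ x, fun ℓ => by
    have h : Subgroup.quotientMapOfLE (lattice_succ_le ℓ)
        (mk ((N * n (ℓ + 1) : ℤ) : ℝ) 0 0 • level (ℓ + 1) x) =
          mk ((N * n ℓ : ℤ) : ℝ) 0 0 • level ℓ x := by
      rw [quotientMapOfLE_smul, map_level_succ]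
      exact hx.smul_level_eq_smul_level (hdvd ℓ (ℓ + 1) ℓ.le_succ)
    exact h⟩
  refine ⟨y, fun ℓ => ?_, ?_⟩
  · obtain ⟨j, k, h⟩ := hx ℓ
    refine ⟨j, N * n ℓ * j + k, ?_⟩
    change mk ((N * n ℓ : ℤ) : ℝ) 0 0 • level ℓ x = _
    rw [h]
    change QuotientGroup.mk (mk _ 0 0 * mk _ _ _) = _
    congr 1
    refine ext_coord ?_ ?_ ?_ <;> simp <;> ring
  · refine IsInducing.subtypeVal.tendsto_nhds_iff.mpr (tendsto_pi_nhds.mpr fun k => ?_)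
    refine tendsto_const_nhds.congr' ?_
    filter_upwards [Filter.eventually_ge_atTop k] with ℓ hkl
    exact (hx.smul_level_eq_smul_level (hdvd k ℓ hkl)).symm

/-- The third coordinate is doubled to avoid the division in `n (n - 1) / 2`. -/
theorem mk_pow (A B D : ℤ) (n : ℕ) : ∃ D' : ℤ, 2 * D' = 2 * n * D + n * (n - 1) * (A * B) ∧
    mk A B D ^ n = mk (n * A : ℤ) (n * B : ℤ) D' := by
  obtain ⟨c, hc⟩ : (2 : ℤ) ∣ n * (n - 1) := by
    simpa using (Int.even_mul_pred_self (n : ℤ)).two_dvd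
  refine ⟨n * D + c * (A * B), by linear_combination -(A * B) * hc, ?_⟩
  obtain ⟨h0, h1, h2⟩ := coord_pow (mk A B D) n
  have hc' : (n * (n - 1) : ℝ) = 2 * c := by exact_mod_cast hc
  refine ext_coord ?_ ?_ ?_
  · simpa using h0
  · simpa using h1
  · rw [h2, hc']
    simp

theorem mk_zpow (A : ℝ) (n : ℤ) : mk A 0 0 ^ n = mk (A * n) 0 0 := by
  have hnat : ∀ n : ℕ, mk A 0 0 ^ n = mk (A * n) 0 0 := fun n => by
    obtain ⟨h0, h1, h2⟩ := coord_pow (mk A 0 0) n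
    refine ext_coord ?_ ?_ ?_
    · rw [h0]
      simp [mul_comm]
    · simp [h1]
    · simp [h2]
  cases n with
  | ofNat n => simpa using hnat n
  | negSucc n =>
    rw [zpow_negSucc, hnat]
    refine ext_coord ?_ ?_ ?_ <;> simp
    ring

section FiberProduct

variable {M : Type} [TopologicalSpace M] [MulAction Heisenberg M]
  {q : M → Heisenberg ⧸ lattice 0} [hq : IsEquivariantCovering q]

/-- A component of the fibre product has a point over a given one with shifted residues. -/
theorem exists_component_hasResidues {z : FiberProduct q} {i : ℕ → ℤ} (hi : HasResidues i z.1.2)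
    {N : ℕ} (hN : mk N 0 0 • z.1.1 = z.1.1) {n : ℕ → ℤ}
    (hn : ∀ ℓ, (5 : ℤ) ^ ℓ ∣ n (ℓ + 1) - n ℓ) :
    ∃ w : connectedComponent z, w.1.1.1 = z.1.1 ∧ HasResidues (fun ℓ => i ℓ + N * n ℓ) w.1.1.2 := by
  obtain ⟨y, hy, hlim⟩ := hi.exists_tendsto N hn
  have hfix : ∀ m : ℤ, mk ((N * m : ℤ) : ℝ) 0 0 • z.1.1 = z.1.1 := fun m => by
    have := zpow_mem (show mk N 0 0 ∈ MulAction.stabilizer Heisenberg z.1.1 from hN) m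
    rw [mk_zpow] at this
    push_cast
    exact this
  have hlim' : Filter.Tendsto (fun ℓ => (mk ((N * n ℓ : ℤ) : ℝ) 0 0 • z).1) Filter.atTop
      (𝓝 (z.1.1, y)) := by
    refine Filter.Tendsto.prodMk_nhds (tendsto_const_nhds.congr fun ℓ => ?_) hlim
    exact (hfix (n ℓ)).symm
  have hq0 : q z.1.1 = level 0 y := by
    have := t2Space_of_isEquivariantCovering hq
    refine tendsto_nhds_unique (f := fun _ : ℕ => q z.1.1) (l := Filter.atTop) tendsto_const_nhds ?_
    refine (((continuous_level 0).tendsto y).comp hlim).congr fun ℓ => ?_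
    rw [Function.comp_apply, ← hfix (n ℓ), hq.map_smul, z.2, level_smul]
  refine ⟨⟨⟨(z.1.1, y), hq0⟩, ?_⟩, rfl, hy⟩
  refine isClosed_connectedComponent.mem_of_tendsto
    (IsInducing.subtypeVal.tendsto_nhds_iff.mpr hlim') (Filter.Eventually.of_forall fun ℓ => ?_)
  exact smul_mem_connectedComponent _ z

/-- A homeomorphism does not map a point of rational type to a point of irrational type. -/
theorem homeomorph_ne_of_residues {z : FiberProduct q}
    (h : connectedComponent z ≃ₜ connectedComponent z) {w w' : connectedComponent z}
    {i i' : ℕ → ℤ}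
    (hi : HasResidues i w.1.1.2) (hi' : HasResidues i' w'.1.1.2) {r : ℤ}
    (hr : ∀ ℓ, (5 : ℤ) ^ ℓ ∣ i ℓ - r)
    (hirr : ∀ B D : ℤ, (∀ ℓ, (5 : ℤ) ^ ℓ ∣ D - i' ℓ * B) → B = 0) : h w ≠ w' := by
  rintro rfl
  obtain ⟨ℓ₀, hℓ₀⟩ := exists_ne_one_of_component_homeomorph h w
  obtain ⟨N, hN, hNw⟩ := exists_pow_smul_eq (q := q) (a := mk (0 : ℤ) (1 : ℤ) r) (m := w.1.1.1) (by
    rw [w.1.2, hi.smul_level_eq_iff]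
    simp)
  have hpow : ∀ n : ℕ, mk (0 : ℤ) (1 : ℤ) r ^ n = mk (0 : ℤ) (n : ℤ) (n * r : ℤ) := fun n => by
    obtain ⟨D', hD, h1⟩ := mk_pow 0 1 r n
    have : D' = n * r := by linarith
    rw [h1, this]
    simp
  -- As `i ℓ ≡ r` modulo `5 ^ ℓ`, every power of `(0, 1, r)` meets the 5-adic condition, and only
  -- divisibility by `2 ^ ℓ` remains.
  have hfix : ∀ ℓ n : ℕ, 2 ^ ℓ ∣ n →
      (mk (0 : ℤ) (1 : ℤ) r ^ N) ^ n • componentLevel ℓ w = componentLevel ℓ w := by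
    intro ℓ n hn
    refine Prod.ext ?_ ?_
    · exact pow_mem (show _ ∈ MulAction.stabilizer Heisenberg w.1.1.1 from hNw) n
    · change (mk (0 : ℤ) (1 : ℤ) r ^ N) ^ n • level ℓ w.1.1.2 = level ℓ w.1.1.2
      rw [← pow_mul, hpow, hi.smul_level_eq_iff]
      refine ⟨dvd_zero _, ?_, ?_⟩
      · exact_mod_cast hn.mul_left N
      · convert! (hr ℓ).mul_left (-((N * n : ℕ) : ℤ)) using 1
        ring
  -- The exponent `2 ^ ℓ₀` makes the element fix level `ℓ₀`; its powers leave compact sets because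
  -- their second coordinates grow.
  obtain ⟨δ, hδ1, hδ0, hδ⟩ := hℓ₀ ((mk (0 : ℤ) (1 : ℤ) r ^ N) ^ 2 ^ ℓ₀) (hfix _ _ dvd_rfl) (by
    intro K hK
    obtain ⟨R, hR⟩ := (hK.image (continuous_coord 1)).bddAbove
    obtain ⟨n, hn⟩ := exists_nat_gt R
    refine ⟨n, fun hnK => ?_⟩
    have h1 : (((mk (0 : ℤ) (1 : ℤ) r ^ N) ^ 2 ^ ℓ₀) ^ n).coord 1 ≤ R := hR ⟨_, hnK, rfl⟩
    rw [← pow_mul, ← pow_mul, hpow, coord_mk_one] at h1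
    have h2 : n ≤ N * 2 ^ ℓ₀ * n := Nat.le_mul_of_pos_left n (by positivity)
    have h3 : (n : ℝ) ≤ ((N * 2 ^ ℓ₀ * n : ℕ) : ℤ) := by exact_mod_cast h2
    rw [mul_assoc] at h3
    linarith)
  obtain ⟨A, B, D, rfl⟩ : ∃ A B D : ℤ, δ = mk A B D := by
    obtain ⟨j, k, hjk⟩ := hi' 0
    have h1 : δ • level 0 (h w).1.1.2 = level 0 (h w).1.1.2 := congrArg Prod.snd hδ0
    rw [hjk, smul_mk_eq_self] at h1
    have hg : mk (i' 0) j k ∈ lattice 0 := ⟨i' 0, j, k, by simp⟩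
    have h2 := mul_mem (mul_mem hg h1) (inv_mem hg)
    have h3 : mk (i' 0) j k * ((mk (i' 0) j k)⁻¹ * δ * mk (i' 0) j k) * (mk (i' 0) j k)⁻¹ = δ := by
      group
    rw [h3] at h2
    obtain ⟨A, B, D, h4⟩ := h2
    exact ⟨A, B, D, by simpa using h4⟩
  -- For the exponent `2 ^ ℓ` the conditions at level `k` lose the factor `2 ^ ℓ`, a unit modulo `5
  -- ^ k`. Hence `A = 0` and `D = i' B` in the 5-adic integers, against irrationality unless `δ =
  -- 1`.
  have key : ∀ k : ℕ, ∃ ℓ : ℕ, (5 : ℤ) ^ k ∣ 2 ^ ℓ * A ∧ ∃ D' : ℤ,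
      2 * D' = 2 * 2 ^ ℓ * D + 2 ^ ℓ * (2 ^ ℓ - 1) * (A * B) ∧
        (5 : ℤ) ^ k ∣ D' - i' k * (2 ^ ℓ * B) := by
    intro k
    obtain ⟨ℓ, hℓ⟩ := hδ k
    have h1 := hℓ (2 ^ ℓ) (by
      rw [← pow_mul]
      exact hfix ℓ _ (Dvd.intro_left _ rfl))
    have h2 : mk A B D ^ 2 ^ ℓ • level k (h w).1.1.2 = level k (h w).1.1.2 := congrArg Prod.snd h1
    obtain ⟨D', hD', h3⟩ := mk_pow A B D (2 ^ ℓ)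
    rw [h3, hi'.smul_level_eq_iff] at h2
    push_cast at h2 hD'
    exact ⟨ℓ, h2.1, D', hD', h2.2.2⟩
  have hcop : ∀ k ℓ : ℕ, IsCoprime ((5 : ℤ) ^ k) (2 ^ ℓ) := fun k ℓ =>
    IsCoprime.pow ⟨1, -2, by norm_num⟩
  have hA : A = 0 := eq_zero_of_forall_five_pow_dvd fun k => by
    obtain ⟨ℓ, h1, -⟩ := key k
    exact (hcop k ℓ).dvd_of_dvd_mul_left h1
  subst hA
  have hD : ∀ k, (5 : ℤ) ^ k ∣ D - i' k * B := fun k => by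
    obtain ⟨ℓ, -, D', h1, h2⟩ := key k
    have h3 : D' = 2 ^ ℓ * D := by linarith
    rw [h3] at h2
    have h4 : 2 ^ ℓ * D - i' k * (2 ^ ℓ * B) = 2 ^ ℓ * (D - i' k * B) := by ring
    exact (hcop k ℓ).dvd_of_dvd_mul_left (h4 ▸ h2)
  obtain rfl : B = 0 := hirr B D hD
  obtain rfl : D = 0 := eq_zero_of_forall_five_pow_dvd fun k => by simpa using hD k
  exact hδ1 (ext_coord (by simp) (by simp) (by simp))

/-- Moving along the orbit stays in the component and reaches the identity coset. There the
component has a point with integer invariant and one with irrational invariant. -/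
theorem not_isHomogeneousSpace_component (z : FiberProduct q) :
    ¬ IsHomogeneousSpace (connectedComponent z) := by
  suffices H : ∀ z : FiberProduct q, level 0 z.1.2 = QuotientGroup.mk 1 →
      ¬ IsHomogeneousSpace (connectedComponent z) by
    obtain ⟨a, ha⟩ := QuotientGroup.mk_surjective (level 0 z.1.2)
    have h1 := H (a⁻¹ • z) (by
      change a⁻¹ • level 0 z.1.2 = _
      rw [← ha, inv_smul_eq_iff]
      change _ = QuotientGroup.mk (a * 1)
      rw [mul_one])
    rwa [← connectedComponent_eq (smul_mem_connectedComponent a⁻¹ z)] at h1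
  intro z hz hom
  obtain ⟨i, hi, hres⟩ := exists_hasResidues hz
  -- This `N` determines the coset `i + N ℤ₅` of invariants that are realized in the component.
  obtain ⟨N, hN, hfix⟩ := exists_pow_smul_eq (q := q) (a := mk 1 0 0) (m := z.1.1) (by
    have := (hres.smul_level_eq_iff (ℓ := 0) (A := 1) (B := 0) (D := 0)).mpr (by simp)
    rw [z.2]
    simpa using this)
  have hfix' : mk N 0 0 • z.1.1 = z.1.1 := by
    have := mk_zpow 1 N
    rw [zpow_natCast] at this
    rw [this] at hfix
    simpa using hfix
  obtain ⟨r, n, hn, hr⟩ := exists_seq_dvd_add_mul_sub hi hN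
  obtain ⟨n', hn', hirr⟩ := exists_seq_irrational i hN
  obtain ⟨w, hw, hwres⟩ := exists_component_hasResidues hres hfix' hn
  obtain ⟨w', -, hwres'⟩ := exists_component_hasResidues hres hfix' hn'
  obtain ⟨h, hh⟩ := hom w w'
  exact homeomorph_ne_of_residues h hwres hwres' hr hirr hh

end FiberProduct

/-- No component of the pullback of the solenoid to a finite covering of the base is
homogeneous. -/
theorem not_isHomogeneousSpace_pullback {M : Type} [TopologicalSpace M] {q : M → tower.M 0}
    (hq : IsFiniteConnectedCovering q) (z : tower.Pullback q) :
    ¬ IsHomogeneousSpace (connectedComponent z) := by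
  let _ : MulAction Heisenberg M := liftAction (q := q) hq.2.1
  have : IsEquivariantCovering q := isEquivariantCovering_liftAction (q := q) hq.2.1 hq.2.2
  exact not_isHomogeneousSpace_component (q := q) z

theorem not_virtuallyHomogeneous_tower : ¬ tower.VirtuallyHomogeneous := by
  rintro ⟨M, _, q, hq, h⟩
  have := hq.1
  obtain ⟨m⟩ : Nonempty M := inferInstance
  obtain ⟨x, hx⟩ : ∃ x : tower.Solenoid, q m = level 0 x := by
    obtain ⟨g, hg⟩ := QuotientGroup.mk_surjective (s := lattice 0) (q m)
    exact ⟨⟨fun ℓ => (QuotientGroup.mk g : Heisenberg ⧸ lattice ℓ), fun ℓ => rfl⟩, hg.symm⟩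
  exact not_isHomogeneousSpace_pullback hq ⟨(m, x), hx⟩
    (IsHomogeneousSpace.component h ⟨(m, x), hx⟩)

theorem not_isHomogeneousSpace_solenoid : ¬ IsHomogeneousSpace tower.Solenoid := by
  intro h
  refine not_virtuallyHomogeneous_tower ⟨tower.M 0, inferInstance, id, ⟨inferInstance,
    isCoveringMap_homeomorph (Homeomorph.refl _), fun x => finite_singleton x⟩, ?_⟩
  refine IsHomogeneousSpace.of_homeomorph h
    { toFun := fun x => ⟨(tower.baseProj x, x), rfl⟩
      invFun := fun z => z.1.2
      left_inv := fun x => rfl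
      right_inv := fun z => Subtype.ext (Prod.ext z.2.symm rfl)
      continuous_toFun := Continuous.subtype_mk ((continuous_level 0).prodMk continuous_id) _
      continuous_invFun := by fun_prop }

end Heisenberg

end

theorem mainTheorem3 :
    ∃ P : Presentation 3,
      -- the leaves are manifolds of dimension 3
      (∀ x : P.Solenoid, Nonempty (ChartedSpace (EuclideanSpace ℝ (Fin 3)) (Leaf x))) ∧
      -- the base is a quotient of the Heisenberg space by a discrete subgroup, and the quotient
      -- map factors through a covering of each leaf by the Heisenberg space
      (∃ (Γ : Subgroup Heisenberg) (proj : Heisenberg → P.M 0),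
        DiscreteTopology Γ ∧ Function.Surjective proj ∧
        IsLocalDiffeomorph (𝓡 3) (𝓡 3) ∞ proj ∧
        (∀ a b : Heisenberg, proj a = proj b ↔ a⁻¹ * b ∈ Γ) ∧
        ∀ x : P.Solenoid, ∃ f : Heisenberg → Leaf x,
          IsCoveringMap f ∧ Function.Surjective f ∧ ∀ a, P.baseProj (f a).incl = proj a) ∧
      -- every leaf has growth type exactly polynomial of degree 4
      (∀ (g : SmoothRiemannianMetric 3 (P.M 0)) (x : P.Solenoid),
        HasExactPolynomialGrowth (P.leafGrowth g x) 4) ∧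
      -- the solenoid is neither homogeneous nor virtually homogeneous
      ¬ IsHomogeneousSpace P.Solenoid ∧
      ¬ P.VirtuallyHomogeneous ∧
      -- not even a connected component of a pullback to a finite covering is homogeneous
      (∀ (M' : Type) (_ : TopologicalSpace M') (q : M' → P.M 0), IsFiniteConnectedCovering q →
        ∀ z : P.Pullback q, ¬ IsHomogeneousSpace (connectedComponent z)) := by
  refine ⟨Heisenberg.tower, Heisenberg.nonempty_chartedSpace_leaf, ⟨Heisenberg.lattice 0, QuotientGroup.mk, inferInstance,
    QuotientGroup.mk_surjective, Heisenberg.isLocalDiffeomorph_mk _, fun a b => QuotientGroup.eq,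
    Heisenberg.exists_isCoveringMap_leaf⟩, Heisenberg.hasExactPolynomialGrowth_leafGrowth,
    Heisenberg.not_isHomogeneousSpace_solenoid, Heisenberg.not_virtuallyHomogeneous_tower,
    fun M' _ q hq z => Heisenberg.not_isHomogeneousSpace_pullback hq z⟩
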